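/- Let $d\ge 1$, let $r=(r_1,\dots,r_d)$ be positive integers with $r_j\mid r_{j+1}$ for $1\le j<d$, and let $s>0$. Let $\mathbb H_d$ be the Heisenberg group, i.e. $\mathbb R^d\times\mathbb R^d\times\mathbb R$ with the product $(x,y,t)(x',y',t')=(x+x',y+y',t+t'+x\cdot y')$ (multiplication of the unipotent matrices with rows $(1,x,t)$, $(0,I,y^T)$, $(0,0,1)$), let $\Gamma_r=\{(x,y,t): x\in\mathbb Z^d,\ y\in r_1\mathbb Z\times\cdots\times r_d\mathbb Z,\ t\in\mathbb Z\}$, $|\Gamma_r|=r_1\cdots r_d$, and let $M=\Gamma_r\backslash\mathbb H_d$ carry the metric induced by the left-invariant metric $$g_s=\sum_j dx_j\otimes dx_j+\sum_j s^{-2}\,dy_j\otimes dy_j+s^{2d}\,\theta\otimes\theta,\qquad \theta=dt-\sum_j x_j\,dy_j .$$ Let $P_{1,g_s}=\Delta_{g_s}+\frac{N-2}{4(N-1)}R_{g_s}$, $N=2d+1$, be its Yamabe operator, where $\Delta_{g_s}\ge 0$ is the Laplace–Beltrami operator and $R_{g_s}$ the scalar curvature. Let $\Lambda'=\{(\xi,\eta)\in\mathbb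 R^d\times\mathbb R^d:\ \xi\cdot x+\eta\cdot y\in\mathbb Z$ for all $x\in\mathbb Z^d$, $y\in r_1\mathbb Z\times\cdots\times r_d\mathbb Z\}$ and $\chi_{(\xi,\eta)}(x,y,t)=e^{2i\pi(\xi\cdot x+\eta\cdot y)}$. For $n\in\mathbb Z\setminus\{0\}$ let $$\mathcal A_n=\Bigl\{a\in\mathbb R^d: a_j\in\bigl\{0,\tfrac1{|n|},\dots,\tfrac{|n|-1}{|n|}\bigr\}\Bigr\},\qquad \mathcal B_n=\Bigl\{b\in\mathbb R^d: b_j\in\bigl\{0,\tfrac1{|n|r_j},\dots,\tfrac{r_j-1}{|n|r_j}\bigr\}\Bigr\},$$ let $\mathcal H_n$ be the space of $f\in L^2(M)$ of the form $f(x,y,t)=e^{2i\pi nt}g(x,y)$, let $h_k(v)=(-1)^k e^{v^2/2}\frac{d^k}{dv^k}e^{-v^2}$ be the Hermite functions, and for $\alpha\in\mathbb N_0^d$, $|\alpha|=\sum_j\alpha_j$, put $f_\alpha(\xi)=\prod_j h_{\alpha_j}(\sqrt{2\pi|n|s}\,\xi_j)$. For $a\in\mathcal A_n$, $b\in\mathcal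 B_n$ let $$W_n^{a,b}f_\alpha(x,y,t)=e^{2i\pi nt}\sum_{k\in\mathbb Z^d}f_\alpha(x+k+a+b)\,e^{2i\pi n(k+a+b)\cdot y}.$$ These functions and the $\chi_{(\xi,\eta)}$, $(\xi,\eta)\in\Lambda'$, are $\Gamma_r$-invariant, hence functions on $M$. Then: 1. The family $\{\chi_{(\xi,\eta)}:(\xi,\eta)\in\Lambda'\}\cup\{W_n^{a,b}f_\alpha: n\in\mathbb Z\setminus\{0\},\ a\in\mathcal A_n,\ b\in\mathcal B_n,\ \alpha\in\mathbb N_0^d\}$ is an orthogonal basis of $L^2(M)$ (with respect to the Riemannian volume) consisting of smooth eigenfunctions of $P_{1,g_s}$. The series defining $W_n^{a,b}f_\alpha$ converge absolutely, $$W_n^{a,b}f_\alpha(x,y,t)=e^{2i\pi nt}\prod_{j=1}^d\ \sum_{k\in\mathbb Z}h_{\alpha_j}\bigl(\sqrt{2\pi|n|s}\,(x_j+k+a_j+b_j)\bigr)e^{2i\pi n(k+a_j+b_j)y_j},$$ and, with $\vartheta(z,\tau)=\sum_{k\in\mathbb Z}e^{i\pi k^2\tau}e^{2i\pi kz}$ and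 $\pm$ the sign of $n$, $$W_n^{a,b}f_0(x,y,t)=e^{2i\pi nt}e^{-\pi|n|s|x+a+b|^2}e^{2i\pi n(a+b)\cdot y}\prod_{j=1}^d\vartheta\bigl(n(y_j\pm is(x_j+a_j+b_j)),\,i|n|s\bigr).$$ 2. Each $\chi_{(\xi,\eta)}$, $(\xi,\eta)\in\Lambda'$, is an eigenfunction of $P_{1,g_s}$ with eigenvalue $4\pi^2(|\xi|^2+s^2|\eta|^2)-\frac{2d-1}{16}s^{2d+2}$. 3. Each $W_n^{a,b}f_\alpha$ lies in $\mathcal H_n$ and is an eigenfunction of $P_{1,g_s}$ with eigenvalue $\mu(n,|\alpha|)=2\pi|n|s(d+2|\alpha|)+4n^2s^{-2d}\pi^2-\frac{2d-1}{16}s^{2d+2}$. This eigenvalue has multiplicity $|n|^d|\Gamma_r|\binom{|\alpha|+d-1}{d-1}$ in $\mathcal H_n$, i.e. the space of smooth $u\in\mathcal H_n$ with $P_{1,g_s}u=\mu(n,|\alpha|)u$ has this dimension. -/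

import Mathlib

open MeasureTheory
open scoped Matrix ContDiff

noncomputable section

/-! Riemannian geometry in coordinates: a metric on `ℝ^ι` is its matrix-valued function `g`. -/

namespace CoordGeom

/-- The partial derivative `∂f/∂u_i` at `p`. -/
def partialDeriv {ι F : Type*} [Fintype ι] [DecidableEq ι] [NormedAddCommGroup F]
    [NormedSpace ℝ F] (i : ι) (f : (ι → ℝ) → F) (p : ι → ℝ) : F :=
  fderiv ℝ f p (Pi.single i 1)

/-- The Christoffel symbol `Γ^k_{ij}` of the Levi-Civita connection of `g`. -/
def christoffel {ι : Type*} [Fintype ι] [DecidableEq ι] (g : (ι → ℝ) → Matrix ι ι ℝ)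
    (k i j : ι) (p : ι → ℝ) : ℝ :=
  (1 / 2 : ℝ) * ∑ l, (g p)⁻¹ k l *
    (partialDeriv i (fun q => g q j l) p + partialDeriv j (fun q => g q i l) p
      - partialDeriv l (fun q => g q i j) p)

/-- The Ricci tensor `Ric_{ij}` of `g`; the round sphere has positive Ricci curvature. -/
def ricci {ι : Type*} [Fintype ι] [DecidableEq ι] (g : (ι → ℝ) → Matrix ι ι ℝ)
    (i j : ι) (p : ι → ℝ) : ℝ :=
  (∑ k, (partialDeriv k (christoffel g k i j) p - partialDeriv j (christoffel g k i k) p))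
    + ∑ k, ∑ l, (christoffel g k k l p * christoffel g l i j p
      - christoffel g k j l p * christoffel g l i k p)

/-- The scalar curvature `R_g = g^{ij} Ric_{ij}`. -/
def scalarCurvature {ι : Type*} [Fintype ι] [DecidableEq ι] (g : (ι → ℝ) → Matrix ι ι ℝ)
    (p : ι → ℝ) : ℝ :=
  ∑ i, ∑ j, (g p)⁻¹ i j * ricci g i j p

/-- The nonnegative Laplace-Beltrami operator
`Δ_g u = - (det g)^{-1/2} ∂_i ((det g)^{1/2} g^{ij} ∂_j u)`. -/
def laplacian {ι : Type*} [Fintype ι] [DecidableEq ι] (g : (ι → ℝ) → Matrix ι ι ℝ)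
    (u : (ι → ℝ) → ℂ) (p : ι → ℝ) : ℂ :=
  -((√(g p).det)⁻¹ • ∑ i, partialDeriv i
      (fun q => ∑ j, (√(g q).det * (g q)⁻¹ i j) • partialDeriv j u q) p)

/-- The Yamabe operator `P_{1,g} = Δ_g + (N - 2) / (4 (N - 1)) R_g` in dimension `N`. -/
def yamabe {ι : Type*} [Fintype ι] [DecidableEq ι] (g : (ι → ℝ) → Matrix ι ι ℝ)
    (u : (ι → ℝ) → ℂ) (p : ι → ℝ) : ℂ :=
  laplacian g u p
    + ((((Fintype.card ι : ℝ) - 2) / (4 * ((Fintype.card ι : ℝ) - 1))) * scalarCurvature g p) • u p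

/-- The Riemannian volume measure `(det g)^{1/2} du`. -/
def riemannianVolume {ι : Type*} [Fintype ι] [DecidableEq ι] (g : (ι → ℝ) → Matrix ι ι ℝ) :
    Measure (ι → ℝ) :=
  (volume : Measure (ι → ℝ)).withDensity (fun p => ENNReal.ofReal √(g p).det)

end CoordGeom

/-- The Heisenberg group `ℍ_d` in the coordinates `(x, y, t)`. -/
@[ext]
structure Heisenberg (d : ℕ) where
  x : Fin d → ℝ
  y : Fin d → ℝ
  t : ℝ

namespace Heisenberg

instance instMul (d : ℕ) : Mul (Heisenberg d) :=
  ⟨fun p q => ⟨p.x + q.x, p.y + q.y, p.t + q.t + p.x ⬝ᵥ q.y⟩⟩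

instance instOne (d : ℕ) : One (Heisenberg d) := ⟨⟨0, 0, 0⟩⟩

instance instInv (d : ℕ) : Inv (Heisenberg d) :=
  ⟨fun p => ⟨-p.x, -p.y, -p.t + p.x ⬝ᵥ p.y⟩⟩

@[simp] theorem mul_x {d : ℕ} (p q : Heisenberg d) : (p * q).x = p.x + q.x := rfl
@[simp] theorem mul_y {d : ℕ} (p q : Heisenberg d) : (p * q).y = p.y + q.y := rfl
@[simp] theorem mul_t {d : ℕ} (p q : Heisenberg d) :
    (p * q).t = p.t + q.t + p.x ⬝ᵥ q.y := rfl
@[simp] theorem one_x {d : ℕ} : (1 : Heisenberg d).x = 0 := rfl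
@[simp] theorem one_y {d : ℕ} : (1 : Heisenberg d).y = 0 := rfl
@[simp] theorem one_t {d : ℕ} : (1 : Heisenberg d).t = 0 := rfl
@[simp] theorem inv_x {d : ℕ} (p : Heisenberg d) : (p⁻¹).x = -p.x := rfl
@[simp] theorem inv_y {d : ℕ} (p : Heisenberg d) : (p⁻¹).y = -p.y := rfl
@[simp] theorem inv_t {d : ℕ} (p : Heisenberg d) : (p⁻¹).t = -p.t + p.x ⬝ᵥ p.y := rfl

instance instGroup (d : ℕ) : Group (Heisenberg d) :=
  Group.ofLeftAxioms
    (by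
      intro a b c
      ext <;> simp [add_assoc]
      ring)
    (by intro a; ext <;> simp)
    (by intro a; ext <;> simp)

/-- The unipotent matrix with rows `(1, x, t)`, `(0, I, yᵀ)`, `(0, 0, 1)`. -/
def toMatrix {d : ℕ} (p : Heisenberg d) : Matrix (Unit ⊕ Fin d ⊕ Unit) (Unit ⊕ Fin d ⊕ Unit) ℝ :=
  Matrix.fromBlocks 1 (Matrix.of fun _ => Sum.elim p.x (fun _ => p.t)) 0
    (Matrix.fromBlocks 1 (Matrix.of fun j _ => p.y j) 0 1)

/-- The group law of `ℍ_d` is multiplication of the unipotent matrices. -/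
theorem toMatrix_mul {d : ℕ} (p q : Heisenberg d) :
    (p * q).toMatrix = p.toMatrix * q.toMatrix := by
  ext i j
  rcases i with i | i | i <;> rcases j with j | j | j <;>
    simp [toMatrix, Matrix.mul_apply, Matrix.fromBlocks, Matrix.one_apply, dotProduct, add_comm,
      add_left_comm, add_assoc]

/-- The index set of the coordinates `x_1, …, x_d, y_1, …, y_d, t`. -/
abbrev CoordIndex (d : ℕ) : Type := Fin d ⊕ Fin d ⊕ Unit

/-- The global chart `(x, y, t)` of `ℍ_d`. -/
def coord (d : ℕ) : Heisenberg d ≃ (CoordIndex d → ℝ) where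
  toFun p := Sum.elim p.x (Sum.elim p.y (fun _ => p.t))
  invFun u := ⟨fun j => u (Sum.inl j), fun j => u (Sum.inr (Sum.inl j)), u (Sum.inr (Sum.inr ()))⟩
  left_inv p := rfl
  right_inv u := by
    ext i
    rcases i with i | i | i <;> rfl

instance instMeasurableSpace (d : ℕ) : MeasurableSpace (Heisenberg d) :=
  MeasurableSpace.comap (coord d) inferInstance

/-- The covector `dx_j`. -/
def dx {d : ℕ} (j : Fin d) : CoordIndex d → ℝ := Pi.single (Sum.inl j) 1

/-- The covector `dy_j`. -/
def dy {d : ℕ} (j : Fin d) : CoordIndex d → ℝ := Pi.single (Sum.inr (Sum.inl j)) 1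

/-- The covector `dt`. -/
def dt {d : ℕ} : CoordIndex d → ℝ := Pi.single (Sum.inr (Sum.inr ())) 1

/-- The contact form `θ = dt - ∑ x_j dy_j` at the point with coordinates `u`. -/
def contactForm {d : ℕ} (u : CoordIndex d → ℝ) : CoordIndex d → ℝ :=
  dt - ∑ j, u (Sum.inl j) • dy j

/-- The metric `g_s = ∑ dx_j ⊗ dx_j + ∑ s⁻² dy_j ⊗ dy_j + s^{2d} θ ⊗ θ`
(`vecMulVec α β` is the matrix of `α ⊗ β`). -/
def metric (d : ℕ) (s : ℝ) (u : CoordIndex d → ℝ) : Matrix (CoordIndex d) (CoordIndex d) ℝ :=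
  (∑ j, Matrix.vecMulVec (dx j) (dx j)) + (∑ j, (s ^ 2)⁻¹ • Matrix.vecMulVec (dy j) (dy j))
    + s ^ (2 * d) • Matrix.vecMulVec (contactForm u) (contactForm u)

/-- A finite sum of products of integers is an integer. -/
theorem exists_int_dotProduct {d : ℕ} {v w : Fin d → ℝ} (hv : ∀ j, ∃ m : ℤ, v j = m)
    (hw : ∀ j, ∃ m : ℤ, w j = m) : ∃ m : ℤ, v ⬝ᵥ w = m := by
  choose f hf using hv
  choose g hg using hw
  exact ⟨∑ j, f j * g j, by simp [dotProduct, hf, hg]⟩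

/-- The lattice `Γ_r`: `x ∈ ℤ^d`, `y ∈ r_1 ℤ × ⋯ × r_d ℤ`, `t ∈ ℤ`. -/
def lattice (d : ℕ) (r : Fin d → ℕ) : Subgroup (Heisenberg d) where
  carrier := {p | (∀ j, ∃ m : ℤ, p.x j = m) ∧ (∀ j, ∃ m : ℤ, p.y j = r j * m) ∧
    ∃ m : ℤ, p.t = m}
  mul_mem' := by
    rintro p q ⟨hx, hy, m, hm⟩ ⟨hx', hy', m', hm'⟩
    obtain ⟨l, hl⟩ := exists_int_dotProduct hx
      (fun j => (hy' j).elim fun k hk => ⟨r j * k, by simpa using hk⟩)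
    refine ⟨fun j => ?_, fun j => ?_, ⟨m + m' + l, by simp [hm, hm', hl]⟩⟩
    · obtain ⟨a, ha⟩ := hx j
      obtain ⟨b, hb⟩ := hx' j
      exact ⟨a + b, by simp [ha, hb]⟩
    · obtain ⟨a, ha⟩ := hy j
      obtain ⟨b, hb⟩ := hy' j
      exact ⟨a + b, by simp [ha, hb, mul_add]⟩
  one_mem' := ⟨fun j => ⟨0, by simp⟩, fun j => ⟨0, by simp⟩, ⟨0, by simp⟩⟩
  inv_mem' := by
    rintro p ⟨hx, hy, m, hm⟩
    obtain ⟨l, hl⟩ := exists_int_dotProduct hx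
      (fun j => (hy j).elim fun k hk => ⟨r j * k, by simpa using hk⟩)
    refine ⟨fun j => ?_, fun j => ?_, ⟨-m + l, by simp [hm, hl]⟩⟩
    · obtain ⟨a, ha⟩ := hx j
      exact ⟨-a, by simp [ha]⟩
    · obtain ⟨a, ha⟩ := hy j
      exact ⟨-a, by simp [ha]⟩

/-- The nilmanifold `M = Γ_r \ ℍ_d`: two points are identified when they differ by left
multiplication by an element of `Γ_r`. -/
abbrev Nilmanifold (d : ℕ) (r : Fin d → ℕ) : Type :=
  Quotient (QuotientGroup.rightRel (lattice d r))

/-- The projection `ℍ_d → M`. -/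
def proj {d : ℕ} (r : Fin d → ℕ) (p : Heisenberg d) : Nilmanifold d r :=
  Quotient.mk (QuotientGroup.rightRel (lattice d r)) p

/-- A `Γ_r`-invariant function on `ℍ_d` as a function on `M`. -/
def descend {d : ℕ} {r : Fin d → ℕ} (F : Heisenberg d → ℂ)
    (hF : ∀ γ ∈ lattice d r, ∀ p, F (γ * p) = F p) : Nilmanifold d r → ℂ :=
  Quotient.lift F (by
    intro p q hpq
    have h : q * p⁻¹ ∈ lattice d r := QuotientGroup.rightRel_apply.mp hpq
    simpa using (hF _ h p).symm)

/-- The coordinate expression of a function on `M` in the charts given by `ℍ_d → M`. -/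
def pullback {d : ℕ} {r : Fin d → ℕ} (u : Nilmanifold d r → ℂ) (v : CoordIndex d → ℝ) : ℂ :=
  u (proj r ((coord d).symm v))

/-- The fundamental domain `D = [0,1)^d × [0,r_1) × ⋯ × [0,r_d) × [0,1)` of `Γ_r`. -/
def fundamentalDomain (d : ℕ) (r : Fin d → ℕ) : Set (CoordIndex d → ℝ) :=
  {u | (∀ j, u (Sum.inl j) ∈ Set.Ico (0 : ℝ) 1) ∧
    (∀ j, u (Sum.inr (Sum.inl j)) ∈ Set.Ico (0 : ℝ) (r j)) ∧
    u (Sum.inr (Sum.inr ())) ∈ Set.Ico (0 : ℝ) 1}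

/-- The Riemannian volume measure of `(M, g_s)`. -/
def volumeM (d : ℕ) (r : Fin d → ℕ) (s : ℝ) : Measure (Nilmanifold d r) :=
  ((CoordGeom.riemannianVolume (metric d s)).restrict (fundamentalDomain d r)).map
    (fun v => proj r ((coord d).symm v))

/-- Smooth functions on `M`. -/
def SmoothM {d : ℕ} {r : Fin d → ℕ} (u : Nilmanifold d r → ℂ) : Prop :=
  ContDiff ℝ ∞ (pullback u)

/-- `P_{1,g_s} u = lam u` on `M`. Since `ℍ_d → M` is a local isometry, the Yamabe operator of
`(M, g_s)` is read off in the coordinates `(x, y, t)`. -/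
def YamabeEq {d : ℕ} {r : Fin d → ℕ} (s lam : ℝ) (u : Nilmanifold d r → ℂ) : Prop :=
  ∀ v, CoordGeom.yamabe (metric d s) (pullback u) v = (lam : ℂ) * pullback u v

/-- `u` is a (smooth, nonzero) eigenfunction of `P_{1,g_s}` on `M` with eigenvalue `lam`. -/
def IsYamabeEigenfunction {d : ℕ} {r : Fin d → ℕ} (s lam : ℝ) (u : Nilmanifold d r → ℂ) : Prop :=
  SmoothM u ∧ u ≠ 0 ∧ YamabeEq s lam u

/-- `u(x, y, t) = e^{2iπnt} g(x, y)` for some `g`. -/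
def InHn {d : ℕ} {r : Fin d → ℕ} (n : ℤ) (u : Nilmanifold d r → ℂ) : Prop :=
  ∃ g : (Fin d → ℝ) → (Fin d → ℝ) → ℂ, ∀ x y t,
    u (proj r ⟨x, y, t⟩) = Complex.exp (2 * Real.pi * Complex.I * n * t) * g x y

/-- The dual lattice `Λ'` of `Λ = ℤ^d × (r_1 ℤ × ⋯ × r_d ℤ)`. -/
def dualLattice (d : ℕ) (r : Fin d → ℕ) : Set ((Fin d → ℝ) × (Fin d → ℝ)) :=
  {p | ∀ x y : Fin d → ℝ, (∀ j, ∃ m : ℤ, x j = m) → (∀ j, ∃ m : ℤ, y j = r j * m) →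
    ∃ m : ℤ, p.1 ⬝ᵥ x + p.2 ⬝ᵥ y = m}

/-- The character `χ_{(ξ,η)}(x, y, t) = e^{2iπ(ξ·x + η·y)}` of `ℍ_d`. -/
def character {d : ℕ} (ξ η : Fin d → ℝ) (p : Heisenberg d) : ℂ :=
  Complex.exp (2 * Real.pi * Complex.I * ((ξ ⬝ᵥ p.x + η ⬝ᵥ p.y : ℝ) : ℂ))

/-- The numbers `a` with `a_j ∈ {0, 1/|n|, …, (|n|-1)/|n|}`. -/
def setA (d : ℕ) (n : ℤ) : Set (Fin d → ℝ) :=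
  {a | ∀ j, ∃ i : ℕ, i < n.natAbs ∧ a j = (i : ℝ) / n.natAbs}

/-- The numbers `b` with `b_j ∈ {0, 1/(|n| r_j), …, (r_j-1)/(|n| r_j)}`. -/
def setB (d : ℕ) (r : Fin d → ℕ) (n : ℤ) : Set (Fin d → ℝ) :=
  {b | ∀ j, ∃ i : ℕ, i < r j ∧ b j = (i : ℝ) / (n.natAbs * r j)}

/-- `W_n^{a,b} f (x, y, t) = e^{2iπnt} ∑_{k ∈ ℤ^d} f(x + k + a + b) e^{2iπn(k + a + b)·y}`. -/
def weilBrezin {d : ℕ} (n : ℤ) (a b : Fin d → ℝ) (f : (Fin d → ℝ) → ℂ) (p : Heisenberg d) : ℂ :=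
  Complex.exp (2 * Real.pi * Complex.I * n * p.t) *
    ∑' k : Fin d → ℤ, f (p.x + (fun j => (k j : ℝ)) + a + b) *
      Complex.exp (2 * Real.pi * Complex.I * n *
        ((((fun j => (k j : ℝ)) + a + b) ⬝ᵥ p.y : ℝ) : ℂ))

/-- The Hermite function `h_k(v) = (-1)^k e^{v²/2} (d/dv)^k e^{-v²}`. -/
def hermiteFun (k : ℕ) (v : ℝ) : ℝ :=
  (-1) ^ k * Real.exp (v ^ 2 / 2) * iteratedDeriv k (fun w : ℝ => Real.exp (-w ^ 2)) v

/-- `f_α(ξ) = ∏ h_{α_j}(√(2π|n|s) ξ_j)`. -/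
def fAlpha {d : ℕ} (s : ℝ) (n : ℤ) (α : Fin d → ℕ) (ξ : Fin d → ℝ) : ℂ :=
  ((∏ j, hermiteFun (α j) (√(2 * Real.pi * |(n : ℝ)| * s) * ξ j) : ℝ) : ℂ)

theorem exp_two_pi_int (m : ℤ) : Complex.exp (2 * Real.pi * Complex.I * (m : ℂ)) = 1 := by
  rw [mul_comm]
  exact Complex.exp_int_mul_two_pi_mul_I m

theorem character_invariant {d : ℕ} {r : Fin d → ℕ} {ξ η : Fin d → ℝ}
    (h : (ξ, η) ∈ dualLattice d r) :
    ∀ γ ∈ lattice d r, ∀ p, character ξ η (γ * p) = character ξ η p := by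
  rintro γ ⟨hx, hy, -⟩ p
  obtain ⟨m, hm⟩ := h γ.x γ.y hx hy
  have e : ξ ⬝ᵥ (γ * p).x + η ⬝ᵥ (γ * p).y = m + (ξ ⬝ᵥ p.x + η ⬝ᵥ p.y) := by
    simp only [mul_x, mul_y, dotProduct_add, ← hm]
    ring
  simp only [character, e]
  rw [Complex.ofReal_add, mul_add, Complex.exp_add, Complex.ofReal_intCast, exp_two_pi_int,
    one_mul]

theorem weilBrezin_invariant {d : ℕ} {r : Fin d → ℕ} {n : ℤ} {a b : Fin d → ℝ}
    (ha : a ∈ setA d n) (hb : b ∈ setB d r n) (f : (Fin d → ℝ) → ℂ) :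
    ∀ γ ∈ lattice d r, ∀ p, weilBrezin n a b f (γ * p) = weilBrezin n a b f p := by
  rintro γ ⟨hx, hy, l, hl⟩ p
  have hint : ∀ k : Fin d → ℤ, ∃ m : ℤ, n * (((fun j => (k j : ℝ)) + a + b) ⬝ᵥ γ.y) = (m : ℝ) := by
    intro k
    have h1 : ∀ j, ∃ m : ℤ, n * ((k j + a j + b j) * γ.y j) = (m : ℝ) := by
      intro j
      obtain ⟨i, hi, hai⟩ := ha j
      obtain ⟨i', hi', hbi⟩ := hb j
      obtain ⟨m, hm⟩ := hy j
      have hn : (n.natAbs : ℝ) ≠ 0 := by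
        have : 0 < n.natAbs := by omega
        positivity
      have hr : (r j : ℝ) ≠ 0 := by
        have : 0 < r j := by omega
        positivity
      have hs : (n : ℝ) = n.sign * n.natAbs := by
        have h := congrArg (fun z : ℤ => (z : ℝ)) (Int.sign_mul_natAbs n).symm
        push_cast at h
        simpa using h
      refine ⟨n * k j * r j * m + n.sign * i * r j * m + n.sign * i' * m, ?_⟩
      rw [hai, hbi, hm]
      push_cast
      rw [hs]
      field_simp
    choose g hg using h1
    refine ⟨∑ j, g j, ?_⟩
    rw [dotProduct, Finset.mul_sum]
    push_cast
    exact Finset.sum_congr rfl fun j _ => by simpa using hg j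
  choose c hc using hx
  have hcx : γ.x = fun j => (c j : ℝ) := funext hc
  simp only [weilBrezin]
  rw [← (Equiv.addRight c).tsum_eq (fun k : Fin d → ℤ =>
    f (p.x + (fun j => (k j : ℝ)) + a + b) * Complex.exp (2 * Real.pi * Complex.I * n *
        ((((fun j => (k j : ℝ)) + a + b) ⬝ᵥ p.y : ℝ) : ℂ))), ← tsum_mul_left, ← tsum_mul_left]
  refine tsum_congr fun k => ?_
  obtain ⟨m, hm⟩ := hint k
  have e1 : (γ * p).x + (fun j => (k j : ℝ)) + a + b
      = p.x + (fun j => ((Equiv.addRight c k) j : ℝ)) + a + b := by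
    ext j
    simp [hcx]
    ring
  have e2 : (fun j => ((Equiv.addRight c k) j : ℝ)) + a + b
      = γ.x + ((fun j => (k j : ℝ)) + a + b) := by
    ext j
    simp [hcx]
    ring
  have hm' : (n : ℂ) * ((((fun j => (k j : ℝ)) + a + b) ⬝ᵥ γ.y : ℝ) : ℂ) = (m : ℂ) := by
    exact_mod_cast congrArg (fun z : ℝ => (z : ℂ)) hm
  rw [e1, e2]
  have e3 : ∀ A B C : ℂ, A * (B * C) = B * (A * C) := fun A B C => by ring
  rw [e3, e3 _ (f _)]
  congr 1
  rw [← Complex.exp_add, ← Complex.exp_add]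
  have e4 : 2 * Real.pi * Complex.I * n * ((γ * p).t : ℂ) + 2 * Real.pi * Complex.I * n *
        ((((fun j => (k j : ℝ)) + a + b) ⬝ᵥ (γ * p).y : ℝ) : ℂ)
      = (2 * Real.pi * Complex.I * n * (p.t : ℂ) + 2 * Real.pi * Complex.I * n *
        (((γ.x + ((fun j => (k j : ℝ)) + a + b)) ⬝ᵥ p.y : ℝ) : ℂ))
        + 2 * Real.pi * Complex.I * ((n * l + m : ℤ) : ℂ) := by
    simp only [mul_t, mul_y, dotProduct_add, add_dotProduct, hl] at hm' ⊢
    push_cast at hm' ⊢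
    rw [← hm']
    ring
  rw [e4, Complex.exp_add _ (2 * Real.pi * Complex.I * ((n * l + m : ℤ) : ℂ)), exp_two_pi_int,
    mul_one]

/-- `χ_{(ξ,η)}`, `(ξ,η) ∈ Λ'`, as a function on `M`. -/
def chiM {d : ℕ} {r : Fin d → ℕ} (p : dualLattice d r) : Nilmanifold d r → ℂ :=
  descend (character p.1.1 p.1.2) (character_invariant p.2)

/-- `W_n^{a,b} f_α`, `a ∈ 𝒜_n`, `b ∈ ℬ_n`, as a function on `M`. -/
def wM {d : ℕ} {r : Fin d → ℕ} (s : ℝ) (n : ℤ) (a : setA d n) (b : setB d r n) (α : Fin d → ℕ) :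
    Nilmanifold d r → ℂ :=
  descend (weilBrezin n a b (fAlpha s n α)) (weilBrezin_invariant a.2 b.2 _)

/-- The index set `Λ' ⊔ {(n, a, b, α)}` of the eigenbasis. -/
abbrev EigenIndex (d : ℕ) (r : Fin d → ℕ) : Type :=
  dualLattice d r ⊕ (Σ n : {n : ℤ // n ≠ 0}, setA d n × setB d r n × (Fin d → ℕ))

/-- The joint family of the `χ_{(ξ,η)}` and the `W_n^{a,b} f_α`. -/
def eigenFamily {d : ℕ} {r : Fin d → ℕ} (s : ℝ) : EigenIndex d r → Nilmanifold d r → ℂ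
  | Sum.inl p => chiM p
  | Sum.inr ⟨n, a, b, α⟩ => wM s n a b α

/-- The eigenvalue of `χ_{(ξ,η)}`. -/
def lambdaChar {d : ℕ} (s : ℝ) (ξ η : Fin d → ℝ) : ℝ :=
  4 * Real.pi ^ 2 * (ξ ⬝ᵥ ξ + s ^ 2 * (η ⬝ᵥ η)) - (2 * d - 1) / 16 * s ^ (2 * d + 2)

/-- The eigenvalue `μ(n, m)` of `W_n^{a,b} f_α`, `m = |α|`. -/
def muW (d : ℕ) (s : ℝ) (n : ℤ) (m : ℕ) : ℝ :=
  2 * Real.pi * |(n : ℝ)| * s * (d + 2 * m) + 4 * n ^ 2 * (s ^ (2 * d))⁻¹ * Real.pi ^ 2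
    - (2 * d - 1) / 16 * s ^ (2 * d + 2)

end Heisenberg

end

/-!
In the coordinates `(x, y, t)` the metric has determinant one, its inverse is explicit, and its
scalar curvature is the constant `-(d / 2) s ^ (2 d + 2)` (`det_metric`, `scalarCurvature_metric`).
With the left-invariant fields `X_j = ∂/∂x_j`, `Y_j = s (∂/∂y_j + x_j ∂/∂t)`, the Yamabe operator is
therefore `-∑_j (X_j² + Y_j²) - s^{-2d} ∂²/∂t²` plus a constant. On functions of central frequency
`n`, those which transform by `e^{2iπnt}` under translations in `t`, the middle term is a constant
too, so everything is about the operators `X_j² + Y_j²` (`oscillator`, `HasFrequency.yamabe`).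

*Eigenfunctions.* A product of series is a series of products, so `W_n^{a,b} f_α` is
`e^{2iπnt}` times a product over `j` of one-dimensional series `hermiteTheta`. The relations
`v h_k = k h_{k-1} + h_{k+1} / 2` and `h_k' = k h_{k-1} - h_{k+1} / 2` express the derivatives of
such a series through the series for `k ± 1`. This gives smoothness, and shows that
`W_n^{a,b} f_α` is an eigenfunction of every `X_j² + Y_j²`, with eigenvalue `-2π|n|s (2 α_j + 1)`
(`oscillator_hermiteThetaProd`). The terms of `h_0` complete the square to those of Jacobi's theta
function.

*Orthogonality.* If the integrand over the box `D = [0,1)^d × ∏_j [0,r_j) × [0,1)` is periodic in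
one coordinate and some translation in that coordinate multiplies it by `c ≠ 1`, its integral
vanishes (`integral_box_eq_zero_of_shift`). This separates distinct central frequencies, distinct
characters, and, by translation by `1/n` in `y_j`, the functions `W_n^{a,b} f_α` with
different `a + b`; and `a + b` determines `a` and `b`. Different `α` are
separated by the symmetry of `X_j² + Y_j²` (`pairing_oscillator`), obtained from
integration by parts along a coordinate.

*Completeness* (`ae_eq_zero_of_pairing_eigenFamily_eq_zero`). Let `F` be orthogonal to the whole
family. It suffices that the Fourier coefficients of `F` on `D` vanish. Those of frequency zero in
`t` are pairings with characters. For `n ≠ 0`, the pairing of `F` with `W_n^{a,b} f_α` unfolds to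
the integral over `ℤ^d × D` of `f_α(x + k + a + b)` against a fixed density, independent of `α`
(`integral_unfoldDensity`). Since these vanish for all `α`, completeness of the Hermite functions
(`integral_comp_mul_gaussian_eq_zero`) allows `f_α` to be replaced by a function supported in the
translate by `k + a + b` of the unit cube, which picks out the `k`-th term and hence a Fourier
coefficient of `F` with frequency `n (k + a + b)` in `y` (`integral_exp_mul_eq_zero_of_pairing`).
Every element of `∏_j r_j⁻¹ ℤ` has the form `n (k + a + b)` (`exists_offset`). Completeness of the
Hermite functions itself follows from the uniqueness of characteristic functions, as a Gaussian
times a character is a convergent series of Gaussians times polynomials.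

*Multiplicity.* The eigenspace for `μ(n, m)` in `ℋ_n` contains the functions `W_n^{a,b} f_α` with
`|α| = m`. An element of it orthogonal to these is orthogonal to the whole family, by symmetry of
`X_j² + Y_j²`, hence is zero. So these functions form a basis (`span_levelFamily`,
`linearIndependent_levelFamily`), and they are counted by `card_levelIndex`.
-/

noncomputable section

namespace Heisenberg

/-! ### Hermite functions -/

theorem contDiff_gaussian : ContDiff ℝ ∞ (fun w : ℝ => Real.exp (-w ^ 2)) := by fun_prop

theorem hasDerivAt_iteratedDeriv_gaussian (k : ℕ) (v : ℝ) :
    HasDerivAt (iteratedDeriv k fun w : ℝ => Real.exp (-w ^ 2))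
      (iteratedDeriv (k + 1) (fun w : ℝ => Real.exp (-w ^ 2)) v) v := by
  rw [iteratedDeriv_succ]
  exact ((contDiff_gaussian.differentiable_iteratedDeriv k (by exact_mod_cast WithTop.coe_lt_top _))
    v).hasDerivAt

theorem iteratedDeriv_gaussian_one (v : ℝ) :
    iteratedDeriv 1 (fun w : ℝ => Real.exp (-w ^ 2)) v = -2 * v * Real.exp (-v ^ 2) := by
  rw [iteratedDeriv_one]
  have h : HasDerivAt (fun w : ℝ => Real.exp (-w ^ 2)) (Real.exp (-v ^ 2) * -(2 * v)) v := by
    simpa using ((hasDerivAt_pow 2 v).neg).exp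
  rw [h.deriv]
  ring

/-- The three-term recursion for the derivatives of the Gaussian: the relation `g' = -2 v g` for
`g = e^{-v²}`, differentiated `k` times. -/
theorem iteratedDeriv_gaussian_succ (k : ℕ) (v : ℝ) :
    iteratedDeriv (k + 1) (fun w : ℝ => Real.exp (-w ^ 2)) v =
      -2 * v * iteratedDeriv k (fun w : ℝ => Real.exp (-w ^ 2)) v
        - 2 * k * iteratedDeriv (k - 1) (fun w : ℝ => Real.exp (-w ^ 2)) v := by
  induction k generalizing v with
  | zero => simp [iteratedDeriv_gaussian_one, iteratedDeriv_zero]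
  | succ k ih =>
    refine (hasDerivAt_iteratedDeriv_gaussian (k + 1) v).unique ?_
    have h2 : HasDerivAt (fun v : ℝ => -2 * v) (-2) v := by
      simpa using (hasDerivAt_id v).const_mul (-2 : ℝ)
    have h1 := h2.fun_mul (hasDerivAt_iteratedDeriv_gaussian k v)
    rw [show iteratedDeriv (k + 1) (fun w : ℝ => Real.exp (-w ^ 2)) = _ from funext ih]
    rcases k with _ | k
    · simp only [Nat.cast_zero, mul_zero, zero_mul, sub_zero]
      refine h1.congr_deriv ?_
      simp [ih]
      ring
    · have h3 := (hasDerivAt_iteratedDeriv_gaussian k v).const_mul (2 * ((k + 1 : ℕ) : ℝ))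
      refine (h1.fun_sub h3).congr_deriv ?_
      simp only [Nat.add_sub_cancel, ih v]
      push_cast
      ring

theorem hermiteFun_zero (v : ℝ) : hermiteFun 0 v = Real.exp (-v ^ 2 / 2) := by
  simp only [hermiteFun, pow_zero, one_mul, iteratedDeriv_zero, ← Real.exp_add]
  congr 1
  ring

theorem hermiteFun_succ (k : ℕ) (v : ℝ) :
    hermiteFun (k + 1) v = 2 * v * hermiteFun k v - 2 * k * hermiteFun (k - 1) v := by
  rcases k with _ | k
  · simp [hermiteFun, iteratedDeriv_gaussian_one]
    ring
  · simp only [hermiteFun, iteratedDeriv_gaussian_succ (k + 1), Nat.add_sub_cancel]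
    push_cast
    ring

/-- Multiplication by `v` in terms of lowering and raising the index. For `k = 0` the truncated
`k - 1` comes with the factor zero. -/
theorem mul_hermiteFun (k : ℕ) (v : ℝ) :
    v * hermiteFun k v = k * hermiteFun (k - 1) v + hermiteFun (k + 1) v / 2 := by
  rw [hermiteFun_succ]; ring

theorem hasDerivAt_hermiteFun (k : ℕ) (v : ℝ) :
    HasDerivAt (hermiteFun k) (k * hermiteFun (k - 1) v - hermiteFun (k + 1) v / 2) v := by
  have h0 : HasDerivAt (fun v : ℝ => v ^ 2 / 2) v v := by
    simpa using (hasDerivAt_pow 2 v).div_const 2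
  have h := (h0.exp.const_mul ((-1 : ℝ) ^ k)).fun_mul (hasDerivAt_iteratedDeriv_gaussian k v)
  have e : k * hermiteFun (k - 1) v - hermiteFun (k + 1) v / 2
      = v * hermiteFun k v - hermiteFun (k + 1) v := by
    rw [mul_hermiteFun]; ring
  rw [e]
  refine h.congr_deriv ?_
  simp only [hermiteFun]
  ring

theorem continuous_hermiteFun (k : ℕ) : Continuous (hermiteFun k) :=
  continuous_iff_continuousAt.2 fun v => (hasDerivAt_hermiteFun k v).continuousAt

/-- Hermite functions decay faster than any exponential. -/
theorem exists_abs_hermiteFun_le (k : ℕ) (A : ℝ) :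
    ∃ C, 0 ≤ C ∧ ∀ v, |hermiteFun k v| ≤ C * Real.exp (-A * |v|) := by
  induction k using Nat.strong_induction_on generalizing A with
  | _ k ih =>
    rcases k with _ | k
    · refine ⟨Real.exp (A ^ 2 / 2), (Real.exp_pos _).le, fun v => ?_⟩
      rw [hermiteFun_zero, abs_of_pos (Real.exp_pos _), ← Real.exp_add, Real.exp_le_exp]
      nlinarith [sq_nonneg (A - |v|), sq_abs v]
    · obtain ⟨C₁, hC₁, h₁⟩ := ih k (by omega) (A + 1)
      obtain ⟨C₂, hC₂, h₂⟩ := ih (k - 1) (by omega) A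
      refine ⟨2 * C₁ + 2 * k * C₂, by positivity, fun v => ?_⟩
      rw [hermiteFun_succ]
      have h3 : |v| ≤ Real.exp |v| := by linarith [Real.add_one_le_exp |v|]
      calc |2 * v * hermiteFun k v - 2 * k * hermiteFun (k - 1) v|
          ≤ |2 * v * hermiteFun k v| + |2 * k * hermiteFun (k - 1) v| := abs_sub _ _
        _ = 2 * (|v| * |hermiteFun k v|) + 2 * k * |hermiteFun (k - 1) v| := by
            simp only [abs_mul, abs_two, Nat.abs_cast]; ring
        _ ≤ 2 * (Real.exp |v| * (C₁ * Real.exp (-(A + 1) * |v|)))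
              + 2 * k * (C₂ * Real.exp (-A * |v|)) := by
            gcongr
            · exact h₁ v
            · exact h₂ v
        _ = (2 * C₁ + 2 * k * C₂) * Real.exp (-A * |v|) := by
            rw [show -A * |v| = |v| + -(A + 1) * |v| by ring, Real.exp_add]; ring

/-! ### One-dimensional Hermite theta series -/

/-- The product of `d` absolutely convergent series over `ℤ` is an absolutely convergent series over
`ℤ^d`. -/
theorem hasSum_prod_of_summable_norm (d : ℕ) (g : Fin d → ℤ → ℂ)
    (hg : ∀ j, Summable fun m => ‖g j m‖) :
    HasSum (fun k : Fin d → ℤ => ∏ j, g j (k j)) (∏ j, ∑' m, g j m) ∧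
      Summable fun k : Fin d → ℤ => ‖∏ j, g j (k j)‖ := by
  induction d with
  | zero =>
    constructor
    · simp [hasSum_unique]
    · exact (hasSum_unique (fun k : Fin 0 → ℤ => ‖∏ j, g j (k j)‖)).summable
  | succ d ih =>
    obtain ⟨h1, h2⟩ := ih (fun j => g j.succ) (fun j => hg j.succ)
    set F := (fun k : Fin d → ℤ => ∏ j, g j.succ (k j))
    have h2' : Summable fun k => ‖F k‖ := h2
    have h3 := (hg 0).mul_norm h2'
    have h4 := (hg 0).of_norm.hasSum.mul h1 h3.of_norm
    constructor
    · rw [Fin.prod_univ_succ, ← (Fin.consEquiv fun _ => ℤ).hasSum_iff]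
      refine h4.congr_fun fun x => ?_
      simp [F, Fin.prod_univ_succ]
    · rw [← (Fin.consEquiv fun _ => ℤ).summable_iff]
      refine h3.congr fun x => ?_
      simp [F, Fin.prod_univ_succ]

theorem summable_exp_neg_mul_abs {ν : ℝ} (hν : 0 < ν) :
    Summable fun m : ℤ => Real.exp (-ν * |(m : ℝ)|) := by
  have h : Summable fun m : ℕ => Real.exp (-ν * (m : ℝ)) := by
    simpa [mul_comm] using Real.summable_exp_nat_mul_iff.2 (neg_lt_zero.2 hν)
  refine Summable.of_nat_of_neg ?_ ?_ <;> simpa using h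

/-- The `m`-th term of `hermiteTheta`. -/
def hermiteThetaTerm (n : ℤ) (ν c : ℝ) (k : ℕ) (m : ℤ) (p : ℝ × ℝ) : ℂ :=
  (hermiteFun k (ν * (p.1 + m + c)) : ℂ) *
    Complex.exp (2 * Real.pi * Complex.I * n * (m + c) * p.2)

/-- The theta series `∑_{m ∈ ℤ} h_k(ν (x + m + c)) e^{2iπn(m + c)y}`, the one-dimensional factor
of the functions `W_n^{a,b} f_α`. -/
def hermiteTheta (n : ℤ) (ν c : ℝ) (k : ℕ) (p : ℝ × ℝ) : ℂ :=
  ∑' m : ℤ, hermiteThetaTerm n ν c k m p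

theorem norm_exp_two_pi (x : ℝ) : ‖Complex.exp (2 * Real.pi * Complex.I * x)‖ = 1 := by
  rw [show (2 * Real.pi * Complex.I * x : ℂ) = ((2 * Real.pi * x : ℝ) : ℂ) * Complex.I by
    push_cast; ring]
  exact Complex.norm_exp_ofReal_mul_I _

theorem norm_hermiteThetaTerm (n : ℤ) (ν c : ℝ) (k : ℕ) (m : ℤ) (p : ℝ × ℝ) :
    ‖hermiteThetaTerm n ν c k m p‖ = |hermiteFun k (ν * (p.1 + m + c))| := by
  have h := norm_exp_two_pi (n * (m + c) * p.2)
  push_cast at h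
  rw [hermiteThetaTerm, norm_mul, mul_assoc _ (n : ℂ), mul_assoc _ ((n : ℂ) * _), h, mul_one,
    Complex.norm_real, Real.norm_eq_abs]

/-- Locally uniform domination of translated Hermite functions by a convergent series. -/
theorem exists_hermiteFun_translate_le {ν : ℝ} (hν : 0 < ν) (c R : ℝ) (k : ℕ) :
    ∃ B, 0 ≤ B ∧ ∀ (m : ℤ) (x : ℝ), |x| ≤ R →
      |hermiteFun k (ν * (x + m + c))| ≤ B * Real.exp (-ν * |(m : ℝ)|) := by
  obtain ⟨C, hC, h⟩ := exists_abs_hermiteFun_le k 1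
  refine ⟨C * Real.exp (ν * (R + |c|)), by positivity, fun m x hx => (h _).trans ?_⟩
  rw [mul_assoc, ← Real.exp_add]
  gcongr
  have h1 : |(m : ℝ)| ≤ |x + m + c| + (R + |c|) := by
    have := abs_sub_abs_le_abs_sub (m : ℝ) (-(x + c))
    rw [abs_neg, show (m : ℝ) - -(x + c) = x + m + c by ring] at this
    linarith [abs_add_le x c]
  rw [abs_mul, abs_of_pos hν]
  nlinarith

theorem summable_norm_hermiteThetaTerm (n : ℤ) {ν : ℝ} (hν : 0 < ν) (c : ℝ) (k : ℕ) (p : ℝ × ℝ) :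
    Summable fun m => ‖hermiteThetaTerm n ν c k m p‖ := by
  obtain ⟨B, -, h⟩ := exists_hermiteFun_translate_le hν c |p.1| k
  refine Summable.of_nonneg_of_le (fun _ => norm_nonneg _) (fun m => ?_)
    ((summable_exp_neg_mul_abs hν).mul_left B)
  rw [norm_hermiteThetaTerm]
  exact h m _ le_rfl

/-- The `x`-derivative of `h_k(ν (x + m + c)) e^{2iπn(m + c)y}`, through the lowering and raising of
Hermite functions. -/
def hermiteThetaTermX (n : ℤ) (ν c : ℝ) (k : ℕ) (m : ℤ) (p : ℝ × ℝ) : ℂ :=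
  ν * (k * hermiteThetaTerm n ν c (k - 1) m p - hermiteThetaTerm n ν c (k + 1) m p / 2)

/-- The `y`-derivative of `h_k(ν (x + m + c)) e^{2iπn(m + c)y}`, through the lowering and raising of
Hermite functions. -/
def hermiteThetaTermY (n : ℤ) (ν c : ℝ) (k : ℕ) (m : ℤ) (p : ℝ × ℝ) : ℂ :=
  2 * Real.pi * Complex.I * n * ((ν : ℂ)⁻¹ *
    (k * hermiteThetaTerm n ν c (k - 1) m p + hermiteThetaTerm n ν c (k + 1) m p / 2)
      - p.1 * hermiteThetaTerm n ν c k m p)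

/-- The `x`-derivative of `hermiteTheta`. -/
def hermiteThetaX (n : ℤ) (ν c : ℝ) (k : ℕ) (p : ℝ × ℝ) : ℂ :=
  ν * (k * hermiteTheta n ν c (k - 1) p - hermiteTheta n ν c (k + 1) p / 2)

/-- The `y`-derivative of `hermiteTheta`. -/
def hermiteThetaY (n : ℤ) (ν c : ℝ) (k : ℕ) (p : ℝ × ℝ) : ℂ :=
  2 * Real.pi * Complex.I * n * ((ν : ℂ)⁻¹ *
    (k * hermiteTheta n ν c (k - 1) p + hermiteTheta n ν c (k + 1) p / 2)
      - p.1 * hermiteTheta n ν c k p)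

/-- The real-linear form `(h₁, h₂) ↦ A h₁ + B h₂`. -/
def gradForm (A B : ℂ) : ℝ × ℝ →L[ℝ] ℂ :=
  (ContinuousLinearMap.fst ℝ ℝ ℝ).smulRight A + (ContinuousLinearMap.snd ℝ ℝ ℝ).smulRight B

@[simp] theorem gradForm_apply (A B : ℂ) (h : ℝ × ℝ) :
    gradForm A B h = h.1 * A + h.2 * B := by
  simp [gradForm]

theorem norm_gradForm_le (A B : ℂ) : ‖gradForm A B‖ ≤ ‖A‖ + ‖B‖ := by
  refine ContinuousLinearMap.opNorm_le_bound _ (by positivity) fun h => ?_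
  rw [gradForm_apply]
  calc ‖(h.1 : ℂ) * A + h.2 * B‖ ≤ ‖h.1‖ * ‖A‖ + ‖h.2‖ * ‖B‖ := by
        refine (norm_add_le _ _).trans ?_
        simp
    _ ≤ ‖h‖ * ‖A‖ + ‖h‖ * ‖B‖ := by
        gcongr
        · exact norm_fst_le h
        · exact norm_snd_le h
    _ = _ := by ring

theorem hasFDerivAt_hermiteThetaTerm (n : ℤ) {ν : ℝ} (hν : 0 < ν) (c : ℝ) (k : ℕ) (m : ℤ)
    (p : ℝ × ℝ) :
    HasFDerivAt (hermiteThetaTerm n ν c k m)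
      (gradForm (hermiteThetaTermX n ν c k m p) (hermiteThetaTermY n ν c k m p)) p := by
  have hx : HasFDerivAt (fun p : ℝ × ℝ => ν * (p.1 + m + c))
      (ν • ContinuousLinearMap.fst ℝ ℝ ℝ) p :=
    ((hasFDerivAt_fst.add_const _).add_const _).const_mul ν
  have h1 := (Complex.ofRealCLM.hasFDerivAt (x := hermiteFun k (ν * (p.1 + m + c)))).comp p
    ((hasDerivAt_hermiteFun k (ν * (p.1 + m + c))).comp_hasFDerivAt p hx)
  have h2 : HasFDerivAt (fun p : ℝ × ℝ => 2 * Real.pi * Complex.I * n * (m + c) * (p.2 : ℂ))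
      ((2 * Real.pi * Complex.I * n * (m + c)) •
        Complex.ofRealCLM.comp (ContinuousLinearMap.snd ℝ ℝ ℝ)) p :=
    ((Complex.ofRealCLM.comp (ContinuousLinearMap.snd ℝ ℝ ℝ)).hasFDerivAt (x := p)).const_mul _
  have h3 := h1.mul h2.cexp
  refine h3.congr_fderiv ?_
  have hm := congrArg (fun z : ℝ => (z : ℂ)) (mul_hermiteFun k (ν * (p.1 + m + c)))
  push_cast at hm
  have hν' : (ν : ℂ) ≠ 0 := by exact_mod_cast hν.ne'
  ext
  · simp [gradForm, hermiteThetaTermX, hermiteThetaTerm]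
    ring
  · simp [gradForm, hermiteThetaTermY, hermiteThetaTerm]
    have e : ((m : ℂ) + c) * hermiteFun k (ν * (p.1 + m + c))
        = (ν : ℂ)⁻¹ * (k * hermiteFun (k - 1) (ν * (p.1 + m + c))
          + hermiteFun (k + 1) (ν * (p.1 + m + c)) / 2)
          - p.1 * hermiteFun k (ν * (p.1 + m + c)) := by
      rw [← hm]
      field_simp
      ring
    generalize Complex.exp (2 * Real.pi * Complex.I * n * (m + c) * p.2) = E at *
    linear_combination (2 * Real.pi * Complex.I * n * E) * e

/-- Termwise differentiation, on a strip `|x| < R` where the derivatives of the terms are dominated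
by multiples of `e^{-ν|m|}`. -/
theorem hasFDerivAt_hermiteTheta (n : ℤ) {ν : ℝ} (hν : 0 < ν) (c : ℝ) (k : ℕ) (p : ℝ × ℝ) :
    HasFDerivAt (hermiteTheta n ν c k)
      (gradForm (hermiteThetaX n ν c k p) (hermiteThetaY n ν c k p)) p := by
  set R := |p.1| + 1 with hR
  obtain ⟨B₀, hB₀, h₀⟩ := exists_hermiteFun_translate_le hν c R k
  obtain ⟨B₁, hB₁, h₁⟩ := exists_hermiteFun_translate_le hν c R (k - 1)
  obtain ⟨B₂, hB₂, h₂⟩ := exists_hermiteFun_translate_le hν c R (k + 1)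
  let s : Set (ℝ × ℝ) := Set.Ioo (-R) R ×ˢ Set.univ
  have hs : IsOpen s := isOpen_Ioo.prod isOpen_univ
  have hs' : IsPreconnected s := isPreconnected_Ioo.prod isPreconnected_univ
  have hmem : ∀ q ∈ s, |q.1| ≤ R := fun q hq => abs_le.2 ⟨hq.1.1.le, hq.1.2.le⟩
  have hp : p ∈ s := by
    refine ⟨?_, trivial⟩
    rw [Set.mem_Ioo, ← abs_lt]
    linarith
  set K : ℝ := ‖(2 * Real.pi * Complex.I * n : ℂ)‖ with hK
  have hsum : Summable fun m : ℤ =>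
      (ν * (k * B₁ + B₂ / 2) + K * (ν⁻¹ * (k * B₁ + B₂ / 2) + R * B₀)) *
        Real.exp (-ν * |(m : ℝ)|) := (summable_exp_neg_mul_abs hν).mul_left _
  have key := hasFDerivAt_tsum_of_isPreconnected hsum hs hs'
    (fun m q _ => hasFDerivAt_hermiteThetaTerm n hν c k m q) (fun m q hq => ?_) hp
    (summable_norm_hermiteThetaTerm n hν c k p).of_norm hp
  · refine key.congr_fderiv ?_
    have s0 := (summable_norm_hermiteThetaTerm n hν c k p).of_norm
    have s1 := (summable_norm_hermiteThetaTerm n hν c (k - 1) p).of_norm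
    have s2 := (summable_norm_hermiteThetaTerm n hν c (k + 1) p).of_norm
    have hX : HasSum (fun m => hermiteThetaTermX n ν c k m p) (hermiteThetaX n ν c k p) :=
      ((s1.hasSum.mul_left _).sub (s2.hasSum.div_const 2)).mul_left _
    have hY : HasSum (fun m => hermiteThetaTermY n ν c k m p) (hermiteThetaY n ν c k p) :=
      ((((s1.hasSum.mul_left _).add (s2.hasSum.div_const 2)).mul_left _).sub
        (s0.hasSum.mul_left _)).mul_left _
    exact ((hX.mapL (ContinuousLinearMap.smulRightL ℝ _ _ (ContinuousLinearMap.fst ℝ ℝ ℝ))).add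
      (hY.mapL (ContinuousLinearMap.smulRightL ℝ _ _ (ContinuousLinearMap.snd ℝ ℝ ℝ)))).tsum_eq
  · have b0 := h₀ m q.1 (hmem q hq)
    have b1 := h₁ m q.1 (hmem q hq)
    have b2 := h₂ m q.1 (hmem q hq)
    rw [← norm_hermiteThetaTerm n ν c _ m q] at b0 b1 b2
    have hq1 : ‖(q.1 : ℂ)‖ ≤ R := by simpa using hmem q hq
    have hνn : ‖(ν : ℂ)‖ = ν := by simp [hν.le]
    have hνi : ‖(ν : ℂ)⁻¹‖ = ν⁻¹ := by simp [hν.le]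
    have hk : ‖(k : ℂ)‖ = k := by simp
    refine (norm_gradForm_le _ _).trans ?_
    rw [add_mul]
    have hR0 : 0 ≤ R := by positivity
    have two : ‖(2 : ℂ)‖ = 2 := by simp
    refine add_le_add ?_ ?_
    · rw [hermiteThetaTermX, norm_mul, hνn, mul_assoc]
      gcongr
      refine (norm_sub_le _ _).trans ?_
      rw [norm_mul, norm_div, hk, two]
      calc _ ≤ k * (B₁ * Real.exp (-ν * |(m : ℝ)|)) + B₂ * Real.exp (-ν * |(m : ℝ)|) / 2 := by
            gcongr
        _ = _ := by ring
    · rw [hermiteThetaTermY, norm_mul, ← hK, mul_assoc]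
      gcongr
      refine (norm_sub_le _ _).trans ?_
      rw [norm_mul, norm_mul, hνi]
      calc _ ≤ ν⁻¹ * (k * (B₁ * Real.exp (-ν * |(m : ℝ)|)) + B₂ * Real.exp (-ν * |(m : ℝ)|) / 2)
              + R * (B₀ * Real.exp (-ν * |(m : ℝ)|)) := by
            gcongr
            refine (norm_add_le _ _).trans ?_
            rw [norm_mul, norm_div, hk, two]
            gcongr
        _ = _ := by ring

/-- The partial derivatives of a theta series are combinations of theta series, so continuity of all
of them gives smoothness of all of them. -/
theorem contDiff_hermiteTheta (n : ℤ) {ν : ℝ} (hν : 0 < ν) (c : ℝ) (k : ℕ) :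
    ContDiff ℝ ∞ (hermiteTheta n ν c k) := by
  have h : ∀ N : ℕ, ∀ k, ContDiff ℝ N (hermiteTheta n ν c k) := by
    intro N
    induction N with
    | zero =>
      intro k
      exact contDiff_zero.2 (continuous_iff_continuousAt.2 fun p =>
        (hasFDerivAt_hermiteTheta n hν c k p).continuousAt)
    | succ N ih =>
      intro k
      rw [show ((N + 1 : ℕ) : WithTop ℕ∞) = (N : WithTop ℕ∞) + 1 by push_cast; rfl,
        contDiff_succ_iff_hasFDerivAt]
      refine ⟨_, ?_, fun p => hasFDerivAt_hermiteTheta n hν c k p⟩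
      have hX : ContDiff ℝ N (hermiteThetaX n ν c k) :=
        contDiff_const.mul ((contDiff_const.mul (ih _)).sub ((ih _).div_const 2))
      have hY : ContDiff ℝ N (hermiteThetaY n ν c k) :=
        contDiff_const.mul ((contDiff_const.mul ((contDiff_const.mul (ih _)).add
          ((ih _).div_const 2))).sub
            ((Complex.ofRealCLM.contDiff.comp contDiff_fst).mul (ih _)))
      exact (contDiff_const.smulRight hX).add (contDiff_const.smulRight hY)
  exact contDiff_infty.2 fun N => h N k

theorem hermiteTheta_zero_ne_zero (n : ℤ) {ν : ℝ} (hν : 0 < ν) (c x : ℝ) :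
    hermiteTheta n ν c 0 (x, 0) ≠ 0 := by
  have h : hermiteTheta n ν c 0 (x, 0)
      = ((∑' m : ℤ, Real.exp (-(ν * (x + m + c)) ^ 2 / 2) : ℝ) : ℂ) := by
    rw [hermiteTheta, Complex.ofReal_tsum]
    exact tsum_congr fun m => by simp [hermiteThetaTerm, hermiteFun_zero]
  rw [h, Complex.ofReal_ne_zero]
  have hs : Summable fun m : ℤ => Real.exp (-(ν * (x + m + c)) ^ 2 / 2) := by
    refine (summable_norm_hermiteThetaTerm n hν c 0 (x, 0)).congr fun m => ?_
    rw [norm_hermiteThetaTerm, hermiteFun_zero, abs_of_pos (Real.exp_pos _)]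
  exact (hs.tsum_pos (fun m => (Real.exp_pos _).le) 0 (Real.exp_pos _)).ne'

/-- No Hermite theta series vanishes identically: otherwise the lowering operator would annihilate
the one of index `0`, which is positive for `y = 0`. -/
theorem exists_hermiteTheta_ne_zero {n : ℤ} (hn : n ≠ 0) {ν : ℝ} (hν : 0 < ν) (c : ℝ) (k : ℕ) :
    ∃ p, hermiteTheta n ν c k p ≠ 0 := by
  induction k with
  | zero => exact ⟨_, hermiteTheta_zero_ne_zero n hν c 0⟩
  | succ k ih =>
    by_contra! h
    obtain ⟨p, hp⟩ := ih
    have h0 : hermiteTheta n ν c (k + 1) = fun _ => 0 := funext h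
    have hd := hasFDerivAt_hermiteTheta n hν c (k + 1) p
    rw [h0] at hd
    have e := hd.unique (hasFDerivAt_const (0 : ℂ) p)
    have e1 := congrArg (fun L => L (1, 0)) e
    have e2 := congrArg (fun L => L (0, 1)) e
    have hν' : (ν : ℂ) ≠ 0 := by exact_mod_cast hν.ne'
    have hn' : (n : ℂ) ≠ 0 := by exact_mod_cast hn
    have hπ : (Real.pi : ℂ) ≠ 0 := by exact_mod_cast Real.pi_ne_zero
    have hk : ((k + 1 : ℕ) : ℂ) ≠ 0 := by exact_mod_cast k.succ_ne_zero
    simp [hermiteThetaX, hν', -Nat.cast_add] at e1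
    simp [hermiteThetaY, h p, hν', hn', hπ, -Nat.cast_add] at e2
    refine hp ((mul_eq_zero.1 ?_).resolve_left hk)
    linear_combination (e1 + e2) / 2

/-- The Gaussian theta series is Jacobi's theta function up to an exponential factor, since
`(x + m + c)² = (x + c)² + 2 m (x + c) + m²`. -/
theorem hermiteTheta_zero_eq_jacobiTheta₂ (n : ℤ) {s ν : ℝ}
    (hν : ν ^ 2 = 2 * Real.pi * |(n : ℝ)| * s)
    (c x y : ℝ) :
    hermiteTheta n ν c 0 (x, y) =
      (Real.exp (-Real.pi * |(n : ℝ)| * s * (x + c) ^ 2) : ℂ) *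
        Complex.exp (2 * Real.pi * Complex.I * n * (c * y)) *
        jacobiTheta₂ (n * (y + (n.sign : ℂ) * Complex.I * s * (x + c)))
          (Complex.I * |(n : ℝ)| * s) := by
  rw [hermiteTheta, jacobiTheta₂, ← tsum_mul_left]
  refine tsum_congr fun m => ?_
  have hns : (n : ℂ) * (n.sign : ℂ) = ((|(n : ℝ)| : ℝ) : ℂ) := by
    rw [← Int.cast_abs, Complex.ofReal_intCast, ← Int.cast_mul]
    rw [mul_comm, Int.sign_mul_self_eq_abs]
  have hν' := congrArg (fun z : ℝ => (z : ℂ)) hν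
  push_cast at hν' hns
  rw [hermiteThetaTerm, hermiteFun_zero, jacobiTheta₂_term, Complex.ofReal_exp, Complex.ofReal_exp,
    ← Complex.exp_add, ← Complex.exp_add, ← Complex.exp_add]
  congr 1
  push_cast
  linear_combination (-((x : ℂ) + m + c) ^ 2 / 2) * hν'
    - 2 * Real.pi * Complex.I ^ 2 * m * s * (x + c) * hns
    + (-Real.pi * m ^ 2 * ((|(n : ℝ)| : ℝ) : ℂ) * s
      - 2 * Real.pi * m * s * (x + c) * ((|(n : ℝ)| : ℝ) : ℂ)) * Complex.I_sq

end Heisenberg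

namespace CoordGeom

/-! ### Partial derivatives -/

variable {ι : Type*} [Fintype ι] [DecidableEq ι]

theorem partialDeriv_const {F : Type*} [NormedAddCommGroup F] [NormedSpace ℝ F] (i : ι) (c : F)
    (p : ι → ℝ) : partialDeriv i (fun _ => c) p = 0 := by
  simp [partialDeriv]

theorem partialDeriv_coord (i j : ι) (p : ι → ℝ) :
    partialDeriv i (fun q => q j) p = if j = i then 1 else 0 := by
  simp [partialDeriv, (hasFDerivAt_apply (𝕜 := ℝ) j p).fderiv, Pi.single_apply]

theorem partialDeriv_add {F : Type*} [NormedAddCommGroup F] [NormedSpace ℝ F] (i : ι)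
    {f g : (ι → ℝ) → F} {p : ι → ℝ} (hf : DifferentiableAt ℝ f p) (hg : DifferentiableAt ℝ g p) :
    partialDeriv i (fun q => f q + g q) p = partialDeriv i f p + partialDeriv i g p := by
  simp [partialDeriv, fderiv_fun_add hf hg]

theorem partialDeriv_sum {F κ : Type*} [NormedAddCommGroup F] [NormedSpace ℝ F] (i : ι)
    {f : κ → (ι → ℝ) → F} {p : ι → ℝ} {t : Finset κ} (hf : ∀ k ∈ t, DifferentiableAt ℝ (f k) p) :
    partialDeriv i (fun q => ∑ k ∈ t, f k q) p = ∑ k ∈ t, partialDeriv i (f k) p := by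
  simp [partialDeriv, fderiv_fun_sum hf]

theorem partialDeriv_const_mul {A : Type*} [NormedRing A] [NormedAlgebra ℝ A] (i : ι) (c : A)
    {f : (ι → ℝ) → A} {p : ι → ℝ}
    (hf : DifferentiableAt ℝ f p) :
    partialDeriv i (fun q => c * f q) p = c * partialDeriv i f p := by
  simp [partialDeriv, fderiv_const_mul hf]

theorem partialDeriv_smul {F : Type*} [NormedAddCommGroup F] [NormedSpace ℝ F] (i : ι)
    {f : (ι → ℝ) → ℝ} {g : (ι → ℝ) → F} {p : ι → ℝ} (hf : DifferentiableAt ℝ f p)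
    (hg : DifferentiableAt ℝ g p) :
    partialDeriv i (fun q => f q • g q) p
      = f p • partialDeriv i g p + partialDeriv i f p • g p := by
  simp [partialDeriv, fderiv_fun_smul hf hg]

theorem partialDeriv_const_mul_coord (i j : ι) (c : ℝ) (p : ι → ℝ) :
    partialDeriv i (fun q => c * q j) p = if j = i then c else 0 := by
  rw [partialDeriv_const_mul i c (by fun_prop), partialDeriv_coord]
  simp

theorem partialDeriv_const_mul_coord_mul_coord (i j k : ι) (c : ℝ) (p : ι → ℝ) :
    partialDeriv i (fun q => c * (q j * q k)) p
      = (if j = i then c * p k else 0) + if k = i then c * p j else 0 := by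
  have h := partialDeriv_smul i (f := fun q : ι → ℝ => q j) (g := fun q : ι → ℝ => q k) (p := p)
    (by fun_prop) (by fun_prop)
  simp only [smul_eq_mul, partialDeriv_coord] at h
  rw [partialDeriv_const_mul i c (by fun_prop), h]
  split_ifs <;> simp; ring

theorem contDiff_partialDeriv {u : (ι → ℝ) → ℂ} {m n : WithTop ℕ∞} (hu : ContDiff ℝ n u)
    (hmn : m + 1 ≤ n) (i : ι) : ContDiff ℝ m (partialDeriv i u) :=
  (hu.fderiv_right hmn).clm_apply contDiff_const

theorem partialDeriv_comm {u : (ι → ℝ) → ℂ} (hu : ContDiff ℝ 2 u) (i j : ι) (p : ι → ℝ) :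
    partialDeriv i (partialDeriv j u) p = partialDeriv j (partialDeriv i u) p := by
  have hd : DifferentiableAt ℝ (fderiv ℝ u) p :=
    (hu.fderiv_right (m := 1) (by norm_num)).differentiable (by norm_num) p
  have h : ∀ i j, partialDeriv i (partialDeriv j u) p
      = fderiv ℝ (fderiv ℝ u) p (Pi.single i 1) (Pi.single j 1) := fun i j => by
    change fderiv ℝ (fun q => fderiv ℝ u q (Pi.single j 1)) p (Pi.single i 1) = _
    rw [fderiv_clm_apply hd (differentiableAt_const _)]
    simp
  rw [h, h]
  exact (hu.contDiffAt.isSymmSndFDerivAt (by simp)).eq _ _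

end CoordGeom

namespace Heisenberg

open CoordGeom

/-! ### The metric, its inverse and its determinant -/

/-- The inverse matrix of `metric d s u`. -/
def metricInv (d : ℕ) (s : ℝ) (u : CoordIndex d → ℝ) :
    Matrix (CoordIndex d) (CoordIndex d) ℝ :=
  Matrix.of fun i j => match i, j with
    | .inl i, .inl j => if i = j then 1 else 0
    | .inr (.inl i), .inr (.inl j) => if i = j then s ^ 2 else 0
    | .inr (.inl i), .inr (.inr _) => s ^ 2 * u (.inl i)
    | .inr (.inr _), .inr (.inl i) => s ^ 2 * u (.inl i)
    | .inr (.inr _), .inr (.inr _) => (s ^ (2 * d))⁻¹ + s ^ 2 * ∑ j, u (.inl j) ^ 2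
    | .inl _, .inr _ => 0
    | .inr _, .inl _ => 0

theorem contactForm_apply {d : ℕ} (u : CoordIndex d → ℝ) (i : CoordIndex d) :
    contactForm u i = match i with
      | .inl _ => 0
      | .inr (.inl i) => -u (.inl i)
      | .inr (.inr _) => 1 := by
  rcases i with i | i | i <;> simp [contactForm, dt, dy, Finset.sum_apply, Pi.single_apply]

theorem metric_apply {d : ℕ} (s : ℝ) (u : CoordIndex d → ℝ) (i j : CoordIndex d) :
    metric d s u i j = match i, j with
      | .inl i, .inl j => if i = j then 1 else 0
      | .inr (.inl i), .inr (.inl j) =>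
          (if i = j then (s ^ 2)⁻¹ else 0) + s ^ (2 * d) * (u (.inl i) * u (.inl j))
      | .inr (.inl i), .inr (.inr _) => -s ^ (2 * d) * u (.inl i)
      | .inr (.inr _), .inr (.inl i) => -s ^ (2 * d) * u (.inl i)
      | .inr (.inr _), .inr (.inr _) => s ^ (2 * d)
      | .inl _, .inr _ => 0
      | .inr _, .inl _ => 0 := by
  rcases i with i | i | i <;> rcases j with j | j | j <;>
    simp [metric, Matrix.sum_apply, Matrix.vecMulVec_apply, contactForm_apply, dx, dy,
      Pi.single_apply, eq_comm]

theorem metric_mul_metricInv {d : ℕ} {s : ℝ} (hs : s ≠ 0) (u : CoordIndex d → ℝ) :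
    metric d s u * metricInv d s u = 1 := by
  ext i j
  rcases i with i | i | i <;> rcases j with j | j | j <;>
    simp [Matrix.mul_apply, Fintype.sum_sum_type, metric_apply, metricInv, Matrix.one_apply,
      add_mul, Finset.sum_add_distrib]
  · split_ifs
    · field_simp
      ring
    · ring
  · have h : ∑ k, s ^ (2 * d) * (u (Sum.inl i) * u (Sum.inl k)) * (s ^ 2 * u (Sum.inl k))
        = s ^ (2 * d) * s ^ 2 * u (Sum.inl i) * ∑ k, u (Sum.inl k) ^ 2 := by
      rw [Finset.mul_sum]
      exact Finset.sum_congr rfl fun k _ => by ring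
    rw [h]
    field_simp
    ring
  · ring
  · have h : ∑ k, s ^ (2 * d) * u (Sum.inl k) * (s ^ 2 * u (Sum.inl k))
        = s ^ (2 * d) * s ^ 2 * ∑ k, u (Sum.inl k) ^ 2 := by
      rw [Finset.mul_sum]
      exact Finset.sum_congr rfl fun k _ => by ring
    rw [h]
    field_simp
    ring

theorem metric_inv {d : ℕ} {s : ℝ} (hs : s ≠ 0) (u : CoordIndex d → ℝ) :
    (metric d s u)⁻¹ = metricInv d s u :=
  Matrix.inv_eq_right_inv (metric_mul_metricInv hs u)

/-- The matrix of the coframe `dx_j`, `dy_j`, `θ`. -/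
def coframe (d : ℕ) (u : CoordIndex d → ℝ) : Matrix (CoordIndex d) (CoordIndex d) ℝ :=
  1 + Matrix.replicateCol Unit (dt : CoordIndex d → ℝ) *
    Matrix.replicateRow Unit (contactForm u - dt)

theorem coframe_apply {d : ℕ} (u : CoordIndex d → ℝ) (i j : CoordIndex d) :
    coframe d u i j = match i with
      | .inl i => (dx i : CoordIndex d → ℝ) j
      | .inr (.inl i) => (dy i : CoordIndex d → ℝ) j
      | .inr (.inr _) => contactForm u j := by
  rcases i with i | i | i <;>
    simp [coframe, Matrix.mul_apply, dx, dy, dt, Matrix.one_apply, Pi.single_apply, eq_comm]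

theorem det_coframe {d : ℕ} (u : CoordIndex d → ℝ) : (coframe d u).det = 1 := by
  rw [coframe, Matrix.det_one_add_replicateCol_mul_replicateRow]
  simp [dt, contactForm_apply]

/-- The metric is diagonal in the coframe `dx_j`, `dy_j`, `θ`. -/
theorem metric_eq_coframe {d : ℕ} (s : ℝ) (u : CoordIndex d → ℝ) :
    metric d s u = (coframe d u)ᵀ * Matrix.diagonal
      (Sum.elim (fun _ => 1) (Sum.elim (fun _ => (s ^ 2)⁻¹) (fun _ => s ^ (2 * d)))) *
        coframe d u := by
  ext i j
  rw [Matrix.mul_apply]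
  simp only [Matrix.mul_diagonal, Matrix.transpose_apply, Fintype.sum_sum_type, coframe_apply,
    metric, Matrix.sum_apply, Matrix.vecMulVec_apply, Matrix.add_apply, Matrix.smul_apply,
    Sum.elim_inl, Sum.elim_inr, Finset.univ_unique, Finset.sum_singleton, smul_eq_mul, mul_one]
  rw [add_assoc]
  congr 2
  · exact Finset.sum_congr rfl fun k _ => by ring
  · ring

theorem det_metric {d : ℕ} {s : ℝ} (hs : s ≠ 0) (u : CoordIndex d → ℝ) :
    (metric d s u).det = 1 := by
  rw [metric_eq_coframe, Matrix.det_mul, Matrix.det_mul, Matrix.det_transpose, det_coframe,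
    Matrix.det_diagonal]
  simp [Fintype.prod_sum_type, pow_mul]
  field_simp

/-! ### Curvature of the metric -/

/-- The partial derivatives `∂_l g_{ij}`. -/
theorem partialDeriv_metric {d : ℕ} (s : ℝ) (l i j : CoordIndex d) (p : CoordIndex d → ℝ) :
    partialDeriv l (fun q => metric d s q i j) p = match l, i, j with
      | .inl k, .inr (.inl i), .inr (.inl j) =>
          s ^ (2 * d) * ((if i = k then p (.inl j) else 0) + if j = k then p (.inl i) else 0)
      | .inl k, .inr (.inl i), .inr (.inr _) => if i = k then -s ^ (2 * d) else 0
      | .inl k, .inr (.inr _), .inr (.inl i) => if i = k then -s ^ (2 * d) else 0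
      | _, _, _ => 0 := by
  have h : ∀ i j : Fin d, partialDeriv l (fun q : CoordIndex d → ℝ =>
      (if i = j then (s ^ 2)⁻¹ else 0) + s ^ (2 * d) * (q (.inl i) * q (.inl j))) p =
      (if Sum.inl i = l then s ^ (2 * d) * p (.inl j) else 0) +
        if Sum.inl j = l then s ^ (2 * d) * p (.inl i) else 0 := fun i j => by
    rw [partialDeriv_add _ (by fun_prop) (by fun_prop), partialDeriv_const, zero_add,
      partialDeriv_const_mul_coord_mul_coord]
  rcases l with l | l | l <;> rcases i with i | i | i <;> rcases j with j | j | j <;>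
    simp [metric_apply, partialDeriv_const, partialDeriv_const_mul_coord, h, mul_add, -neg_mul]

/-- The Christoffel symbols of `metric d s`. -/
def christoffelSymbol (d : ℕ) (s : ℝ) (k i j : CoordIndex d) (p : CoordIndex d → ℝ) : ℝ :=
  match k, i, j with
  | .inl k, .inr (.inl i), .inr (.inl j) => (if k = i then -s ^ (2 * d) / 2 * p (.inl j) else 0) +
      if k = j then -s ^ (2 * d) / 2 * p (.inl i) else 0
  | .inl k, .inr (.inl i), .inr (.inr _) => if k = i then s ^ (2 * d) / 2 else 0
  | .inl k, .inr (.inr _), .inr (.inl i) => if k = i then s ^ (2 * d) / 2 else 0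
  | .inr (.inl j), .inl k, .inr (.inl i) =>
      if j = k then s ^ 2 * s ^ (2 * d) / 2 * p (.inl i) else 0
  | .inr (.inl j), .inr (.inl i), .inl k =>
      if j = k then s ^ 2 * s ^ (2 * d) / 2 * p (.inl i) else 0
  | .inr (.inl j), .inl k, .inr (.inr _) => if j = k then -(s ^ 2 * s ^ (2 * d) / 2) else 0
  | .inr (.inl j), .inr (.inr _), .inl k => if j = k then -(s ^ 2 * s ^ (2 * d) / 2) else 0
  | .inr (.inr _), .inl k, .inr (.inl i) =>
      (if k = i then -1 / 2 else 0) + s ^ 2 * s ^ (2 * d) / 2 * (p (.inl k) * p (.inl i))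
  | .inr (.inr _), .inr (.inl i), .inl k =>
      (if k = i then -1 / 2 else 0) + s ^ 2 * s ^ (2 * d) / 2 * (p (.inl k) * p (.inl i))
  | .inr (.inr _), .inl k, .inr (.inr _) => -(s ^ 2 * s ^ (2 * d) / 2) * p (.inl k)
  | .inr (.inr _), .inr (.inr _), .inl k => -(s ^ 2 * s ^ (2 * d) / 2) * p (.inl k)
  | _, _, _ => 0

theorem christoffel_metric {d : ℕ} {s : ℝ} (hs : s ≠ 0) (k i j : CoordIndex d) :
    christoffel (metric d s) k i j = christoffelSymbol d s k i j := by
  funext p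
  rw [christoffel, metric_inv hs]
  have hsum : ∀ i j : Fin d, ∑ k, s ^ 2 * p (.inl k) *
      (s ^ (2 * d) * ((if j = i then p (.inl k) else 0) + if k = i then p (.inl j) else 0)) =
      s ^ 2 * s ^ (2 * d) * ((if j = i then ∑ k, p (.inl k) ^ 2 else 0)
        + p (.inl i) * p (.inl j)) := by
    intro i j
    simp only [mul_add, Finset.sum_add_distrib, mul_ite, mul_zero, Finset.sum_ite_eq',
      Finset.mem_univ, if_true]
    congr 1
    · split_ifs
      · rw [Finset.mul_sum]
        exact Finset.sum_congr rfl fun k _ => by ring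
      · simp
    · ring
  rcases k with k | k | k <;> rcases i with i | i | i <;> rcases j with j | j | j <;>
    simp [Fintype.sum_sum_type, metricInv, partialDeriv_metric, christoffelSymbol, hsum]
  all_goals try split_ifs
  all_goals subst_vars
  all_goals first
    | ring1
    | (exfalso; simp_all; done)
    | (field_simp; ring1)

/-- The partial derivatives of the Christoffel symbols with an upper index `x_k`. -/
theorem partialDeriv_christoffelSymbol {d : ℕ} (s : ℝ) (k l : Fin d) (i j : CoordIndex d)
    (p : CoordIndex d → ℝ) :
    partialDeriv (.inl l) (christoffelSymbol d s (.inl k) i j) p = match i, j with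
      | .inr (.inl i), .inr (.inl j) => (if k = i ∧ j = l then -s ^ (2 * d) / 2 else 0) +
          if k = j ∧ i = l then -s ^ (2 * d) / 2 else 0
      | _, _ => 0 := by
  change partialDeriv (.inl l) (fun q => christoffelSymbol d s (.inl k) i j q) p = _
  rcases i with i | i | i <;> rcases j with j | j | j <;>
    simp only [christoffelSymbol, partialDeriv_const]
  have h : ∀ i j : Fin d, (fun q : CoordIndex d → ℝ =>
      if k = i then -s ^ (2 * d) / 2 * q (.inl j) else 0) =
      fun q : CoordIndex d → ℝ => (if k = i then -s ^ (2 * d) / 2 else 0) * q (.inl j) := by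
    intro i j
    funext q
    split_ifs <;> simp
  have h' := congrFun (h i j)
  have h'' := congrFun (h j i)
  simp only [h', h'']
  rw [partialDeriv_add _ (by fun_prop) (by fun_prop), partialDeriv_const_mul_coord,
    partialDeriv_const_mul_coord]
  simp only [Sum.inl.injEq, ← ite_and, and_comm]

theorem differentiable_christoffelSymbol {d : ℕ} (s : ℝ) (k i j : CoordIndex d) :
    Differentiable ℝ (christoffelSymbol d s k i j) := by
  change Differentiable ℝ fun q => christoffelSymbol d s k i j q
  rcases k with k | k | k <;> rcases i with i | i | i <;> rcases j with j | j | j <;>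
    simp only [christoffelSymbol] <;> try split_ifs
  all_goals fun_prop

/-- The Christoffel symbols depend on the coordinates `x_j` only. -/
theorem partialDeriv_christoffelSymbol_inr {d : ℕ} (s : ℝ) (k i j : CoordIndex d)
    (l : Fin d ⊕ Unit) (p : CoordIndex d → ℝ) :
    partialDeriv (.inr l) (christoffelSymbol d s k i j) p = 0 := by
  have h : ∀ τ : ℝ, ∀ k i j, christoffelSymbol d s k i j (p + τ • Pi.single (.inr l) 1)
      = christoffelSymbol d s k i j p := by
    intro τ k i j
    rcases k with k | k | k <;> rcases i with i | i | i <;> rcases j with j | j | j <;>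
    simp [christoffelSymbol]
  rw [partialDeriv, ← (differentiable_christoffelSymbol s k i j p).lineDeriv_eq_fderiv, lineDeriv]
  simp [h]

/-- The trace `Γ^k_{jk}` of the Christoffel symbols vanishes, since `det g` is constant. -/
theorem sum_christoffelSymbol {d : ℕ} (s : ℝ) (j : CoordIndex d) (p : CoordIndex d → ℝ) :
    ∑ k, christoffelSymbol d s k k j p = 0 := by
  rcases j with j | j | j <;> simp [Fintype.sum_sum_type, christoffelSymbol]

theorem christoffelSymbol_symm {d : ℕ} (s : ℝ) (k i j : CoordIndex d) :
    christoffelSymbol d s k i j = christoffelSymbol d s k j i := by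
  funext p
  rcases k with k | k | k <;> rcases i with i | i | i <;> rcases j with j | j | j <;>
    simp only [christoffelSymbol]
  ring

/-- In the coframe `dx_j`, `dy_j`, `θ` this is the diagonal form
`-(s^{2d+2}/2) ∑ dx_j² - (s^{2d}/2) ∑ dy_j² + (d/2) s^{4d+2} θ²`. -/
theorem ricci_metric {d : ℕ} {s : ℝ} (hs : s ≠ 0) (i j : CoordIndex d) (p : CoordIndex d → ℝ) :
    ricci (metric d s) i j p = match i, j with
      | .inl i, .inl j => if i = j then -(s ^ 2 * s ^ (2 * d) / 2) else 0
      | .inr (.inl i), .inr (.inl j) => (if i = j then -(s ^ (2 * d) / 2) else 0)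
          + d / 2 * s ^ 2 * (s ^ (2 * d)) ^ 2 * (p (.inl i) * p (.inl j))
      | .inr (.inl i), .inr (.inr _) => -(d / 2 * s ^ 2 * (s ^ (2 * d)) ^ 2 * p (.inl i))
      | .inr (.inr _), .inr (.inl i) => -(d / 2 * s ^ 2 * (s ^ (2 * d)) ^ 2 * p (.inl i))
      | .inr (.inr _), .inr (.inr _) => d / 2 * s ^ 2 * (s ^ (2 * d)) ^ 2
      | .inl _, .inr _ => 0
      | .inr _, .inl _ => 0 := by
  have h1 : ∑ k, (partialDeriv k (christoffelSymbol d s k i j) p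
      - partialDeriv j (christoffelSymbol d s k i k) p) =
      ∑ k : Fin d, partialDeriv (.inl k) (christoffelSymbol d s (.inl k) i j) p := by
    rw [Finset.sum_sub_distrib, ← partialDeriv_sum j
      (fun k _ => (differentiable_christoffelSymbol s k i k).differentiableAt)]
    simp only [christoffelSymbol_symm s _ i, sum_christoffelSymbol, partialDeriv_const, sub_zero]
    simp [Fintype.sum_sum_type, partialDeriv_christoffelSymbol_inr]
  have h2 : ∑ k, ∑ l, (christoffelSymbol d s k k l p * christoffelSymbol d s l i j p
      - christoffelSymbol d s k j l p * christoffelSymbol d s l i k p) =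
      - ∑ k, ∑ l, christoffelSymbol d s k j l p * christoffelSymbol d s l i k p := by
    simp only [Finset.sum_sub_distrib]
    rw [Finset.sum_comm]
    simp only [← Finset.sum_mul, sum_christoffelSymbol, zero_mul, Finset.sum_const_zero, zero_sub]
  simp only [ricci, christoffel_metric hs, h1, h2]
  rcases i with i | i | i <;> rcases j with j | j | j <;>
    simp [Fintype.sum_sum_type, partialDeriv_christoffelSymbol, christoffelSymbol]
  all_goals
    clear h1 h2
    generalize s ^ (2 * d) = σ
    generalize s ^ 2 = ε
  all_goals
    try simp [mul_add, add_mul, Finset.sum_add_distrib, ite_and]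
    try split_ifs
  all_goals subst_vars
  all_goals first
    | ring1
    | (exfalso; simp_all)

/-- The scalar curvature is constant: `d` equal contributions of the brackets `[X_j, Y_j]`. -/
theorem scalarCurvature_metric {d : ℕ} {s : ℝ} (hs : s ≠ 0) (p : CoordIndex d → ℝ) :
    scalarCurvature (metric d s) p = -(d / 2) * s ^ (2 * d + 2) := by
  rw [scalarCurvature, metric_inv hs]
  simp only [ricci_metric hs]
  simp [Fintype.sum_sum_type, metricInv]
  have h : s ^ (2 * d) ≠ 0 := pow_ne_zero _ hs
  rw [pow_add]
  simp only [mul_add, Finset.sum_add_distrib, Finset.sum_neg_distrib, Finset.sum_const,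
    Finset.card_univ, Fintype.card_fin, nsmul_eq_mul]
  have e1 : ∑ i, s ^ 2 * (d / 2 * s ^ 2 * (s ^ (2 * d)) ^ 2 * (p (.inl i) * p (.inl i)))
      = s ^ 2 * (d / 2 * s ^ 2 * (s ^ (2 * d)) ^ 2) * ∑ i : Fin d, p (.inl i) ^ 2 := by
    rw [Finset.mul_sum]
    exact Finset.sum_congr rfl fun k _ => by ring
  have e2 : ∑ i, s ^ 2 * p (.inl i) * (d / 2 * s ^ 2 * (s ^ (2 * d)) ^ 2 * p (.inl i))
      = s ^ 2 * (d / 2 * s ^ 2 * (s ^ (2 * d)) ^ 2) * ∑ i : Fin d, p (.inl i) ^ 2 := by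
    rw [Finset.mul_sum]
    exact Finset.sum_congr rfl fun k _ => by ring
  rw [e1, e2]
  field_simp
  ring

/-! ### The Yamabe operator on functions of fixed central frequency -/

/-- The operator `X_j² + Y_j²`, with `X_j = ∂/∂x_j` and `Y_j = s (∂/∂y_j + x_j ∂/∂t)`, on functions
on which `∂/∂t` acts as multiplication by `iκ`. -/
def oscillator {d : ℕ} (s κ : ℝ) (j : Fin d) (u : (CoordIndex d → ℝ) → ℂ)
    (p : CoordIndex d → ℝ) : ℂ :=
  partialDeriv (.inl j) (partialDeriv (.inl j) u) p +
    s ^ 2 * (partialDeriv (.inr (.inl j)) (partialDeriv (.inr (.inl j)) u) p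
      + 2 * (Complex.I * κ * p (.inl j)) * partialDeriv (.inr (.inl j)) u p
      + (Complex.I * κ * p (.inl j)) ^ 2 * u p)

/-- The Laplacian on functions on which `∂/∂t` acts as multiplication by `iκ`. -/
theorem laplacian_metric {d : ℕ} {s : ℝ} (hs : s ≠ 0) (κ : ℝ)
    {u : (CoordIndex d → ℝ) → ℂ} (hu : ContDiff ℝ 2 u)
    (ht : ∀ p, partialDeriv (.inr (.inr ())) u p = Complex.I * κ * u p) (p : CoordIndex d → ℝ) :
    laplacian (metric d s) u p
      = -∑ j, oscillator s κ j u p + (κ ^ 2 * (s ^ (2 * d))⁻¹ : ℝ) * u p := by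
  have hd : Differentiable ℝ u := hu.differentiable (by norm_num)
  have hd1 : ∀ i, Differentiable ℝ (partialDeriv i u) := fun i =>
    (contDiff_partialDeriv (m := 1) hu (by norm_num) i).differentiable (by norm_num)
  have ht' : partialDeriv (.inr (.inr ())) u = fun q => Complex.I * κ * u q := funext ht
  have hty : ∀ j, partialDeriv (.inr (.inr ())) (partialDeriv (.inr (.inl j)) u) p
      = Complex.I * κ * partialDeriv (.inr (.inl j)) u p := fun j => by
    rw [partialDeriv_comm hu, ht', partialDeriv_const_mul _ _ (hd p)]
  have hc : ∀ j, DifferentiableAt ℝ (fun q : CoordIndex d → ℝ => s ^ 2 * q (.inl j)) p :=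
    fun j => by fun_prop
  rw [laplacian]
  simp only [det_metric hs, metric_inv hs, Real.sqrt_one, one_mul, inv_one, one_smul]
  have fx : ∀ k : Fin d, partialDeriv (.inl k)
      (fun q => ∑ j, metricInv d s q (.inl k) j • partialDeriv j u q) p
      = partialDeriv (.inl k) (partialDeriv (.inl k) u) p := fun k => by
    congr 1
    funext q
    simp [Fintype.sum_sum_type, metricInv, -Complex.real_smul]
  have fy : ∀ k : Fin d, partialDeriv (.inr (.inl k))
      (fun q => ∑ j, metricInv d s q (.inr (.inl k)) j • partialDeriv j u q) p
      = s ^ 2 * partialDeriv (.inr (.inl k)) (partialDeriv (.inr (.inl k)) u) p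
        + s ^ 2 * (p (.inl k)) * (Complex.I * κ * partialDeriv (.inr (.inl k)) u p) := fun k => by
    have e : (fun q => ∑ j, metricInv d s q (.inr (.inl k)) j • partialDeriv j u q)
        = fun q => (s ^ 2) • partialDeriv (.inr (.inl k)) u q
          + (s ^ 2 * q (.inl k)) • (Complex.I * κ * u q) := by
      funext q
      simp [Fintype.sum_sum_type, metricInv, ht, -Complex.real_smul]
    rw [e, partialDeriv_add _ ((hd1 _ p).fun_const_smul _) ((hc k).fun_smul ((hd p).const_mul _)),
      partialDeriv_smul _ (differentiableAt_const _) (hd1 _ p),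
      partialDeriv_smul _ (hc k) ((hd p).const_mul _),
      partialDeriv_const_mul_coord, partialDeriv_const_mul _ _ (hd p), partialDeriv_const]
    simp
  have ft : partialDeriv (.inr (.inr ()))
      (fun q => ∑ j, metricInv d s q (.inr (.inr ())) j • partialDeriv j u q) p
      = ∑ k : Fin d, s ^ 2 * (p (.inl k)) * (Complex.I * κ * partialDeriv (.inr (.inl k)) u p)
        + ((s ^ (2 * d))⁻¹ + s ^ 2 * ∑ k : Fin d, (p (.inl k) : ℂ) ^ 2) *
          (Complex.I * κ * (Complex.I * κ * u p)) := by
    have e : (fun q => ∑ j, metricInv d s q (.inr (.inr ())) j • partialDeriv j u q)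
        = fun q => ∑ k : Fin d, (s ^ 2 * q (.inl k)) • partialDeriv (.inr (.inl k)) u q
          + ((s ^ (2 * d))⁻¹ + ∑ k : Fin d, s ^ 2 * (q (.inl k) * q (.inl k))) •
            (Complex.I * κ * u q) := by
      funext q
      simp [Fintype.sum_sum_type, metricInv, ht, Finset.mul_sum, sq, -Complex.real_smul]
    have hq : DifferentiableAt ℝ (fun q : CoordIndex d → ℝ =>
        (s ^ (2 * d))⁻¹ + ∑ k : Fin d, s ^ 2 * (q (.inl k) * q (.inl k))) p := by fun_prop
    have hq' : ∀ k : Fin d, DifferentiableAt ℝ (fun q : CoordIndex d → ℝ =>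
        s ^ 2 * (q (.inl k) * q (.inl k))) p := fun k => by fun_prop
    rw [e, partialDeriv_add _ (DifferentiableAt.fun_sum fun k _ => (hc k).fun_smul (hd1 _ p))
        (hq.fun_smul ((hd p).const_mul _)),
      partialDeriv_sum _ (fun k _ => (hc k).fun_smul (hd1 _ p)),
      partialDeriv_smul _ hq ((hd p).const_mul _), partialDeriv_const_mul _ _ (hd p), ht,
      partialDeriv_add _ (by fun_prop) (DifferentiableAt.fun_sum fun k _ => hq' k),
      partialDeriv_sum _ (fun k _ => hq' k)]
    simp only [partialDeriv_smul _ (hc _) (hd1 _ p), partialDeriv_const_mul_coord, hty,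
      partialDeriv_const, partialDeriv_const_mul_coord_mul_coord]
    simp [Finset.mul_sum, sq]
  have hsum : ∀ G : CoordIndex d → ℂ, ∑ i, G i
      = ∑ k, G (.inl k) + (∑ k, G (.inr (.inl k)) + G (.inr (.inr ()))) := fun G => by
    simp [Fintype.sum_sum_type]
  rw [hsum, ft]
  simp only [fx, fy, oscillator, Finset.sum_add_distrib, mul_add, mul_pow, Finset.mul_sum, add_mul,
    Finset.sum_mul]
  have e1 : ∀ k : Fin d, (s : ℂ) ^ 2 *
      (2 * (Complex.I * κ * p (.inl k)) * partialDeriv (.inr (.inl k)) u p)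
      = s ^ 2 * (p (.inl k)) * (Complex.I * κ * partialDeriv (.inr (.inl k)) u p) +
        s ^ 2 * (p (.inl k)) * (Complex.I * κ * partialDeriv (.inr (.inl k)) u p) := fun k => by
    ring
  have e2 : ∀ k : Fin d, (s : ℂ) ^ 2 * (p (.inl k)) ^ 2 * (Complex.I * κ * (Complex.I * κ * u p))
      = s ^ 2 * (Complex.I ^ 2 * κ ^ 2 * p (.inl k) ^ 2 * u p) := fun k => by ring
  simp only [e1, e2, Finset.sum_add_distrib]
  push_cast
  linear_combination (-(s ^ (2 * d) : ℂ)⁻¹ * κ ^ 2 * u p) * Complex.I_sq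

theorem yamabe_metric {d : ℕ} (hd : 1 ≤ d) {s : ℝ} (hs : s ≠ 0) (κ : ℝ)
    {u : (CoordIndex d → ℝ) → ℂ} (hu : ContDiff ℝ 2 u)
    (ht : ∀ p, partialDeriv (.inr (.inr ())) u p = Complex.I * κ * u p) (p : CoordIndex d → ℝ) :
    yamabe (metric d s) u p = -∑ j, oscillator s κ j u p +
      (κ ^ 2 * (s ^ (2 * d))⁻¹ - (2 * d - 1) / 16 * s ^ (2 * d + 2) : ℝ) * u p := by
  have hd' : (d : ℝ) ≠ 0 := by positivity
  have hc : ((Fintype.card (CoordIndex d) : ℝ) - 2) / (4 * ((Fintype.card (CoordIndex d) : ℝ) - 1))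
      * scalarCurvature (metric d s) p = -((2 * d - 1) / 16 * s ^ (2 * d + 2)) := by
    rw [scalarCurvature_metric hs]
    simp only [Fintype.card_sum, Fintype.card_fin, Fintype.card_unit]
    push_cast
    rw [show 4 * ((d : ℝ) + (d + 1) - 1) = 8 * d by ring]
    field_simp
    ring
  rw [yamabe, hc, laplacian_metric hs κ hu ht, Complex.real_smul]
  push_cast
  ring

end Heisenberg

namespace CoordGeom

/-! ### Integration over boxes -/

variable {ι : Type*} [Fintype ι]

theorem integrableOn_box {w : (ι → ℝ) → ℂ} (hw : Continuous w) (L : ι → ℝ) :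
    IntegrableOn w (Set.univ.pi fun i => Set.Ico 0 (L i)) :=
  (hw.continuousOn.integrableOn_compact (isCompact_univ_pi fun i => isCompact_Icc (a := 0)
    (b := L i))).mono_set (Set.pi_mono fun _ _ => Set.Ico_subset_Icc_self)

theorem integral_pi_unique {κ : Type*} {_ : Fintype κ} [Unique κ] (ν : κ → Measure ℝ)
    [∀ j, SigmaFinite (ν j)] (F : (κ → ℝ) → ℂ) :
    ∫ a, F a ∂Measure.pi ν = ∫ τ, F (fun _ => τ) ∂ν default := by
  rw [← (measurePreserving_piUnique ν).symm.integral_comp']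
  refine integral_congr_ae (Filter.Eventually.of_forall fun τ => congrArg F ?_)
  funext j
  rw [Unique.eq_default j]
  simp [MeasurableEquiv.piUnique]

variable [DecidableEq ι]

/-- By Fubini, an integral over a box vanishes if the integral over every segment in one
coordinate direction does. -/
theorem integral_box_eq_zero (L : ι → ℝ) (i : ι) (w : (ι → ℝ) → ℂ)
    (h : ∀ p, ∫ τ in Set.Ico 0 (L i), w (Function.update p i τ) = 0) :
    ∫ p in Set.univ.pi (fun i => Set.Ico 0 (L i)), w p = 0 := by
  set μ : ι → Measure ℝ := fun j => volume.restrict (Set.Ico 0 (L j)) with hμ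
  have hvol : (volume : Measure (ι → ℝ)).restrict (Set.univ.pi fun i => Set.Ico 0 (L i))
      = Measure.pi μ := by
    rw [volume_pi, Measure.restrict_pi_pi]
  rw [hvol]
  let e := MeasurableEquiv.piEquivPiSubtypeProd (fun _ : ι => ℝ) (· = i)
  have he : MeasurePreserving e (Measure.pi μ) _ := measurePreserving_piEquivPiSubtypeProd μ (· = i)
  have h1 := he.integral_comp' (g := fun q => w (e.symm q))
  simp only [MeasurableEquiv.symm_apply_apply] at h1
  rw [h1]
  -- no integrability of `w` is needed: otherwise the integral is zero by convention
  by_contra hne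
  rw [integral_prod_symm _ (not_imp_comm.1 integral_undef hne)] at hne
  refine hne (integral_eq_zero_of_ae (Filter.Eventually.of_forall fun b => ?_))
  simp only [Pi.zero_apply]
  rw [integral_pi_unique, ← h (fun j => if hj : j = i then 0 else b ⟨j, hj⟩)]
  refine integral_congr_ae (Filter.Eventually.of_forall fun τ => congrArg w ?_)
  funext j
  by_cases hj : j = i
  · subst hj
    simp [e, MeasurableEquiv.piEquivPiSubtypeProd, Equiv.piEquivPiSubtypeProd]
  · simp [e, MeasurableEquiv.piEquivPiSubtypeProd, Equiv.piEquivPiSubtypeProd, hj]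

theorem hasDerivAt_comp_update {F : Type*} [NormedAddCommGroup F] [NormedSpace ℝ F]
    {u : (ι → ℝ) → F} (hu : Differentiable ℝ u) (p : ι → ℝ)
    (i : ι) (τ : ℝ) :
    HasDerivAt (fun τ => u (Function.update p i τ)) (partialDeriv i u (Function.update p i τ)) τ :=
  (hu _).hasFDerivAt.comp_hasDerivAt τ (hasDerivAt_update p i τ)

/-- Integration by parts for the square of `d/dτ + iκ` on functions with the same Floquet
multiplier `c` of modulus one. -/
theorem integral_conj_mul_sub_eq_zero {L κ : ℝ} (hL : 0 ≤ L) {c : ℂ} (hc : ‖c‖ = 1)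
    {U U' U'' V V' V'' : ℝ → ℂ}
    (hU : ∀ τ, HasDerivAt U (U' τ) τ) (hU' : ∀ τ, HasDerivAt U' (U'' τ) τ)
    (hV : ∀ τ, HasDerivAt V (V' τ) τ) (hV' : ∀ τ, HasDerivAt V' (V'' τ) τ)
    (hUc : ∀ τ, U (τ + L) = c * U τ) (hVc : ∀ τ, V (τ + L) = c * V τ)
    (hU'' : Continuous U'') (hV'' : Continuous V'') :
    ∫ τ in Set.Ico 0 L, (starRingEnd ℂ (V τ) * (U'' τ + 2 * (Complex.I * κ) * U' τ
        + (Complex.I * κ) ^ 2 * U τ)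
      - starRingEnd ℂ (V'' τ + 2 * (Complex.I * κ) * V' τ + (Complex.I * κ) ^ 2 * V τ) * U τ)
        = 0 := by
  have hper : ∀ {W W' : ℝ → ℂ}, (∀ τ, HasDerivAt W (W' τ) τ) → (∀ τ, W (τ + L) = c * W τ) →
      ∀ τ, W' (τ + L) = c * W' τ := fun hW hWc τ => by
    have h1 := (hW (τ + L)).comp_add_const τ L
    rw [funext hWc] at h1
    exact h1.unique ((hW τ).const_mul c)
  have conj : ∀ {W W' : ℝ → ℂ}, (∀ τ, HasDerivAt W (W' τ) τ) →
      ∀ τ, HasDerivAt (fun τ => starRingEnd ℂ (W τ)) (starRingEnd ℂ (W' τ)) τ :=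
    fun hW τ => Complex.conjCLE.toContinuousLinearMap.hasFDerivAt.comp_hasDerivAt τ (hW τ)
  have cont : ∀ {W W' : ℝ → ℂ}, (∀ τ, HasDerivAt W (W' τ) τ) → Continuous W :=
    fun hW => continuous_iff_continuousAt.2 fun τ => (hW τ).continuousAt
  have cU := cont hU
  have cU' := cont hU'
  have cV := cont hV
  have cV' := cont hV'
  rw [integral_Ico_eq_integral_Ioc, ← intervalIntegral.integral_of_le hL]
  -- a primitive of the integrand; it is periodic because `c̄ c = 1`
  rw [intervalIntegral.integral_eq_sub_of_hasDerivAt (f := fun τ =>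
    starRingEnd ℂ (V τ) * U' τ - starRingEnd ℂ (V' τ) * U τ
      + 2 * (Complex.I * κ) * (starRingEnd ℂ (V τ) * U τ))]
  · have hcc : starRingEnd ℂ c * c = 1 := by
      rw [mul_comm, Complex.mul_conj, Complex.normSq_eq_norm_sq, hc]; simp
    have e1 := hUc 0
    have e2 := hVc 0
    have e3 := hper hU hUc 0
    have e4 := hper hV hVc 0
    rw [zero_add] at e1 e2 e3 e4
    rw [e1, e2, e3, e4]
    simp only [map_mul]
    linear_combination (starRingEnd ℂ (V 0) * U' 0 - starRingEnd ℂ (V' 0) * U 0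
      + 2 * (Complex.I * κ) * (starRingEnd ℂ (V 0) * U 0)) * hcc
  · intro τ _
    refine ((((conj hV τ).fun_mul (hU' τ)).fun_sub ((conj hV' τ).fun_mul (hU τ))).fun_add
      (((conj hV τ).fun_mul (hU τ)).const_mul (2 * (Complex.I * κ)))).congr_deriv ?_
    simp only [map_add, map_mul, map_pow, Complex.conj_I, Complex.conj_ofReal, map_ofNat]
    ring
  · refine Continuous.intervalIntegrable ?_ _ _
    have cc : ∀ {W : ℝ → ℂ}, Continuous W → Continuous fun τ => starRingEnd ℂ (W τ) :=
      fun h => Complex.continuous_conj.comp h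
    exact ((cc cV).mul ((hU''.add (continuous_const.mul cU')).add (continuous_const.mul cU))).sub
      ((cc ((hV''.add (continuous_const.mul cV')).add (continuous_const.mul cV))).mul cU)

end CoordGeom

namespace Heisenberg

open CoordGeom

/-! ### Integration over the fundamental domain -/

/-- The side lengths of the fundamental domain. -/
def sideLength {d : ℕ} (r : Fin d → ℕ) : CoordIndex d → ℝ :=
  Sum.elim (fun _ => 1) (Sum.elim (fun j => r j) (fun _ => 1))

theorem fundamentalDomain_eq_pi (d : ℕ) (r : Fin d → ℕ) :
    fundamentalDomain d r = Set.univ.pi fun i => Set.Ico 0 (sideLength r i) := by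
  ext u
  simp [fundamentalDomain, sideLength, Set.mem_pi, show ∀ P : Unit → Prop, (∀ b, P b) ↔ P () from
    fun P => ⟨fun h => h _, fun h _ => h⟩]

theorem measurableSet_fundamentalDomain (d : ℕ) (r : Fin d → ℕ) :
    MeasurableSet (fundamentalDomain d r) := by
  rw [fundamentalDomain_eq_pi]
  exact MeasurableSet.univ_pi fun i => measurableSet_Ico

theorem riemannianVolume_metric {d : ℕ} {s : ℝ} (hs : s ≠ 0) :
    riemannianVolume (metric d s) = volume := by
  simp [riemannianVolume, det_metric hs]

theorem measurable_coord (d : ℕ) : Measurable (coord d) := comap_measurable _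

theorem measurable_proj_coord_symm {d : ℕ} (r : Fin d → ℕ) :
    Measurable fun v => proj r ((coord d).symm v) := by
  have h : Measurable (coord d).symm := by
    rintro _ ⟨t, ht, rfl⟩
    simpa [← Set.preimage_comp] using ht
  exact Measurable.comp (fun _ h => h : Measurable (proj r)) h

theorem measurable_of_pullback {d : ℕ} {r : Fin d → ℕ} {u : Nilmanifold d r → ℂ}
    (hu : Measurable (pullback u)) : Measurable u :=
  measurable_from_quotient.2 (hu.comp (measurable_coord d))

theorem integral_volumeM {d : ℕ} {r : Fin d → ℕ} {s : ℝ} (hs : s ≠ 0) {u : Nilmanifold d r → ℂ}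
    (hu : AEStronglyMeasurable u (volumeM d r s)) :
    ∫ m, u m ∂volumeM d r s = ∫ v in fundamentalDomain d r, pullback u v := by
  rw [volumeM, integral_map (measurable_proj_coord_symm r).aemeasurable hu,
    riemannianVolume_metric hs]
  rfl

/-- The inner product of `L²(M)` on functions on `ℍ_d`, by integration over the fundamental
domain. -/
def pairing {d : ℕ} (r : Fin d → ℕ) (v u : (CoordIndex d → ℝ) → ℂ) : ℂ :=
  ∫ p in fundamentalDomain d r, starRingEnd ℂ (v p) * u p

theorem memLp_of_continuous_pullback {d : ℕ} {r : Fin d → ℕ} {s : ℝ} (hs : s ≠ 0)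
    {u : Nilmanifold d r → ℂ} (hu : Continuous (pullback u)) : MemLp u 2 (volumeM d r s) := by
  have hm := measurable_of_pullback hu.measurable
  rw [volumeM, riemannianVolume_metric hs, memLp_map_measure_iff hm.aestronglyMeasurable
    (measurable_proj_coord_symm r).aemeasurable, memLp_two_iff_integrable_sq_norm
      (hm.comp (measurable_proj_coord_symm r)).aestronglyMeasurable]
  have h := integrableOn_box (w := fun p => ((‖pullback u p‖ ^ 2 : ℝ) : ℂ))
    (Complex.continuous_ofReal.comp (hu.norm.pow 2)) (sideLength r)
  rw [← fundamentalDomain_eq_pi] at h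
  exact h.re

end Heisenberg

namespace CoordGeom

theorem update_add_eq {ι : Type*} [DecidableEq ι] (p : ι → ℝ) (i : ι) (τ L : ℝ) :
    Function.update p i (τ + L) = Function.update p i τ + Pi.single i L := by
  funext j
  by_cases hj : j = i
  · subst hj; simp
  · simp [hj]

variable {ι : Type*} [Fintype ι] [DecidableEq ι]

theorem partialDeriv_eq_of_hasDerivAt {F : Type*} [NormedAddCommGroup F] [NormedSpace ℝ F]
    {u : (ι → ℝ) → F} (hu : Differentiable ℝ u) {p : ι → ℝ} {i : ι} {D : F}
    (h : HasDerivAt (fun τ => u (Function.update p i τ)) D (p i)) : partialDeriv i u p = D := by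
  simpa using (hasDerivAt_comp_update hu p i (p i)).unique h

/-- A function on the box which is periodic in one direction, and multiplied by `c ≠ 1` under some
translation in that direction, has integral zero. -/
theorem integral_box_eq_zero_of_shift {L : ι → ℝ} (hL : ∀ i, 0 ≤ L i) {w : (ι → ℝ) → ℂ} (i : ι)
    {a : ℝ} {c : ℂ} (hc : c ≠ 1) (hper : ∀ p, w (p + Pi.single i (L i)) = w p)
    (hshift : ∀ p, w (p + Pi.single i a) = c * w p) :
    ∫ p in Set.univ.pi (fun i => Set.Ico 0 (L i)), w p = 0 := by
  refine integral_box_eq_zero L i w fun p => ?_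
  rw [integral_Ico_eq_integral_Ioc, ← intervalIntegral.integral_of_le (hL i)]
  set W : ℝ → ℂ := fun τ => w (Function.update p i τ) with hW
  have hP : Function.Periodic W (L i) := fun τ => by
    simp only [hW, update_add_eq, hper]
  have h1 : ∫ τ in (0 : ℝ)..L i, W (τ + a) = ∫ τ in (0 : ℝ)..L i, W τ := by
    rw [intervalIntegral.integral_comp_add_right, zero_add, add_comm (L i) a,
      hP.intervalIntegral_add_eq a 0, zero_add]
  have h2 : ∫ τ in (0 : ℝ)..L i, W (τ + a) = c * ∫ τ in (0 : ℝ)..L i, W τ := by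
    rw [← intervalIntegral.integral_const_mul]
    refine intervalIntegral.integral_congr fun τ _ => ?_
    simp only [hW, update_add_eq, hshift]
  have h3 : (c - 1) * ∫ τ in (0 : ℝ)..L i, W τ = 0 := by
    rw [sub_mul, ← h2, h1, one_mul, sub_self]
  exact (mul_eq_zero.1 h3).resolve_left (sub_ne_zero.2 hc)

end CoordGeom

namespace Heisenberg

open CoordGeom

/-! ### Functions of fixed central frequency -/

/-- Smooth functions on `ℍ_d` which are `Γ_r`-invariant with central frequency `n`, expressed
through their behaviour under translations of the coordinates. -/
structure HasFrequency {d : ℕ} (r : Fin d → ℕ) (n : ℤ) (u : (CoordIndex d → ℝ) → ℂ) : Prop where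
  contDiff : ContDiff ℝ ∞ u
  x_shift : ∀ p j, u (p + Pi.single (.inl j) 1) =
    Complex.exp (-(2 * Real.pi * Complex.I * n * p (.inr (.inl j)))) * u p
  y_shift : ∀ p j, u (p + Pi.single (.inr (.inl j)) (r j : ℝ)) = u p
  t_shift : ∀ p (τ : ℝ), u (p + Pi.single (.inr (.inr ())) τ) =
    Complex.exp (2 * Real.pi * Complex.I * n * τ) * u p

theorem proj_mul {d : ℕ} {r : Fin d → ℕ} {γ : Heisenberg d} (hγ : γ ∈ lattice d r)
    (p : Heisenberg d) : proj r (γ * p) = proj r p := by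
  refine Quotient.sound (QuotientGroup.rightRel_apply.2 ?_)
  simpa using (lattice d r).inv_mem hγ

theorem hasFrequency_pullback {d : ℕ} {r : Fin d → ℕ} {n : ℤ} {u : Nilmanifold d r → ℂ}
    (hs : SmoothM u) (hn : InHn n u) : HasFrequency r n (pullback u) := by
  obtain ⟨g, hg⟩ := hn
  have hpb : ∀ v : CoordIndex d → ℝ, pullback u v =
      u (proj r ⟨fun j => v (.inl j), fun j => v (.inr (.inl j)), v (.inr (.inr ()))⟩) :=
    fun v => rfl
  have t_shift : ∀ (p : CoordIndex d → ℝ) (τ : ℝ),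
      pullback u (p + Pi.single (.inr (.inr ())) τ) =
        Complex.exp (2 * Real.pi * Complex.I * n * τ) * pullback u p := fun p τ => by
    simp only [hpb, hg]
    rw [← mul_assoc, ← Complex.exp_add]
    simp [mul_add, add_comm]
  -- left multiplication by `(e_j, 0, 0)` is translation by `e_j` in `x` and by `y_j` in `t`, and
  -- left multiplication by `(0, r_j e_j, 0)` is translation by `r_j e_j` in `y`
  refine ⟨hs, fun p j => ?_, fun p j => ?_, t_shift⟩
  · have h := t_shift p (-p (.inr (.inl j)))
    push_cast at h
    rw [mul_neg] at h
    have hγ : (⟨Pi.single j 1, 0, 0⟩ : Heisenberg d) ∈ lattice d r :=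
      ⟨fun i => ⟨if i = j then 1 else 0, by simp [Pi.single_apply]⟩, fun i => ⟨0, by simp⟩,
        ⟨0, by simp⟩⟩
    rw [← h, hpb, hpb]
    refine congrArg u (Eq.trans (congrArg _ ?_) (proj_mul hγ _))
    ext i
    · simp [Pi.single_apply, add_comm]
    · simp
    · simp
  · have hγ : (⟨0, Pi.single j (r j : ℝ), 0⟩ : Heisenberg d) ∈ lattice d r := by
      refine ⟨fun i => ⟨0, by simp⟩, fun i => ⟨if i = j then 1 else 0, ?_⟩, ⟨0, by simp⟩⟩
      by_cases h : i = j
      · subst h; simp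
      · simp [h]
    rw [hpb, hpb]
    refine congrArg u (Eq.trans (congrArg _ ?_) (proj_mul hγ _))
    ext i
    · simp
    · simp [Pi.single_apply, add_comm]
    · simp

theorem HasFrequency.differentiable {d : ℕ} {r : Fin d → ℕ} {n : ℤ} {u : (CoordIndex d → ℝ) → ℂ}
    (hu : HasFrequency r n u) : Differentiable ℝ u := hu.contDiff.differentiable (by simp)

theorem HasFrequency.contDiff_partialDeriv {d : ℕ} {r : Fin d → ℕ} {n : ℤ}
    {u : (CoordIndex d → ℝ) → ℂ} (hu : HasFrequency r n u) (i : CoordIndex d) :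
    ContDiff ℝ ∞ (partialDeriv i u) :=
  CoordGeom.contDiff_partialDeriv hu.contDiff (by simp) i

theorem HasFrequency.partialDeriv_t {d : ℕ} {r : Fin d → ℕ} {n : ℤ} {u : (CoordIndex d → ℝ) → ℂ}
    (hu : HasFrequency r n u) (p : CoordIndex d → ℝ) :
    partialDeriv (.inr (.inr ())) u p = Complex.I * (2 * Real.pi * n : ℝ) * u p := by
  -- along the `t`-axis, `u` is `e^{2iπnτ}` times its value at `τ = 0`
  set q := Function.update p (.inr (.inr ())) 0
  have h0 : ∀ τ, u (Function.update p (.inr (.inr ())) τ)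
      = Complex.exp (2 * Real.pi * Complex.I * n * τ) * u q := fun τ => by
    rw [← hu.t_shift, ← update_add_eq, zero_add]
  have hp := h0 (p (.inr (.inr ())))
  rw [Function.update_eq_self] at hp
  refine partialDeriv_eq_of_hasDerivAt hu.differentiable ?_
  rw [funext h0, hp]
  have h1 : HasDerivAt (fun τ : ℝ => 2 * Real.pi * Complex.I * n * (τ : ℂ))
      (2 * Real.pi * Complex.I * n) (p (.inr (.inr ()))) := by
    simpa using (Complex.ofRealCLM.hasDerivAt (x := p (.inr (.inr ())))).const_mul
      (2 * Real.pi * Complex.I * n : ℂ)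
  refine (h1.cexp.mul_const _).congr_deriv ?_
  push_cast
  ring

theorem HasFrequency.add {d : ℕ} {r : Fin d → ℕ} {n : ℤ} {u v : (CoordIndex d → ℝ) → ℂ}
    (hu : HasFrequency r n u) (hv : HasFrequency r n v) : HasFrequency r n (u + v) where
  contDiff := hu.contDiff.add hv.contDiff
  x_shift p j := by simp [hu.x_shift, hv.x_shift, mul_add]
  y_shift p j := by simp [hu.y_shift, hv.y_shift]
  t_shift p τ := by simp [hu.t_shift, hv.t_shift, mul_add]

theorem HasFrequency.const_smul {d : ℕ} {r : Fin d → ℕ} {n : ℤ} {u : (CoordIndex d → ℝ) → ℂ}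
    (hu : HasFrequency r n u) (c : ℂ) : HasFrequency r n (c • u) where
  contDiff := contDiff_const.smul hu.contDiff
  x_shift p j := by simp [hu.x_shift]; ring
  y_shift p j := by simp [hu.y_shift]
  t_shift p τ := by simp [hu.t_shift]; ring

theorem continuous_conj_mul {d : ℕ} {u v : (CoordIndex d → ℝ) → ℂ} (hv : Continuous v)
    (hu : Continuous u) : Continuous fun p => starRingEnd ℂ (v p) * u p :=
  (Complex.continuous_conj.comp hv).mul hu

theorem integrableOn_fundamentalDomain {d : ℕ} (r : Fin d → ℕ) {w : (CoordIndex d → ℝ) → ℂ}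
    (hw : Continuous w) : IntegrableOn w (fundamentalDomain d r) := by
  rw [fundamentalDomain_eq_pi]
  exact integrableOn_box hw _

theorem conj_exp_two_pi_mul (x : ℝ) : starRingEnd ℂ (Complex.exp (2 * Real.pi * Complex.I * x)) =
    Complex.exp (-(2 * Real.pi * Complex.I * x)) := by
  rw [← Complex.exp_conj]
  congr 1
  simp only [map_mul, map_ofNat, Complex.conj_ofReal, Complex.conj_I]
  ring

theorem sideLength_nonneg {d : ℕ} (r : Fin d → ℕ) (i : CoordIndex d) : 0 ≤ sideLength r i := by
  rcases i with i | i | i <;> simp [sideLength]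

/-- Functions of distinct central frequencies are orthogonal. -/
theorem pairing_eq_zero_of_frequency_ne {d : ℕ} {r : Fin d → ℕ} {n n' : ℤ} (h : n ≠ n')
    {u v : (CoordIndex d → ℝ) → ℂ} (hu : HasFrequency r n u) (hv : HasFrequency r n' v) :
    pairing r v u = 0 := by
  have key : ∀ p (τ : ℝ), starRingEnd ℂ (v (p + Pi.single (.inr (.inr ())) τ))
      * u (p + Pi.single (.inr (.inr ())) τ)
      = Complex.exp (2 * Real.pi * Complex.I * ((n - n') * τ)) * (starRingEnd ℂ (v p) * u p) := by
    intro p τ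
    have e := conj_exp_two_pi_mul (n' * τ)
    push_cast at e
    rw [hu.t_shift, hv.t_shift, map_mul, mul_assoc _ (n' : ℂ), e, mul_assoc _ (n : ℂ),
      mul_mul_mul_comm, ← Complex.exp_add]
    congr 2
    ring
  have hne : (n : ℂ) - n' ≠ 0 := by
    rw [sub_ne_zero]
    exact_mod_cast h
  rw [pairing, fundamentalDomain_eq_pi]
  -- translation in `t` by `1 / (2 (n - n'))` changes the sign of the integrand
  refine integral_box_eq_zero_of_shift (sideLength_nonneg r) (.inr (.inr ()))
    (a := 1 / (2 * (n - n'))) (c := -1) (by norm_num) (fun p => ?_) (fun p => ?_)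
  · rw [show sideLength r (.inr (.inr ())) = 1 from rfl, key]
    have := exp_two_pi_int (n - n')
    push_cast at this
    simp [this]
  · rw [key, ← Complex.exp_pi_mul_I]
    congr 2
    push_cast
    field_simp

/-- The operators `X_j² + Y_j²` are symmetric on functions of central frequency `n`. -/
theorem pairing_oscillator {d : ℕ} {r : Fin d → ℕ} {n : ℤ} (s : ℝ) (j : Fin d)
    {u v : (CoordIndex d → ℝ) → ℂ} (hu : HasFrequency r n u) (hv : HasFrequency r n v) :
    pairing r v (oscillator s (2 * Real.pi * n) j u) =
      pairing r (oscillator s (2 * Real.pi * n) j v) u := by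
  set κ : ℝ := 2 * Real.pi * n with hκ
  have dx : ∀ {u : (CoordIndex d → ℝ) → ℂ}, HasFrequency r n u → ∀ i,
      Differentiable ℝ (partialDeriv i u) := fun hu i =>
    (hu.contDiff_partialDeriv i).differentiable (by simp)
  have cx : ∀ {u : (CoordIndex d → ℝ) → ℂ}, HasFrequency r n u → ∀ i,
      Continuous (partialDeriv i (partialDeriv i u)) := fun hu i =>
    (CoordGeom.contDiff_partialDeriv (m := ∞) (hu.contDiff_partialDeriv i) (by simp) i).continuous
  have cl : ∀ p (i : CoordIndex d), Continuous fun τ : ℝ => Function.update p i τ := fun p i =>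
    continuous_const.update i continuous_id
  have hX : ∫ p in fundamentalDomain d r,
      (starRingEnd ℂ (v p) * partialDeriv (.inl j) (partialDeriv (.inl j) u) p -
        starRingEnd ℂ (partialDeriv (.inl j) (partialDeriv (.inl j) v) p) * u p) = 0 := by
    rw [fundamentalDomain_eq_pi]
    refine integral_box_eq_zero _ (.inl j) _ fun p => ?_
    have h := integral_conj_mul_sub_eq_zero (L := 1) (κ := 0) zero_le_one
      (c := Complex.exp (-(2 * Real.pi * Complex.I * n * p (.inr (.inl j))))) (by
        have := norm_exp_two_pi (-(n * p (.inr (.inl j))))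
        push_cast at this
        rw [mul_neg, ← mul_assoc] at this
        exact this)
      (fun τ => hasDerivAt_comp_update hu.differentiable p (.inl j) τ)
      (fun τ => hasDerivAt_comp_update (dx hu (.inl j)) p (.inl j) τ)
      (fun τ => hasDerivAt_comp_update hv.differentiable p (.inl j) τ)
      (fun τ => hasDerivAt_comp_update (dx hv (.inl j)) p (.inl j) τ)
      (fun τ => by rw [update_add_eq, hu.x_shift]; simp)
      (fun τ => by rw [update_add_eq, hv.x_shift]; simp)
      ((cx hu _).comp (cl p _)) ((cx hv _).comp (cl p _))
    simpa [sideLength] using h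
  have hY : ∫ p in fundamentalDomain d r,
      (starRingEnd ℂ (v p) * (partialDeriv (.inr (.inl j)) (partialDeriv (.inr (.inl j)) u) p
        + 2 * (Complex.I * κ * p (.inl j)) * partialDeriv (.inr (.inl j)) u p
        + (Complex.I * κ * p (.inl j)) ^ 2 * u p) -
        starRingEnd ℂ (partialDeriv (.inr (.inl j)) (partialDeriv (.inr (.inl j)) v) p
        + 2 * (Complex.I * κ * p (.inl j)) * partialDeriv (.inr (.inl j)) v p
        + (Complex.I * κ * p (.inl j)) ^ 2 * v p) * u p) = 0 := by
    rw [fundamentalDomain_eq_pi]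
    refine integral_box_eq_zero _ (.inr (.inl j)) _ fun p => ?_
    have h := integral_conj_mul_sub_eq_zero (L := r j) (κ := κ * p (.inl j)) (Nat.cast_nonneg _)
      (c := 1) (by simp)
      (fun τ => hasDerivAt_comp_update hu.differentiable p (.inr (.inl j)) τ)
      (fun τ => hasDerivAt_comp_update (dx hu (.inr (.inl j))) p (.inr (.inl j)) τ)
      (fun τ => hasDerivAt_comp_update hv.differentiable p (.inr (.inl j)) τ)
      (fun τ => hasDerivAt_comp_update (dx hv (.inr (.inl j))) p (.inr (.inl j)) τ)
      (fun τ => by rw [update_add_eq, hu.y_shift]; simp)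
      (fun τ => by rw [update_add_eq, hv.y_shift]; simp)
      ((cx hu _).comp (cl p _)) ((cx hv _).comp (cl p _))
    simpa [sideLength, mul_assoc] using h
  have cu := hu.contDiff.continuous
  have cv := hv.contDiff.continuous
  have hc : Continuous fun p : CoordIndex d → ℝ => Complex.I * κ * p (.inl j) := by fun_prop
  have cY : ∀ {u : (CoordIndex d → ℝ) → ℂ}, HasFrequency r n u → Continuous fun p =>
      partialDeriv (.inr (.inl j)) (partialDeriv (.inr (.inl j)) u) p
        + 2 * (Complex.I * κ * p (.inl j)) * partialDeriv (.inr (.inl j)) u p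
        + (Complex.I * κ * p (.inl j)) ^ 2 * u p := fun hu =>
    ((cx hu _).add ((continuous_const.mul hc).mul (dx hu _).continuous)).add
      ((hc.pow 2).mul hu.contDiff.continuous)
  have co : ∀ {u : (CoordIndex d → ℝ) → ℂ}, HasFrequency r n u →
      Continuous (oscillator s κ j u) := fun hu => (cx hu _).add (continuous_const.mul (cY hu))
  rw [← sub_eq_zero, pairing, pairing, ← integral_sub
    (integrableOn_fundamentalDomain r (continuous_conj_mul cv (co hu)))
    (integrableOn_fundamentalDomain r (continuous_conj_mul (co hv) cu))]
  have iX := integrableOn_fundamentalDomain r ((continuous_conj_mul cv (cx hu (.inl j))).sub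
    (continuous_conj_mul (cx hv (.inl j)) cu))
  have iY := integrableOn_fundamentalDomain r ((continuous_conj_mul cv (cY hu)).sub
    (continuous_conj_mul (cY hv) cu))
  have h := integral_add iX (iY.const_mul ((s : ℂ) ^ 2))
  simp only [Pi.sub_apply] at h
  rw [integral_const_mul, hX, hY, mul_zero, add_zero] at h
  rw [← h]
  refine integral_congr_ae (Filter.Eventually.of_forall fun p => ?_)
  simp only [oscillator, map_add, map_mul, map_pow, Complex.conj_ofReal]
  ring

/-! ### Functions vanishing almost everywhere -/

theorem coord_inl {d : ℕ} (p : Heisenberg d) (j : Fin d) : coord d p (.inl j) = p.x j := rfl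

theorem coord_inr_inl {d : ℕ} (p : Heisenberg d) (j : Fin d) :
    coord d p (.inr (.inl j)) = p.y j := rfl

theorem coord_inr_inr {d : ℕ} (p : Heisenberg d) : coord d p (.inr (.inr ())) = p.t := rfl

theorem exists_mem_fundamentalDomain {d : ℕ} {r : Fin d → ℕ} (hr : ∀ j, 0 < r j)
    (m : Nilmanifold d r) : ∃ v ∈ fundamentalDomain d r, proj r ((coord d).symm v) = m := by
  obtain ⟨p, rfl⟩ := Quotient.exists_rep m
  -- `x` and `y` are reduced independently; then `t` is reduced after the shift caused by `x`
  let γ : Heisenberg d := ⟨fun j => -⌊p.x j⌋, fun j => r j * (-⌊p.y j / r j⌋ : ℤ),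
    -⌊p.t + (fun j => -(⌊p.x j⌋ : ℝ)) ⬝ᵥ p.y⌋⟩
  have hγ : γ ∈ lattice d r := ⟨fun j => ⟨-⌊p.x j⌋, by simp [γ]⟩, fun j => ⟨_, rfl⟩,
    ⟨-⌊p.t + (fun j => -(⌊p.x j⌋ : ℝ)) ⬝ᵥ p.y⌋, by simp [γ]⟩⟩
  refine ⟨coord d (γ * p), ⟨fun j => ?_, fun j => ?_, ?_⟩, ?_⟩
  · have e : coord d (γ * p) (.inl j) = Int.fract (p.x j) := by
      rw [← Int.self_sub_floor]
      simp only [coord_inl, mul_x, Pi.add_apply, γ]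
      ring
    rw [e]
    exact ⟨Int.fract_nonneg _, Int.fract_lt_one _⟩
  · have hrj : (0 : ℝ) < r j := by exact_mod_cast hr j
    have e : coord d (γ * p) (.inr (.inl j)) = r j * Int.fract (p.y j / r j) := by
      rw [← Int.self_sub_floor]
      simp only [coord_inr_inl, mul_y, Pi.add_apply, γ]
      push_cast
      field_simp
      ring
    rw [e]
    exact ⟨mul_nonneg hrj.le (Int.fract_nonneg _), by
      nlinarith [Int.fract_lt_one (p.y j / r j)]⟩
  · have e : coord d (γ * p) (.inr (.inr ()))
        = Int.fract (p.t + (fun j => -(⌊p.x j⌋ : ℝ)) ⬝ᵥ p.y) := by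
      rw [← Int.self_sub_floor]
      simp only [coord_inr_inr, mul_t, γ]
      ring
    rw [e]
    exact ⟨Int.fract_nonneg _, Int.fract_lt_one _⟩
  · rw [Equiv.symm_apply_apply, proj_mul hγ]
    rfl

/-- A continuous function on `M` which vanishes almost everywhere vanishes. -/
theorem eq_zero_of_pullback_ae_eq_zero {d : ℕ} {r : Fin d → ℕ} (hr : ∀ j, 0 < r j)
    {u : Nilmanifold d r → ℂ} (hu : Continuous (pullback u))
    (h : pullback u =ᵐ[volume.restrict (fundamentalDomain d r)] 0) : u = 0 := by
  set U : Set (CoordIndex d → ℝ) := Set.univ.pi fun i => Set.Ioo 0 (sideLength r i) with hU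
  have hUo : IsOpen U := isOpen_set_pi Set.finite_univ fun i _ => isOpen_Ioo
  have hUD : U ⊆ fundamentalDomain d r := by
    rw [fundamentalDomain_eq_pi]
    exact Set.pi_mono fun _ _ => Set.Ioo_subset_Ico_self
  have h1 : Set.EqOn (pullback u) 0 U := Measure.eqOn_open_of_ae_eq
    (ae_restrict_of_ae_restrict_of_subset hUD h) hUo hu.continuousOn continuous_zero.continuousOn
  have h2 := h1.closure hu continuous_zero
  have hpos : ∀ i, (0 : ℝ) ≠ sideLength r i := by
    intro i
    rcases i with i | i | i <;> simp [sideLength, eq_comm, (hr _).ne']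
  have h3 : fundamentalDomain d r ⊆ closure U := by
    rw [hU, closure_pi_set, fundamentalDomain_eq_pi]
    refine Set.pi_mono fun i _ => ?_
    rw [closure_Ioo (hpos i)]
    exact Set.Ico_subset_Icc_self
  funext m
  obtain ⟨v, hv, rfl⟩ := exists_mem_fundamentalDomain hr m
  exact h2 (h3 hv)

/-! ### The functions `W_n^{a,b} f_α` -/

/-- The factorized form `e^{2iπnt} ∏_j ∑_k h_{α_j}(ν (x_j + k + c_j)) e^{2iπn(k + c_j)y_j}` of
`W_n^{a,b} f_α`, where `c = a + b` and `ν = √(2π|n|s)`. -/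
def hermiteThetaProd {d : ℕ} (n : ℤ) (ν : ℝ) (c : Fin d → ℝ) (α : Fin d → ℕ)
    (p : CoordIndex d → ℝ) : ℂ :=
  Complex.exp (2 * Real.pi * Complex.I * n * p (.inr (.inr ()))) *
    ∏ j, hermiteTheta n ν (c j) (α j) (p (.inl j), p (.inr (.inl j)))

theorem contDiff_hermiteThetaProd {d : ℕ} (n : ℤ) {ν : ℝ} (hν : 0 < ν) (c : Fin d → ℝ)
    (α : Fin d → ℕ) : ContDiff ℝ ∞ (hermiteThetaProd n ν c α) := by
  refine ContDiff.mul ?_ (contDiff_prod fun j _ => (contDiff_hermiteTheta n hν (c j) (α j)).comp ?_)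
  · exact (contDiff_const.mul (Complex.ofRealCLM.contDiff.comp (contDiff_apply ℝ ℝ _))).cexp
  · exact (contDiff_apply ℝ ℝ _).prodMk (contDiff_apply ℝ ℝ _)

theorem hermiteThetaProd_update {d : ℕ} (n : ℤ) (ν : ℝ) (c : Fin d → ℝ) (α : Fin d → ℕ) (j : Fin d)
    (k : ℕ) (p : CoordIndex d → ℝ) :
    hermiteThetaProd n ν c (Function.update α j k) p =
      hermiteTheta n ν (c j) k (p (.inl j), p (.inr (.inl j))) *
        (Complex.exp (2 * Real.pi * Complex.I * n * p (.inr (.inr ()))) *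
          ∏ i ∈ Finset.univ.erase j,
            hermiteTheta n ν (c i) (α i) (p (.inl i), p (.inr (.inl i)))) := by
  rw [hermiteThetaProd, ← Finset.mul_prod_erase _ _ (Finset.mem_univ j), Function.update_self,
    mul_left_comm]
  congr 2
  refine Finset.prod_congr rfl fun i hi => ?_
  rw [Function.update_of_ne (Finset.ne_of_mem_erase hi)]

theorem partialDeriv_x_hermiteThetaProd {d : ℕ} (n : ℤ) {ν : ℝ} (hν : 0 < ν) (c : Fin d → ℝ)
    (α : Fin d → ℕ) (j : Fin d) (k : ℕ) (p : CoordIndex d → ℝ) :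
    partialDeriv (.inl j) (hermiteThetaProd n ν c (Function.update α j k)) p =
      ν * (k * hermiteThetaProd n ν c (Function.update α j (k - 1)) p
        - 2⁻¹ * hermiteThetaProd n ν c (Function.update α j (k + 1)) p) := by
  refine partialDeriv_eq_of_hasDerivAt
    ((contDiff_hermiteThetaProd n hν c _).differentiable (by simp)) ?_
  have h1 : HasDerivAt (fun τ : ℝ => ((τ, p (.inr (.inl j))) : ℝ × ℝ)) (1, 0) (p (.inl j)) :=
    (hasDerivAt_id _).prodMk (hasDerivAt_const _ _)
  have h2 := (hasFDerivAt_hermiteTheta n hν (c j) k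
    (p (.inl j), p (.inr (.inl j)))).comp_hasDerivAt (p (.inl j)) h1
  have h3 := h2.mul_const (Complex.exp (2 * Real.pi * Complex.I * n * p (.inr (.inr ()))) *
    ∏ i ∈ Finset.univ.erase j, hermiteTheta n ν (c i) (α i) (p (.inl i), p (.inr (.inl i))))
  have e : (fun τ => hermiteThetaProd n ν c (Function.update α j k)
      (Function.update p (.inl j) τ)) = fun τ =>
      hermiteTheta n ν (c j) k (τ, p (.inr (.inl j))) *
      (Complex.exp (2 * Real.pi * Complex.I * n * p (.inr (.inr ()))) *
    ∏ i ∈ Finset.univ.erase j, hermiteTheta n ν (c i) (α i) (p (.inl i), p (.inr (.inl i)))) := by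
    funext τ
    rw [hermiteThetaProd_update]
    simp only [Function.update_self, ne_eq, reduceCtorEq, not_false_eq_true, Function.update_of_ne]
    congr 2
    refine Finset.prod_congr rfl fun i hi => ?_
    rw [Function.update_of_ne (by simpa using Finset.ne_of_mem_erase hi)]
  rw [e]
  refine h3.congr_deriv ?_
  simp only [hermiteThetaProd_update, gradForm_apply, hermiteThetaX]
  push_cast
  ring

theorem partialDeriv_y_hermiteThetaProd {d : ℕ} (n : ℤ) {ν : ℝ} (hν : 0 < ν) (c : Fin d → ℝ)
    (α : Fin d → ℕ) (j : Fin d) (k : ℕ) (p : CoordIndex d → ℝ) :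
    partialDeriv (.inr (.inl j)) (hermiteThetaProd n ν c (Function.update α j k)) p =
      Complex.I * (2 * Real.pi * n : ℝ) * ((ν : ℂ)⁻¹ *
        (k * hermiteThetaProd n ν c (Function.update α j (k - 1)) p
          + 2⁻¹ * hermiteThetaProd n ν c (Function.update α j (k + 1)) p)
        - p (.inl j) * hermiteThetaProd n ν c (Function.update α j k) p) := by
  refine partialDeriv_eq_of_hasDerivAt
    ((contDiff_hermiteThetaProd n hν c _).differentiable (by simp)) ?_
  have h1 : HasDerivAt (fun τ : ℝ => ((p (.inl j), τ) : ℝ × ℝ)) (0, 1) (p (.inr (.inl j))) :=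
    (hasDerivAt_const _ _).prodMk (hasDerivAt_id _)
  have h2 := (hasFDerivAt_hermiteTheta n hν (c j) k
    (p (.inl j), p (.inr (.inl j)))).comp_hasDerivAt (p (.inr (.inl j))) h1
  have h3 := h2.mul_const (Complex.exp (2 * Real.pi * Complex.I * n * p (.inr (.inr ()))) *
    ∏ i ∈ Finset.univ.erase j, hermiteTheta n ν (c i) (α i) (p (.inl i), p (.inr (.inl i))))
  have e : (fun τ => hermiteThetaProd n ν c (Function.update α j k)
      (Function.update p (.inr (.inl j)) τ)) = fun τ =>
      hermiteTheta n ν (c j) k (p (.inl j), τ) *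
      (Complex.exp (2 * Real.pi * Complex.I * n * p (.inr (.inr ()))) *
    ∏ i ∈ Finset.univ.erase j, hermiteTheta n ν (c i) (α i) (p (.inl i), p (.inr (.inl i)))) := by
    funext τ
    rw [hermiteThetaProd_update]
    simp only [Function.update_self, ne_eq, reduceCtorEq, Sum.inr.injEq, not_false_eq_true,
      Function.update_of_ne]
    congr 2
    refine Finset.prod_congr rfl fun i hi => ?_
    rw [Function.update_of_ne (by simpa using Finset.ne_of_mem_erase hi)]
  rw [e]
  refine h3.congr_deriv ?_
  simp only [hermiteThetaProd_update, gradForm_apply, hermiteThetaY]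
  push_cast
  ring

/-- The functions `W_n^{a,b} f_α` are eigenfunctions of every `X_j² + Y_j²`. In terms of the raising
and lowering of `α_j`, both `X_j²` and `Y_j²` map `α_j` to `α_j - 2`, `α_j`, `α_j + 2`, and the
terms of index `α_j ± 2` cancel. -/
theorem oscillator_hermiteThetaProd {d : ℕ} {n : ℤ} {s ν : ℝ} (hν : 0 < ν)
    (hνs : ν ^ 2 = 2 * Real.pi * |(n : ℝ)| * s) (c : Fin d → ℝ) (α : Fin d → ℕ) (j : Fin d)
    (p : CoordIndex d → ℝ) :
    oscillator s (2 * Real.pi * n) j (hermiteThetaProd n ν c α) p =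
      -(ν ^ 2 * (2 * α j + 1) : ℝ) * hermiteThetaProd n ν c α p := by
  set E : ℕ → (CoordIndex d → ℝ) → ℂ :=
    fun k => hermiteThetaProd n ν c (Function.update α j k) with hE
  have hα : hermiteThetaProd n ν c α = E (α j) := by simp [hE]
  generalize α j = k at hα
  rw [hα]
  set ik : ℂ := Complex.I * (2 * Real.pi * n : ℝ) with hik
  have dE : ∀ k, Differentiable ℝ (E k) := fun k =>
    (contDiff_hermiteThetaProd n hν c _).differentiable (by simp)
  have hX : ∀ k, partialDeriv (.inl j) (E k) = fun p =>
      ν * (k * E (k - 1) p + -2⁻¹ * E (k + 1) p) :=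
    fun k => funext fun p => by
      rw [partialDeriv_x_hermiteThetaProd n hν]
      ring
  have hY : ∀ k, partialDeriv (.inr (.inl j)) (E k) = fun p =>
      ik * ((ν : ℂ)⁻¹ * (k * E (k - 1) p + 2⁻¹ * E (k + 1) p)) + p (.inl j) • (-ik * E k p) :=
    fun k => funext fun p => by
      rw [partialDeriv_y_hermiteThetaProd n hν, Complex.real_smul]
      ring
  have hlin : ∀ (i : CoordIndex d) (a A B : ℂ) (k l : ℕ),
      partialDeriv i (fun p => a * (A * E k p + B * E l p)) p
      = a * (A * partialDeriv i (E k) p + B * partialDeriv i (E l) p) := fun i a A B k l => by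
    rw [partialDeriv_const_mul _ _ (((dE k p).const_mul A).fun_add ((dE l p).const_mul B)),
      partialDeriv_add _ ((dE k p).const_mul A) ((dE l p).const_mul B),
      partialDeriv_const_mul _ _ (dE k p), partialDeriv_const_mul _ _ (dE l p)]
  have hXX : partialDeriv (.inl j) (partialDeriv (.inl j) (E k)) p =
      ν * (k * partialDeriv (.inl j) (E (k - 1)) p
        + -2⁻¹ * partialDeriv (.inl j) (E (k + 1)) p) := by
    rw [hX k, hlin]
  have hYY : partialDeriv (.inr (.inl j)) (partialDeriv (.inr (.inl j)) (E k)) p =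
      ik * (ν : ℂ)⁻¹ * (k * partialDeriv (.inr (.inl j)) (E (k - 1)) p
        + 2⁻¹ * partialDeriv (.inr (.inl j)) (E (k + 1)) p)
      - ik * p (.inl j) * partialDeriv (.inr (.inl j)) (E k) p := by
    have e : (fun p => ik * ((ν : ℂ)⁻¹ * (k * E (k - 1) p + 2⁻¹ * E (k + 1) p))
        + p (.inl j) • (-ik * E k p)) =
        fun p => ik * (ν : ℂ)⁻¹ * (k * E (k - 1) p + 2⁻¹ * E (k + 1) p)
        + p (.inl j) • (-ik * E k p) := by
      funext p
      ring
    have d1 : DifferentiableAt ℝ (fun p : CoordIndex d → ℝ => p (.inl j)) p := by fun_prop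
    rw [hY k, e, partialDeriv_add _
      ((((dE (k - 1) p).const_mul _).fun_add ((dE (k + 1) p).const_mul _)).const_mul _)
      (d1.fun_smul ((dE k p).const_mul _)), hlin, partialDeriv_smul _ d1 ((dE k p).const_mul _),
      partialDeriv_const_mul _ _ (dE k p), partialDeriv_coord]
    simp [hY k]
    ring
  have hν' : (ν : ℂ) ≠ 0 := by exact_mod_cast hν.ne'
  -- `(sκ)² = ν⁴`
  have hsk : (s : ℂ) ^ 2 * ik ^ 2 = -(ν : ℂ) ^ 4 := by
    have h : s ^ 2 * (2 * Real.pi * n) ^ 2 = ν ^ 4 := by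
      rw [show ν ^ 4 = (ν ^ 2) ^ 2 by ring, hνs]
      linear_combination -(2 * Real.pi * s) ^ 2 * sq_abs (n : ℝ)
    have h' := congrArg (fun z : ℝ => (z : ℂ)) h
    push_cast at h'
    rw [← h', hik]
    push_cast
    linear_combination (s : ℂ) ^ 2 * (2 * Real.pi * n) ^ 2 * Complex.I_sq
  rw [oscillator, ← hik, hXX, hYY]
  simp only [hX, hY, Complex.real_smul]
  push_cast
  have hw : (ν : ℂ) * (ν : ℂ)⁻¹ = 1 := mul_inv_cancel₀ hν'
  generalize (ν : ℂ)⁻¹ = w at hw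
  generalize ((p (.inl j) : ℝ) : ℂ) = x
  -- the two cases avoid the truncated `k - 1`
  rcases k with _ | k
  · simp only [Nat.cast_zero, zero_mul, zero_add]
    push_cast
    linear_combination (w ^ 2 * (2⁻¹ * (E 0 p + 2⁻¹ * E 2 p))) * hsk
      - 2⁻¹ * (E 0 p + 2⁻¹ * E 2 p) * (ν : ℂ) ^ 2 * (ν * w + 1) * hw
  · simp only [Nat.add_sub_cancel]
    push_cast
    linear_combination (w ^ 2 * ((k + 1) * (k * E (k - 1) p + 2⁻¹ * E (k + 1) p)
        + 2⁻¹ * ((k + 2) * E (k + 1) p + 2⁻¹ * E (k + 3) p))) * hsk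
      - ((k + 1) * (k * E (k - 1) p + 2⁻¹ * E (k + 1) p)
        + 2⁻¹ * ((k + 2) * E (k + 1) p + 2⁻¹ * E (k + 3) p)) * (ν : ℂ) ^ 2 * (ν * w + 1) * hw

theorem exists_hermiteThetaProd_ne_zero {d : ℕ} {n : ℤ} (hn : n ≠ 0) {ν : ℝ} (hν : 0 < ν)
    (c : Fin d → ℝ) (α : Fin d → ℕ) : ∃ p, hermiteThetaProd n ν c α p ≠ 0 := by
  choose q hq using fun j => exists_hermiteTheta_ne_zero hn hν (c j) (α j)
  refine ⟨Sum.elim (fun j => (q j).1) (Sum.elim (fun j => (q j).2) fun _ => 0), ?_⟩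
  exact mul_ne_zero (Complex.exp_ne_zero _) (Finset.prod_ne_zero_iff.2 fun j _ => hq j)

/-- The scale `ν = √(2π|n|s)` of the Hermite functions. -/
def frequencyScale (s : ℝ) (n : ℤ) : ℝ := √(2 * Real.pi * |(n : ℝ)| * s)

theorem frequencyScale_pos {s : ℝ} (hs : 0 < s) {n : ℤ} (hn : n ≠ 0) : 0 < frequencyScale s n := by
  have : 0 < |(n : ℝ)| := abs_pos.2 (by exact_mod_cast hn)
  exact Real.sqrt_pos.2 (by positivity)

theorem frequencyScale_sq {s : ℝ} (hs : 0 < s) (n : ℤ) :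
    frequencyScale s n ^ 2 = 2 * Real.pi * |(n : ℝ)| * s :=
  Real.sq_sqrt (by positivity)

theorem fAlpha_mul_exp_eq_prod {d : ℕ} (s : ℝ) (n : ℤ) (α : Fin d → ℕ) (a b x y : Fin d → ℝ)
    (k : Fin d → ℤ) :
    fAlpha s n α (x + (fun j => (k j : ℝ)) + a + b) * Complex.exp (2 * Real.pi * Complex.I * n *
        ((((fun j => (k j : ℝ)) + a + b) ⬝ᵥ y : ℝ) : ℂ)) =
      ∏ j, hermiteThetaTerm n (frequencyScale s n) (a j + b j) (α j) (k j) (x j, y j) := by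
  simp only [hermiteThetaTerm, Finset.prod_mul_distrib, fAlpha, dotProduct]
  push_cast
  rw [Finset.mul_sum, Complex.exp_sum]
  congr 1
  · refine Finset.prod_congr rfl fun j _ => ?_
    rw [frequencyScale]
    congr 3
    simp only [Pi.add_apply]
    ring
  · refine Finset.prod_congr rfl fun j _ => ?_
    congr 1
    simp only [Pi.add_apply]
    push_cast
    ring

theorem summable_norm_fAlpha_mul_exp {d : ℕ} {s : ℝ} (hs : 0 < s) {n : ℤ} (hn : n ≠ 0)
    (α : Fin d → ℕ) (a b x y : Fin d → ℝ) :
    Summable fun k : Fin d → ℤ => ‖fAlpha s n α (x + (fun j => (k j : ℝ)) + a + b) *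
      Complex.exp (2 * Real.pi * Complex.I * n *
        ((((fun j => (k j : ℝ)) + a + b) ⬝ᵥ y : ℝ) : ℂ))‖ := by
  simp only [fAlpha_mul_exp_eq_prod]
  exact (hasSum_prod_of_summable_norm d
    (fun j m => hermiteThetaTerm n (frequencyScale s n) (a j + b j) (α j) m (x j, y j))
    fun j => summable_norm_hermiteThetaTerm n (frequencyScale_pos hs hn) _ _ _).2

theorem weilBrezin_fAlpha {d : ℕ} {s : ℝ} (hs : 0 < s) {n : ℤ} (hn : n ≠ 0)
    (α : Fin d → ℕ) (a b : Fin d → ℝ) (v : CoordIndex d → ℝ) :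
    weilBrezin n a b (fAlpha s n α) ((coord d).symm v) =
      hermiteThetaProd n (frequencyScale s n) (a + b) α v := by
  rw [weilBrezin, hermiteThetaProd]
  congr 1
  simp only [fAlpha_mul_exp_eq_prod]
  exact (hasSum_prod_of_summable_norm d
    (fun j m => hermiteThetaTerm n (frequencyScale s n) (a j + b j) (α j) m
      (v (.inl j), v (.inr (.inl j))))
    fun j => summable_norm_hermiteThetaTerm n (frequencyScale_pos hs hn) _ _ _).1.tsum_eq

theorem pullback_wM {d : ℕ} {r : Fin d → ℕ} {s : ℝ} (hs : 0 < s) {n : ℤ} (hn : n ≠ 0)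
    (a : setA d n) (b : setB d r n) (α : Fin d → ℕ) :
    pullback (wM s n a b α) = hermiteThetaProd n (frequencyScale s n) (a.1 + b.1) α :=
  funext fun v => weilBrezin_fAlpha hs hn α a.1 b.1 v

theorem wM_proj {d : ℕ} {r : Fin d → ℕ} {s : ℝ} (hs : 0 < s) {n : ℤ} (hn : n ≠ 0)
    (a : setA d n) (b : setB d r n) (α : Fin d → ℕ) (x y : Fin d → ℝ) (t : ℝ) :
    wM s n a b α (proj r ⟨x, y, t⟩) = Complex.exp (2 * Real.pi * Complex.I * n * t) *
      ∏ j, hermiteTheta n (frequencyScale s n) (a.1 j + b.1 j) (α j) (x j, y j) :=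
  weilBrezin_fAlpha hs hn α a.1 b.1 (coord d ⟨x, y, t⟩)

theorem inHn_wM {d : ℕ} {r : Fin d → ℕ} {s : ℝ} (hs : 0 < s) {n : ℤ} (hn : n ≠ 0)
    (a : setA d n) (b : setB d r n) (α : Fin d → ℕ) : InHn n (wM s n a b α) :=
  ⟨_, fun x y t => wM_proj hs hn a b α x y t⟩

theorem smoothM_wM {d : ℕ} {r : Fin d → ℕ} {s : ℝ} (hs : 0 < s) {n : ℤ} (hn : n ≠ 0)
    (a : setA d n) (b : setB d r n) (α : Fin d → ℕ) : SmoothM (wM s n a b α) := by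
  rw [SmoothM, pullback_wM hs hn]
  exact contDiff_hermiteThetaProd n (frequencyScale_pos hs hn) _ _

theorem hasFrequency_wM {d : ℕ} {r : Fin d → ℕ} {s : ℝ} (hs : 0 < s) {n : ℤ} (hn : n ≠ 0)
    (a : setA d n) (b : setB d r n) (α : Fin d → ℕ) :
    HasFrequency r n (pullback (wM s n a b α)) :=
  hasFrequency_pullback (smoothM_wM hs hn a b α) (inHn_wM hs hn a b α)

theorem wM_ne_zero {d : ℕ} {r : Fin d → ℕ} {s : ℝ} (hs : 0 < s) {n : ℤ} (hn : n ≠ 0)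
    (a : setA d n) (b : setB d r n) (α : Fin d → ℕ) : wM s n a b α ≠ 0 := by
  intro h
  obtain ⟨p, hp⟩ := exists_hermiteThetaProd_ne_zero hn (frequencyScale_pos hs hn) (a.1 + b.1) α
  rw [← pullback_wM hs hn, h] at hp
  exact hp rfl

/-- On functions of central frequency `n` the Yamabe operator is a sum of the operators
`X_j² + Y_j²`, up to a constant. -/
theorem HasFrequency.yamabe {d : ℕ} (hd : 1 ≤ d) {r : Fin d → ℕ} {s : ℝ} (hs : 0 < s) {n : ℤ}
    {u : (CoordIndex d → ℝ) → ℂ} (hu : HasFrequency r n u) (p : CoordIndex d → ℝ) :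
    CoordGeom.yamabe (metric d s) u p = -∑ j, oscillator s (2 * Real.pi * n) j u p +
      ((2 * Real.pi * n) ^ 2 * (s ^ (2 * d))⁻¹ - (2 * d - 1) / 16 * s ^ (2 * d + 2) : ℝ) * u p :=
  yamabe_metric hd hs.ne' _ (by exact_mod_cast contDiff_infty.1 hu.contDiff 2) hu.partialDeriv_t p

theorem yamabeEq_wM {d : ℕ} (hd : 1 ≤ d) {r : Fin d → ℕ} {s : ℝ} (hs : 0 < s) {n : ℤ} (hn : n ≠ 0)
    (a : setA d n) (b : setB d r n) (α : Fin d → ℕ) :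
    YamabeEq s (muW d s n (∑ j, α j)) (wM s n a b α) := by
  intro v
  rw [(hasFrequency_wM hs hn a b α).yamabe hd hs, pullback_wM hs hn]
  simp only [oscillator_hermiteThetaProd (frequencyScale_pos hs hn) (frequencyScale_sq hs n)]
  rw [← Finset.sum_mul, ← neg_mul, ← add_mul]
  congr 1
  rw [frequencyScale_sq hs]
  have h : ∑ j, (2 * Real.pi * |(n : ℝ)| * s * (2 * (α j : ℝ) + 1))
      = 2 * Real.pi * |(n : ℝ)| * s * (d + 2 * ((∑ j, α j : ℕ) : ℝ)) := by
    rw [← Finset.mul_sum, Finset.sum_add_distrib, ← Finset.mul_sum]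
    simp [add_comm]
  rw [Finset.sum_neg_distrib, neg_neg, ← Complex.ofReal_sum, h, ← Complex.ofReal_add, muW]
  congr 1
  ring

/-! ### The characters -/

theorem pullback_chiM {d : ℕ} {r : Fin d → ℕ} (q : dualLattice d r) (v : CoordIndex d → ℝ) :
    pullback (chiM q) v = Complex.exp (2 * Real.pi * Complex.I *
      ((q.1.1 ⬝ᵥ (fun j => v (.inl j)) + q.1.2 ⬝ᵥ (fun j => v (.inr (.inl j))) : ℝ) : ℂ)) := rfl

theorem smoothM_chiM {d : ℕ} {r : Fin d → ℕ} (q : dualLattice d r) : SmoothM (chiM q) := by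
  rw [SmoothM, funext (pullback_chiM q)]
  refine (contDiff_const.mul (Complex.ofRealCLM.contDiff.comp ?_)).cexp
  simp only [dotProduct]
  exact ContDiff.add (by fun_prop) (by fun_prop)

theorem inHn_chiM {d : ℕ} {r : Fin d → ℕ} (q : dualLattice d r) : InHn 0 (chiM q) :=
  ⟨fun x y => Complex.exp (2 * Real.pi * Complex.I * ((q.1.1 ⬝ᵥ x + q.1.2 ⬝ᵥ y : ℝ) : ℂ)),
    fun x y t => by
    rw [Int.cast_zero, mul_zero, zero_mul, Complex.exp_zero, one_mul]
    exact pullback_chiM q (coord d ⟨x, y, t⟩)⟩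

theorem hasFrequency_chiM {d : ℕ} {r : Fin d → ℕ} (q : dualLattice d r) :
    HasFrequency r 0 (pullback (chiM q)) :=
  hasFrequency_pullback (smoothM_chiM q) (inHn_chiM q)

theorem chiM_ne_zero {d : ℕ} {r : Fin d → ℕ} (q : dualLattice d r) : chiM q ≠ 0 := by
  intro h
  have := congrArg (fun u => pullback u 0) h
  rw [pullback_chiM] at this
  exact Complex.exp_ne_zero _ this

/-- The `i`-th coordinate of the frequency `(ξ, η, 0)`. -/
def dualCoord {d : ℕ} {r : Fin d → ℕ} (q : dualLattice d r) : CoordIndex d → ℝ :=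
  Sum.elim q.1.1 (Sum.elim q.1.2 0)

theorem pullback_chiM_add_single {d : ℕ} {r : Fin d → ℕ} (q : dualLattice d r) (i : CoordIndex d)
    (p : CoordIndex d → ℝ) (τ : ℝ) : pullback (chiM q) (p + Pi.single i τ) =
      Complex.exp (2 * Real.pi * Complex.I * (dualCoord q i * τ : ℝ)) * pullback (chiM q) p := by
  have h : ∀ p, pullback (chiM q) p
      = Complex.exp (2 * Real.pi * Complex.I * (dualCoord q ⬝ᵥ p : ℝ)) := fun p => by
    rw [pullback_chiM]
    simp [dotProduct, Fintype.sum_sum_type, dualCoord]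
  rw [h, h, ← Complex.exp_add, dotProduct_add, dotProduct_single]
  congr 1
  push_cast
  ring

theorem partialDeriv_chiM {d : ℕ} {r : Fin d → ℕ} (q : dualLattice d r) (i : CoordIndex d) :
    partialDeriv i (pullback (chiM q)) =
      fun p => 2 * Real.pi * Complex.I * dualCoord q i * pullback (chiM q) p := by
  funext p
  refine partialDeriv_eq_of_hasDerivAt ((smoothM_chiM q).differentiable (by simp)) ?_
  have h : (fun τ => pullback (chiM q) (Function.update p i τ)) = fun τ : ℝ =>
      Complex.exp (2 * Real.pi * Complex.I * dualCoord q i * ((τ - p i : ℝ) : ℂ))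
        * pullback (chiM q) p := by
    funext τ
    have e := update_add_eq p i (p i) (τ - p i)
    rw [add_sub_cancel, Function.update_eq_self] at e
    rw [e, pullback_chiM_add_single]
    congr 2
    push_cast
    ring
  rw [h]
  have h1 : HasDerivAt (fun τ : ℝ => 2 * Real.pi * Complex.I * dualCoord q i *
      ((τ - p i : ℝ) : ℂ)) (2 * Real.pi * Complex.I * dualCoord q i) (p i) := by
    simpa using (((hasDerivAt_id (p i)).sub_const (p i)).ofReal_comp).const_mul
      (2 * Real.pi * Complex.I * dualCoord q i : ℂ)
  refine (h1.cexp.mul_const _).congr_deriv ?_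
  simp

theorem yamabeEq_chiM {d : ℕ} (hd : 1 ≤ d) {r : Fin d → ℕ} {s : ℝ} (hs : 0 < s)
    (q : dualLattice d r) : YamabeEq s (lambdaChar s q.1.1 q.1.2) (chiM q) := by
  intro v
  have hdiff : Differentiable ℝ (pullback (chiM q)) := (smoothM_chiM q).differentiable (by simp)
  rw [(hasFrequency_chiM q).yamabe hd hs]
  have h : ∀ j, oscillator s (2 * Real.pi * (0 : ℤ)) j (pullback (chiM q)) v =
      -(4 * Real.pi ^ 2 * (q.1.1 j * q.1.1 j + s ^ 2 * (q.1.2 j * q.1.2 j)) : ℝ)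
        * pullback (chiM q) v := fun j => by
    rw [oscillator]
    simp only [partialDeriv_chiM, partialDeriv_const_mul _ _ (hdiff v)]
    simp [dualCoord]
    linear_combination (4 * Real.pi ^ 2 * (q.1.1 j ^ 2 + s ^ 2 * q.1.2 j ^ 2)
      * pullback (chiM q) v) * Complex.I_sq
  simp only [h]
  rw [← Finset.sum_mul, ← neg_mul, ← add_mul]
  congr 1
  rw [Finset.sum_neg_distrib, neg_neg, ← Complex.ofReal_sum, ← Finset.mul_sum,
    Finset.sum_add_distrib, ← Finset.mul_sum, ← Complex.ofReal_add, lambdaChar]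
  simp only [dotProduct]
  congr 1
  push_cast
  ring

/-! ### Orthogonality -/

/-- For functions of the same central frequency `conj v * u` is periodic in every coordinate. -/
theorem HasFrequency.conj_mul_periodic {d : ℕ} {r : Fin d → ℕ} {n : ℤ}
    {u v : (CoordIndex d → ℝ) → ℂ} (hu : HasFrequency r n u) (hv : HasFrequency r n v)
    (i : CoordIndex d) (p : CoordIndex d → ℝ) :
    starRingEnd ℂ (v (p + Pi.single i (sideLength r i))) * u (p + Pi.single i (sideLength r i)) =
      starRingEnd ℂ (v p) * u p := by
  rcases i with j | j | j
  · rw [show sideLength r (.inl j) = 1 from rfl, hu.x_shift, hv.x_shift, map_mul,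
      mul_mul_mul_comm]
    have e := conj_exp_two_pi_mul (-(n * p (.inr (.inl j))))
    push_cast at e
    rw [mul_neg, ← mul_assoc, neg_neg] at e
    rw [e, ← Complex.exp_add, add_neg_cancel, Complex.exp_zero, one_mul]
  · rw [show sideLength r (.inr (.inl j)) = r j from rfl, hu.y_shift, hv.y_shift]
  · rw [show sideLength r (.inr (.inr j)) = 1 from rfl, hu.t_shift, hv.t_shift]
    simp [exp_two_pi_int n]

theorem pairing_chiM_of_ne {d : ℕ} {r : Fin d → ℕ} {q q' : dualLattice d r} (h : q ≠ q') :
    pairing r (pullback (chiM q)) (pullback (chiM q')) = 0 := by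
  obtain ⟨i, hi⟩ : ∃ i, dualCoord q i ≠ dualCoord q' i := by
    by_contra! hne
    refine h (Subtype.ext (Prod.ext (funext fun j => hne (.inl j))
      (funext fun j => hne (.inr (.inl j)))))
  rw [pairing, fundamentalDomain_eq_pi]
  have hne : dualCoord q' i - dualCoord q i ≠ 0 := sub_ne_zero.2 (Ne.symm hi)
  -- the integrand is a character with frequency `ω = dualCoord q' i - dualCoord q i` in the `i`-th
  -- coordinate, so translation by `1 / (2 ω)` changes its sign
  refine integral_box_eq_zero_of_shift (sideLength_nonneg r) i
    (a := 1 / (2 * (dualCoord q' i - dualCoord q i))) (c := -1) (by norm_num)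
    ((hasFrequency_chiM q').conj_mul_periodic (hasFrequency_chiM q) i) fun p => ?_
  rw [pullback_chiM_add_single, pullback_chiM_add_single, map_mul, conj_exp_two_pi_mul,
    mul_mul_mul_comm, ← Complex.exp_add, ← Complex.exp_pi_mul_I]
  congr 2
  have hne' : (dualCoord q' i : ℂ) - dualCoord q i ≠ 0 := by exact_mod_cast hne
  push_cast
  field_simp
  ring

/-- For `α_j ≠ β_j` the two functions are eigenfunctions of the symmetric operator `X_j² + Y_j²`
with distinct eigenvalues. -/
theorem pairing_hermiteThetaProd_of_ne {d : ℕ} {r : Fin d → ℕ} {n : ℤ} {s ν : ℝ} (hν : 0 < ν)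
    (hνs : ν ^ 2 = 2 * Real.pi * |(n : ℝ)| * s) {c c' : Fin d → ℝ} {α β : Fin d → ℕ} (h : α ≠ β)
    (hα : HasFrequency r n (hermiteThetaProd n ν c α))
    (hβ : HasFrequency r n (hermiteThetaProd n ν c' β)) :
    pairing r (hermiteThetaProd n ν c α) (hermiteThetaProd n ν c' β) = 0 := by
  obtain ⟨j, hj⟩ := Function.ne_iff.1 h
  have e := pairing_oscillator s j hβ hα
  rw [funext (oscillator_hermiteThetaProd hν hνs c α j),
    funext (oscillator_hermiteThetaProd hν hνs c' β j)] at e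
  simp only [pairing, map_mul, map_neg, Complex.conj_ofReal, mul_left_comm (starRingEnd ℂ _),
    mul_assoc (-((ν ^ 2 * (2 * (α j : ℝ) + 1) : ℝ) : ℂ))] at e
  rw [integral_const_mul, integral_const_mul, ← sub_eq_zero, ← sub_mul] at e
  refine (mul_eq_zero.1 e).resolve_left ?_
  rw [← Complex.ofReal_neg, ← Complex.ofReal_neg, ← Complex.ofReal_sub, Complex.ofReal_eq_zero]
  have hjr : (α j : ℝ) - β j ≠ 0 := sub_ne_zero.2 (by exact_mod_cast hj)
  rw [show -(ν ^ 2 * (2 * (β j : ℝ) + 1)) - -(ν ^ 2 * (2 * (α j : ℝ) + 1))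
    = 2 * ν ^ 2 * (α j - β j) by ring]
  exact mul_ne_zero (by positivity) hjr

/-- Translation by `1/n` in `y_j` multiplies `W_n^{a,b} f_α` by `e^{2iπ(a_j + b_j)}`. -/
theorem hermiteThetaProd_add_single {d : ℕ} {n : ℤ} (hn : n ≠ 0) (ν : ℝ) (c : Fin d → ℝ)
    (α : Fin d → ℕ) (j : Fin d) (p : CoordIndex d → ℝ) :
    hermiteThetaProd n ν c α (p + Pi.single (.inr (.inl j)) (1 / n : ℝ)) =
      Complex.exp (2 * Real.pi * Complex.I * c j) * hermiteThetaProd n ν c α p := by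
  have hn' : (n : ℂ) ≠ 0 := by exact_mod_cast hn
  have h := hermiteThetaProd_update n ν c α j (α j)
  rw [Function.update_eq_self] at h
  rw [h (p + _), h p, ← mul_assoc (Complex.exp _)]
  congr 1
  · simp only [hermiteTheta]
    rw [← tsum_mul_left]
    refine tsum_congr fun m => ?_
    rw [hermiteThetaTerm, hermiteThetaTerm, mul_left_comm, ← Complex.exp_add]
    have e : 2 * Real.pi * Complex.I * n * (m + c j) * ((p (.inr (.inl j)) + 1 / n : ℝ) : ℂ)
        = 2 * Real.pi * Complex.I * c j + 2 * Real.pi * Complex.I * n * (m + c j)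
          * p (.inr (.inl j)) + m * (2 * Real.pi * Complex.I) := by
      push_cast
      field_simp
      ring
    simp only [Pi.add_apply, ne_eq, reduceCtorEq, not_false_eq_true, Pi.single_eq_of_ne, add_zero,
      Pi.single_eq_same]
    rw [e, Complex.exp_add _ (m * (2 * Real.pi * Complex.I)), Complex.exp_int_mul_two_pi_mul_I,
      mul_one]
  · congr 1
    · simp
    · refine Finset.prod_congr rfl fun i hi => ?_
      have : i ≠ j := Finset.ne_of_mem_erase hi
      simp [this]

theorem pairing_hermiteThetaProd_of_offset_ne {d : ℕ} {r : Fin d → ℕ} {n : ℤ} (hn : n ≠ 0) {ν : ℝ}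
    {c c' : Fin d → ℝ} {α β : Fin d → ℕ} {j : Fin d} (hcj : c j ≠ c' j)
    (hc : c j ∈ Set.Ico (0 : ℝ) 1) (hc' : c' j ∈ Set.Ico (0 : ℝ) 1)
    (hα : HasFrequency r n (hermiteThetaProd n ν c α))
    (hβ : HasFrequency r n (hermiteThetaProd n ν c' β)) :
    pairing r (hermiteThetaProd n ν c α) (hermiteThetaProd n ν c' β) = 0 := by
  rw [pairing, fundamentalDomain_eq_pi]
  refine integral_box_eq_zero_of_shift (sideLength_nonneg r) (.inr (.inl j)) (a := 1 / n)
    (c := Complex.exp (2 * Real.pi * Complex.I * (c' j - c j : ℝ))) (fun h => ?_)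
    (hβ.conj_mul_periodic hα _) fun p => ?_
  -- the multiplier is not one, as `c'_j - c_j` is a nonzero number in `(-1, 1)`
  · obtain ⟨m, hm⟩ := Complex.exp_eq_one_iff.1 h
    rw [mul_comm] at hm
    have h1 : ((c' j - c j : ℝ) : ℂ) = (m : ℝ) := by
      simpa using mul_right_cancel₀ Complex.two_pi_I_ne_zero hm
    have h2 : c' j - c j = m := Complex.ofReal_injective h1
    have h3 : (m : ℝ) < 1 := by linarith [hc.1, hc'.2]
    have h4 : (-1 : ℝ) < m := by linarith [hc.2, hc'.1]
    have h5 : m = 0 := by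
      have h6 : m < 1 := by exact_mod_cast h3
      have h7 : -1 < m := by exact_mod_cast h4
      omega
    rw [h5, Int.cast_zero, sub_eq_zero] at h2
    exact hcj h2.symm
  · rw [hermiteThetaProd_add_single hn, hermiteThetaProd_add_single hn, map_mul,
      conj_exp_two_pi_mul, mul_mul_mul_comm, ← Complex.exp_add]
    congr 2
    push_cast
    ring

/-! ### The index sets `𝒜_n` and `ℬ_n` -/

/-- The numerator of `a_j + b_j` over `|n| r_j` is `r_j i + i'` with `i < |n|` and `i' < r_j`:
division with remainder by `r_j` recovers `a_j` and `b_j`. -/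
theorem setA_add_setB_eq {d : ℕ} {r : Fin d → ℕ} {n : ℤ} (a : setA d n) (b : setB d r n)
    (j : Fin d) : ∃ i i' : ℕ, i < n.natAbs ∧ i' < r j ∧ a.1 j = (i : ℝ) / n.natAbs ∧
      b.1 j = (i' : ℝ) / (n.natAbs * r j) ∧
      a.1 j + b.1 j = ((r j * i + i' : ℕ) : ℝ) / (n.natAbs * r j) := by
  obtain ⟨i, hi, ha⟩ := a.2 j
  obtain ⟨i', hi', hb⟩ := b.2 j
  refine ⟨i, i', hi, hi', ha, hb, ?_⟩
  have h1 : (n.natAbs : ℝ) ≠ 0 := by have : 0 < n.natAbs := by omega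
                                     positivity
  have h2 : (r j : ℝ) ≠ 0 := by have : 0 < r j := by omega
                                positivity
  rw [ha, hb]
  push_cast
  field_simp

theorem setA_add_setB_mem_Ico {d : ℕ} {r : Fin d → ℕ} {n : ℤ} (a : setA d n) (b : setB d r n)
    (j : Fin d) : a.1 j + b.1 j ∈ Set.Ico (0 : ℝ) 1 := by
  obtain ⟨i, i', hi, hi', -, -, h⟩ := setA_add_setB_eq a b j
  rw [h]
  have h1 : r j * i + i' < n.natAbs * r j := by nlinarith
  have h2 : (0 : ℝ) < n.natAbs * r j := by exact_mod_cast (by omega : 0 < n.natAbs * r j)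
  refine ⟨by positivity, ?_⟩
  rw [div_lt_one h2]
  exact_mod_cast h1

theorem setA_add_setB_injective {d : ℕ} {r : Fin d → ℕ} {n : ℤ} {a a' : setA d n}
    {b b' : setB d r n} (h : a.1 + b.1 = a'.1 + b'.1) : a = a' ∧ b = b' := by
  have key : ∀ j, a.1 j = a'.1 j ∧ b.1 j = b'.1 j := by
    intro j
    obtain ⟨i, i', hi, hi', ha, hb, hab⟩ := setA_add_setB_eq a b j
    obtain ⟨k, k', hk, hk', hka, hkb, hkab⟩ := setA_add_setB_eq a' b' j
    have h1 := congrFun h j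
    simp only [Pi.add_apply] at h1
    have h2 : (n.natAbs : ℝ) * r j ≠ 0 := by
      have h3 : 0 < n.natAbs * r j := Nat.mul_pos (by omega) (by omega)
      exact_mod_cast h3.ne'
    rw [hab, hkab, div_left_inj' h2, Nat.cast_inj] at h1
    have h4 : i = k := by
      have e := congrArg (· / r j) h1
      simpa [Nat.mul_add_div (by omega : 0 < r j), Nat.div_eq_of_lt hi', Nat.div_eq_of_lt hk']
        using e
    have h5 : i' = k' := by
      rw [h4] at h1
      omega
    rw [ha, hb, hka, hkb, h4, h5]
    exact ⟨rfl, rfl⟩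
  exact ⟨Subtype.ext (funext fun j => (key j).1), Subtype.ext (funext fun j => (key j).2)⟩

/-- Every frequency `m_j / r_j` in `y_j` occurs as `n (k_j + a_j + b_j)`. -/
theorem exists_offset {d : ℕ} {r : Fin d → ℕ} (hr : ∀ j, 0 < r j) {n : ℤ} (hn : n ≠ 0)
    (m : Fin d → ℤ) : ∃ (a : setA d n) (b : setB d r n) (k : Fin d → ℤ),
      ∀ j, (n : ℝ) * (k j + (a.1 j + b.1 j)) = m j / r j := by
  have hN : 0 < n.natAbs := Int.natAbs_pos.2 hn
  have h : ∀ j, ∃ (k : ℤ) (i i' : ℕ), i < n.natAbs ∧ i' < r j ∧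
      n.sign * m j = k * (n.natAbs * r j) + (r j * i + i' : ℕ) := by
    intro j
    have hpos : (0 : ℤ) < n.natAbs * r j := by exact_mod_cast Nat.mul_pos hN (hr j)
    -- the remainder `e` modulo `|n| r_j` gives `a_j + b_j`; its division by `r_j` splits the sum
    set e := (n.sign * m j) % (n.natAbs * r j) with he
    have he0 : 0 ≤ e := Int.emod_nonneg _ hpos.ne'
    have he1 : e < n.natAbs * r j := Int.emod_lt_of_pos _ hpos
    refine ⟨(n.sign * m j) / (n.natAbs * r j), e.toNat / r j, e.toNat % r j, ?_,
      Nat.mod_lt _ (hr j), ?_⟩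
    · rw [Nat.div_lt_iff_lt_mul (hr j)]
      zify
      rw [Int.toNat_of_nonneg he0]
      simpa using he1
    · rw [Nat.div_add_mod, Int.toNat_of_nonneg he0, mul_comm (_ / _), he]
      exact (Int.mul_ediv_add_emod _ _).symm
  choose k i i' hi hi' he using h
  refine ⟨⟨fun j => i j / n.natAbs, fun j => ⟨i j, hi j, rfl⟩⟩,
    ⟨fun j => i' j / (n.natAbs * r j), fun j => ⟨i' j, hi' j, rfl⟩⟩, k, fun j => ?_⟩
  have h1 : (n.natAbs : ℝ) ≠ 0 := by positivity
  have h2 : (r j : ℝ) ≠ 0 := by have := hr j; positivity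
  have h3 := congrArg (fun z : ℤ => (z : ℝ)) (he j)
  have h4 : (n : ℝ) = n.sign * n.natAbs := by
    have h := congrArg (fun z : ℤ => (z : ℝ)) (Int.sign_mul_natAbs n).symm
    push_cast at h
    simpa using h
  have h5 : (n.sign : ℝ) * n.sign = 1 := by
    rcases lt_or_gt_of_ne hn with h | h
    · simp [Int.sign_eq_neg_one_of_neg h]
    · simp [Int.sign_eq_one_of_pos h]
  push_cast at h3
  rw [← Int.cast_abs, Int.abs_eq_natAbs, Int.cast_natCast] at h3
  rw [h4]
  field_simp
  linear_combination -(n.sign : ℝ) * h3 + m j * h5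

theorem pairing_eigenFamily_of_ne {d : ℕ} {r : Fin d → ℕ} {s : ℝ} (hs : 0 < s)
    {i j : EigenIndex d r} (h : i ≠ j) :
    pairing r (pullback (eigenFamily s i)) (pullback (eigenFamily s j)) = 0 := by
  rcases i with q | ⟨⟨n, hn⟩, a, b, α⟩ <;> rcases j with q' | ⟨⟨n', hn'⟩, a', b', β⟩
  · exact pairing_chiM_of_ne fun hq => h (by rw [hq])
  · exact pairing_eq_zero_of_frequency_ne hn' (hasFrequency_wM hs hn' a' b' β) (hasFrequency_chiM q)
  · exact pairing_eq_zero_of_frequency_ne (Ne.symm hn) (hasFrequency_chiM q')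
      (hasFrequency_wM hs hn a b α)
  · have hu := hasFrequency_wM hs hn a b α
    have hv := hasFrequency_wM hs hn' a' b' β
    by_cases hnn : n = n'
    · subst hnn
      change pairing r (pullback (wM s n a b α)) (pullback (wM s n a' b' β)) = 0
      rw [pullback_wM hs hn] at hu ⊢
      rw [pullback_wM hs hn] at hv ⊢
      by_cases hαβ : α = β
      · subst hαβ
        obtain ⟨j, hj⟩ : ∃ j, (a.1 + b.1) j ≠ (a'.1 + b'.1) j := by
          by_contra! hne
          obtain ⟨rfl, rfl⟩ := setA_add_setB_injective (funext hne)
          exact h rfl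
        exact pairing_hermiteThetaProd_of_offset_ne hn hj (setA_add_setB_mem_Ico a b j)
          (setA_add_setB_mem_Ico a' b' j) hu hv
      · exact pairing_hermiteThetaProd_of_ne (frequencyScale_pos hs hn) (frequencyScale_sq hs n)
          hαβ hu hv
    · exact pairing_eq_zero_of_frequency_ne (Ne.symm hnn) hv hu

theorem smoothM_eigenFamily {d : ℕ} {r : Fin d → ℕ} {s : ℝ} (hs : 0 < s) (i : EigenIndex d r) :
    SmoothM (eigenFamily s i) := by
  rcases i with q | ⟨⟨n, hn⟩, a, b, α⟩
  · exact smoothM_chiM q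
  · exact smoothM_wM hs hn a b α

theorem eigenFamily_ne_zero {d : ℕ} {r : Fin d → ℕ} {s : ℝ} (hs : 0 < s) (i : EigenIndex d r) :
    eigenFamily s i ≠ 0 := by
  rcases i with q | ⟨⟨n, hn⟩, a, b, α⟩
  · exact chiM_ne_zero q
  · exact wM_ne_zero hs hn a b α

theorem pairing_self_ne_zero {d : ℕ} {r : Fin d → ℕ} (hr : ∀ j, 0 < r j) {u : Nilmanifold d r → ℂ}
    (hu : Continuous (pullback u)) (h : u ≠ 0) : pairing r (pullback u) (pullback u) ≠ 0 := by
  intro h0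
  refine h (eq_zero_of_pullback_ae_eq_zero hr hu ?_)
  have e : pairing r (pullback u) (pullback u)
      = ((∫ p in fundamentalDomain d r, ‖pullback u p‖ ^ 2 : ℝ) : ℂ) := by
    rw [pairing, ← integral_complex_ofReal]
    refine integral_congr_ae (Filter.Eventually.of_forall fun p => ?_)
    simp only
    rw [mul_comm, Complex.mul_conj, Complex.normSq_eq_norm_sq]
  rw [e, Complex.ofReal_eq_zero] at h0
  have hi : IntegrableOn (fun p => ‖pullback u p‖ ^ 2) (fundamentalDomain d r) := by
    have := integrableOn_fundamentalDomain r (w := fun p => ((‖pullback u p‖ ^ 2 : ℝ) : ℂ))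
      (Complex.continuous_ofReal.comp (hu.norm.pow 2))
    exact this.re
  rw [integral_eq_zero_iff_of_nonneg (fun p => by positivity) hi] at h0
  filter_upwards [h0] with p hp
  simpa using hp

end Heisenberg

/-! ### Uniqueness of Fourier transforms of complex densities -/

namespace CoordGeom

/-- The integral against the pushforward of the positive part of a real density. -/
theorem integral_map_withDensity_ofReal {Ω V : Type*} [MeasurableSpace Ω] [MeasurableSpace V]
    {μ : Measure Ω} {Ξ : Ω → V} (hΞ : Measurable Ξ) {G : Ω → ℝ} (hG : Integrable G μ) {f : V → ℂ}
    (hf : Measurable f) :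
    ∫ v, f v ∂((μ.withDensity fun q => ENNReal.ofReal (G q)).map Ξ)
      = ∫ q, f (Ξ q) * (max (G q) 0 : ℝ) ∂μ := by
  rw [integral_map hΞ.aemeasurable hf.aestronglyMeasurable,
    integral_withDensity_eq_integral_toReal_smul₀ hG.aemeasurable.ennreal_ofReal
      (Filter.Eventually.of_forall fun _ => ENNReal.ofReal_lt_top)]
  refine integral_congr_ae (Filter.Eventually.of_forall fun q => ?_)
  simp only [ENNReal.toReal_ofReal', Complex.real_smul]
  rw [mul_comm]

/-- For a real density `G`, the pushforwards of its positive and negative parts are finite measures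
with the same integrals against all `χ w`, so they agree. -/
theorem integral_comp_mul_ofReal_eq_zero {Ω V W : Type*} [MeasurableSpace Ω] [MeasurableSpace V]
    {μ : Measure Ω} {Ξ : Ω → V} (hΞ : Measurable Ξ) {G : Ω → ℝ} (hG : Integrable G μ)
    {χ : W → V → ℂ} (hχ : ∀ w, Measurable (χ w)) (hb : ∀ w v, ‖χ w v‖ ≤ 1)
    (hext : ∀ (P P' : Measure V) [IsFiniteMeasure P] [IsFiniteMeasure P'],
      (∀ w, ∫ v, χ w v ∂P = ∫ v, χ w v ∂P') → P = P')
    (h : ∀ w, ∫ q, χ w (Ξ q) * (G q : ℂ) ∂μ = 0) {g : V → ℂ} (hg : Measurable g)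
    (hgG : Integrable (fun q => g (Ξ q) * (G q : ℂ)) μ) :
    ∫ q, g (Ξ q) * (G q : ℂ) ∂μ = 0 := by
  have h1 : IsFiniteMeasure (μ.withDensity fun q => ENNReal.ofReal (G q)) :=
    isFiniteMeasure_withDensity_ofReal hG.2
  have h2 : IsFiniteMeasure (μ.withDensity fun q => ENNReal.ofReal (-G q)) :=
    isFiniteMeasure_withDensity_ofReal hG.neg.2
  have key : ∀ f : V → ℂ, Measurable f → Integrable (fun q => f (Ξ q) * (G q : ℂ)) μ →
      ∫ q, f (Ξ q) * (G q : ℂ) ∂μ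
        = ∫ v, f v ∂((μ.withDensity fun q => ENNReal.ofReal (G q)).map Ξ)
          - ∫ v, f v ∂((μ.withDensity fun q => ENNReal.ofReal (-G q)).map Ξ) := by
    intro f hf hi
    have hfΞ : AEStronglyMeasurable (fun q => f (Ξ q)) μ := (hf.comp hΞ).aestronglyMeasurable
    have hm : ∀ {K : Ω → ℝ}, Integrable K μ → (∀ q, |K q| = |G q|) →
        Integrable (fun q => f (Ξ q) * ((max (K q) 0 : ℝ) : ℂ)) μ := by
      intro K hK hKG
      refine hi.mono (hfΞ.mul
        (Complex.continuous_ofReal.comp_aestronglyMeasurable hK.pos_part.1))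
        (Filter.Eventually.of_forall fun q => ?_)
      rw [norm_mul, norm_mul, Complex.norm_real, Complex.norm_real, Real.norm_eq_abs,
        Real.norm_eq_abs, ← hKG]
      refine mul_le_mul_of_nonneg_left ?_ (norm_nonneg _)
      rw [abs_of_nonneg (le_max_right _ _)]
      exact max_le (le_abs_self _) (abs_nonneg _)
    rw [integral_map_withDensity_ofReal hΞ hG hf,
      integral_map_withDensity_ofReal hΞ (G := fun q => -G q) hG.neg hf,
      ← integral_sub (hm hG fun _ => rfl) (hm (K := fun q => -G q) hG.neg fun q => abs_neg _)]
    refine integral_congr_ae (Filter.Eventually.of_forall fun q => ?_)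
    simp only
    rw [← mul_sub, ← Complex.ofReal_sub]
    rw [max_zero_sub_max_neg_zero_eq_self]
  have hPP := hext _ _ fun w => sub_eq_zero.1 (((key (χ w) (hχ w)
    (hG.ofReal.bdd_mul ((hχ w).comp hΞ).aestronglyMeasurable
      (Filter.Eventually.of_forall fun q => hb w (Ξ q)))).symm).trans (h w))
  rw [key g hg hgG, hPP, sub_self]

/-- If the pushforward of the complex density `G` under `Ξ` is annihilated by a family of functions
that separates finite measures and is closed under conjugation, then it vanishes. -/
theorem integral_comp_mul_eq_zero {Ω V W : Type*} [MeasurableSpace Ω] [MeasurableSpace V]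
    {μ : Measure Ω} {Ξ : Ω → V} (hΞ : Measurable Ξ) {G : Ω → ℂ} (hG : Integrable G μ)
    {χ : W → V → ℂ} (hχ : ∀ w, Measurable (χ w)) (hb : ∀ w v, ‖χ w v‖ ≤ 1)
    (hconj : ∀ w, ∃ w', ∀ v, χ w' v = starRingEnd ℂ (χ w v))
    (hext : ∀ (P P' : Measure V) [IsFiniteMeasure P] [IsFiniteMeasure P'],
      (∀ w, ∫ v, χ w v ∂P = ∫ v, χ w v ∂P') → P = P')
    (h : ∀ w, ∫ q, χ w (Ξ q) * G q ∂μ = 0) {g : V → ℂ} (hg : Measurable g)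
    (hgG : Integrable (fun q => g (Ξ q) * G q) μ) :
    ∫ q, g (Ξ q) * G q ∂μ = 0 := by
  have hi : ∀ w, Integrable (fun q => χ w (Ξ q) * G q) μ := fun w =>
    hG.bdd_mul ((hχ w).comp hΞ).aestronglyMeasurable
      (Filter.Eventually.of_forall fun q => hb w (Ξ q))
  have hc : ∀ w, ∫ q, χ w (Ξ q) * starRingEnd ℂ (G q) ∂μ = 0 := by
    intro w
    obtain ⟨w', hw'⟩ := hconj w
    have e := congrArg (starRingEnd ℂ) (h w')
    rw [← integral_conj] at e
    simpa [hw'] using e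
  have hiG : Integrable (fun q => starRingEnd ℂ (G q)) μ :=
    (LinearIsometryEquiv.integrable_comp_iff Complex.conjLIE).2 hG
  have hic : ∀ w, Integrable (fun q => χ w (Ξ q) * starRingEnd ℂ (G q)) μ := fun w =>
    hiG.bdd_mul ((hχ w).comp hΞ).aestronglyMeasurable
      (Filter.Eventually.of_forall fun q => hb w (Ξ q))
  have hre : ∀ w, ∫ q, χ w (Ξ q) * ((G q).re : ℂ) ∂μ = 0 := by
    intro w
    have e : ∀ q, χ w (Ξ q) * ((G q).re : ℂ)
        = (1 / 2 : ℂ) * (χ w (Ξ q) * G q + χ w (Ξ q) * starRingEnd ℂ (G q)) := fun q => by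
      rw [Complex.re_eq_add_conj]; ring
    simp only [e]
    rw [integral_const_mul, integral_add (hi w) (hic w), h, hc]
    simp
  have him : ∀ w, ∫ q, χ w (Ξ q) * ((G q).im : ℂ) ∂μ = 0 := by
    intro w
    have e : ∀ q, χ w (Ξ q) * ((G q).im : ℂ)
        = (1 / (2 * Complex.I) : ℂ) * (χ w (Ξ q) * G q - χ w (Ξ q) * starRingEnd ℂ (G q)) :=
      fun q => by rw [Complex.im_eq_sub_conj]; ring
    simp only [e]
    rw [integral_const_mul, integral_sub (hi w) (hic w), h, hc]
    simp
  have hgΞ : AEStronglyMeasurable (fun q => g (Ξ q)) μ := (hg.comp hΞ).aestronglyMeasurable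
  have h1 : Integrable (fun q => g (Ξ q) * ((G q).re : ℂ)) μ := by
    refine hgG.mono (hgΞ.mul (Complex.continuous_ofReal.comp_aestronglyMeasurable hG.re.1))
      (Filter.Eventually.of_forall fun q => ?_)
    rw [norm_mul, norm_mul, Complex.norm_real, Real.norm_eq_abs]
    exact mul_le_mul_of_nonneg_left (Complex.abs_re_le_norm _) (norm_nonneg _)
  have h2 : Integrable (fun q => g (Ξ q) * ((G q).im : ℂ)) μ := by
    refine hgG.mono (hgΞ.mul (Complex.continuous_ofReal.comp_aestronglyMeasurable hG.im.1))
      (Filter.Eventually.of_forall fun q => ?_)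
    rw [norm_mul, norm_mul, Complex.norm_real, Real.norm_eq_abs]
    exact mul_le_mul_of_nonneg_left (Complex.abs_im_le_norm _) (norm_nonneg _)
  have e : ∀ q, g (Ξ q) * G q
      = g (Ξ q) * ((G q).re : ℂ) + g (Ξ q) * ((G q).im : ℂ) * Complex.I := fun q => by
    rw [mul_assoc, ← mul_add, Complex.re_add_im]
  simp only [e]
  rw [integral_add h1 (h2.mul_const _), integral_mul_const,
    integral_comp_mul_ofReal_eq_zero (G := fun q => (G q).re) hΞ hG.re hχ hb hext hre hg h1,
    integral_comp_mul_ofReal_eq_zero (G := fun q => (G q).im) hΞ hG.im hχ hb hext him hg h2]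
  simp

/-- A finite measure on `ℝ^ι` is determined by its characteristic function. -/
theorem ext_of_integral_exp_dotProduct {ι : Type*} [Fintype ι] (P P' : Measure (ι → ℝ))
    [IsFiniteMeasure P] [IsFiniteMeasure P']
    (h : ∀ ζ : ι → ℝ, ∫ ξ, Complex.exp ((ζ ⬝ᵥ ξ : ℝ) * Complex.I) ∂P
      = ∫ ξ, Complex.exp ((ζ ⬝ᵥ ξ : ℝ) * Complex.I) ∂P') : P = P' := by
  classical
  have hL : Continuous fun p : (ι → ℝ) × (ι → ℝ) => dotProductBilin ℝ ℝ p.1 p.2 := by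
    simp only [dotProductBilin, dotProduct, LinearMap.coe_mk, AddHom.coe_mk]
    fun_prop
  refine ext_of_integral_char_eq (W := ι → ℝ) Real.continuous_probChar Real.probChar_ne_one
    (fun v hv h0 => hv (dotProduct_eq_zero _ fun w => congrArg (· w) h0)) hL fun ζ => ?_
  have e : ∀ ξ, BoundedContinuousFunction.char Real.continuous_probChar hL ζ ξ
      = Complex.exp ((ζ ⬝ᵥ ξ : ℝ) * Complex.I) := fun ξ => by
    rw [BoundedContinuousFunction.char_apply, Real.probChar_apply, dotProduct_comm]
    rfl
  simpa only [e] using h ζ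

/-- A finite measure on a torus is determined by its Fourier coefficients. -/
theorem ext_of_integral_mFourier {ι : Type*} [Fintype ι] (P P' : Measure (UnitAddTorus ι))
    [IsFiniteMeasure P] [IsFiniteMeasure P']
    (h : ∀ n : ι → ℤ, ∫ z, UnitAddTorus.mFourier n z ∂P = ∫ z, UnitAddTorus.mFourier n z ∂P') :
    P = P' := by
  have hi : ∀ (P : Measure (UnitAddTorus ι)) [IsFiniteMeasure P] (f : C(UnitAddTorus ι, ℂ)),
      Integrable f P := fun P _ f => by
    exact (BoundedContinuousFunction.mkOfCompact f).integrable P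
  have hcont : ∀ (P : Measure (UnitAddTorus ι)) [IsFiniteMeasure P],
      Continuous fun f : C(UnitAddTorus ι, ℂ) => ∫ z, f z ∂P := by
    intro P _
    refine (continuous_integral.comp (ContinuousMap.toLp (E := ℂ) 1 P ℂ).continuous).congr
      fun f => integral_congr_ae (ContinuousMap.coeFn_toLp P f)
  have hall : ∀ f : C(UnitAddTorus ι, ℂ), ∫ z, f z ∂P = ∫ z, f z ∂P' := by
    intro f
    have hf : f ∈ (Submodule.span ℂ
        (Set.range (UnitAddTorus.mFourier (d := ι)))).topologicalClosure := by
      rw [UnitAddTorus.span_mFourier_closure_eq_top]; trivial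
    refine closure_minimal (s := (Submodule.span ℂ
        (Set.range (UnitAddTorus.mFourier (d := ι))) : Set C(UnitAddTorus ι, ℂ)))
      (t := {f : C(UnitAddTorus ι, ℂ) | ∫ z, f z ∂P = ∫ z, f z ∂P'}) (fun g hg => ?_)
      (isClosed_eq (hcont P) (hcont P')) hf
    induction hg using Submodule.span_induction with
    | mem g hg => obtain ⟨n, rfl⟩ := hg; exact h n
    | zero => simp
    | add g g' _ _ hg hg' =>
      simp only [Set.mem_ofPred_eq, ContinuousMap.add_apply] at hg hg' ⊢
      rw [integral_add (hi P g) (hi P g'), integral_add (hi P' g) (hi P' g'), hg, hg']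
    | smul c g _ hg =>
      simp only [Set.mem_ofPred_eq, ContinuousMap.smul_apply] at hg ⊢
      rw [integral_smul, integral_smul, hg]
  refine ext_of_forall_integral_eq_of_IsFiniteMeasure fun f => ?_
  have e := hall ⟨fun z => (f z : ℂ), by fun_prop⟩
  simp only [ContinuousMap.coe_mk] at e
  rw [integral_complex_ofReal, integral_complex_ofReal] at e
  exact_mod_cast e

/-- A function on a box all of whose Fourier coefficients vanish is zero almost everywhere. -/
theorem ae_eq_zero_of_fourier_coeff_eq_zero {ι : Type*} [Fintype ι] {L : ι → ℝ}
    (hL : ∀ i, 0 < L i) {F : (ι → ℝ) → ℂ}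
    (hF : IntegrableOn F (Set.univ.pi fun i => Set.Ico 0 (L i)))
    (h : ∀ m : ι → ℤ, ∫ p in Set.univ.pi fun i => Set.Ico 0 (L i),
      Complex.exp (2 * Real.pi * Complex.I * ∑ i, m i * (p i / L i)) * F p = 0) :
    ∀ᵐ p ∂volume.restrict (Set.univ.pi fun i => Set.Ico 0 (L i)), F p = 0 := by
  set μ : Measure (ι → ℝ) := volume.restrict (Set.univ.pi fun i => Set.Ico 0 (L i)) with hμ
  let Ξ : (ι → ℝ) → UnitAddTorus ι := fun p i => ((p i / L i : ℝ) : UnitAddCircle)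
  have hΞ : Measurable Ξ := measurable_pi_lambda _ fun i =>
    AddCircle.measurable_mk'.comp ((measurable_pi_apply i).div_const _)
  -- `σ` inverts `Ξ` on the box, so a subset of the box is the preimage of a subset of the torus
  let σ : UnitAddTorus ι → ι → ℝ := fun z i => L i * (AddCircle.equivIco 1 0 (z i) : ℝ)
  have hσ : Measurable σ := measurable_pi_lambda _ fun i =>
    ((measurable_subtype_coe.comp
      (AddCircle.measurableEquivIco (1 : ℝ) 0).measurable).comp (measurable_pi_apply i)).const_mul _
  have hσΞ : ∀ p ∈ Set.univ.pi fun i => Set.Ico 0 (L i), σ (Ξ p) = p := by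
    intro p hp
    funext i
    have hi := hp i trivial
    have h1 : p i / L i ∈ Set.Ico (0 : ℝ) (0 + 1) :=
      ⟨div_nonneg hi.1 (hL i).le, by rw [zero_add, div_lt_one (hL i)]; exact hi.2⟩
    simp only [σ, Ξ]
    rw [AddCircle.equivIco_coe_eq h1]
    field_simp [(hL i).ne']
  have hmeas : MeasurableSet (Set.univ.pi fun i => Set.Ico 0 (L i)) :=
    MeasurableSet.univ_pi fun i => measurableSet_Ico
  refine hF.ae_eq_zero_of_forall_setIntegral_eq_zero fun A hA _ => ?_
  have key := integral_comp_mul_eq_zero (μ := μ) hΞ hF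
    (χ := fun (m : ι → ℤ) z => UnitAddTorus.mFourier m z)
    (fun m => (UnitAddTorus.mFourier m).continuous.measurable)
    (fun m z => ((UnitAddTorus.mFourier m).norm_coe_le_norm z).trans
      UnitAddTorus.mFourier_norm.le)
    (fun m => ⟨-m, fun z => UnitAddTorus.mFourier_neg⟩)
    (fun P P' _ _ hP => ext_of_integral_mFourier P P' hP) (fun m => ?_)
    (g := (σ ⁻¹' A).indicator 1) (measurable_one.indicator (hσ hA)) ?_
  · rw [← integral_indicator hA, ← key]
    refine integral_congr_ae ?_
    filter_upwards [ae_restrict_mem hmeas] with p hp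
    have e : Ξ p ∈ σ ⁻¹' A ↔ p ∈ A := by rw [Set.mem_preimage, hσΞ p hp]
    by_cases hA' : p ∈ A
    · simp [hA', e.2 hA']
    · simp [hA', mt e.1 hA']
  · rw [← h m]
    congr 1
    funext p
    congr 1
    simp only [UnitAddTorus.mFourier, ContinuousMap.coe_mk, Ξ, fourier_coe_apply]
    rw [← Complex.exp_sum, Complex.ofReal_sum, Finset.mul_sum]
    congr 1
    refine Finset.sum_congr rfl fun i _ => ?_
    push_cast
    ring
  · refine hF.bdd_mul (c := 1) ((measurable_one.indicator (hσ hA)).comp hΞ).aestronglyMeasurable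
      (Filter.Eventually.of_forall fun p => ?_)
    simp only [Set.indicator]
    split_ifs <;> simp

end CoordGeom

namespace Heisenberg

open CoordGeom

/-! ### Completeness of the Hermite functions -/

theorem exists_abs_prod_hermiteFun_le {d : ℕ} {ν : ℝ} (hν : 0 < ν) (α : Fin d → ℕ) (A : ℝ) :
    ∃ C, 0 ≤ C ∧ ∀ ξ : Fin d → ℝ,
      |∏ j, hermiteFun (α j) (ν * ξ j)| ≤ C * Real.exp (-A * ∑ j, |ξ j|) := by
  choose C hC h using fun j => exists_abs_hermiteFun_le (α j) (A / ν)
  refine ⟨∏ j, C j, Finset.prod_nonneg fun j _ => hC j, fun ξ => ?_⟩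
  rw [Finset.abs_prod, Finset.mul_sum, Real.exp_sum, ← Finset.prod_mul_distrib]
  refine Finset.prod_le_prod (fun j _ => abs_nonneg _) fun j _ => (h j _).trans_eq ?_
  rw [abs_mul, abs_of_pos hν]
  congr 2
  field_simp

theorem abs_dotProduct_le {d : ℕ} (ζ ξ : Fin d → ℝ) :
    |ζ ⬝ᵥ ξ| ≤ (∑ j, |ζ j|) * ∑ j, |ξ j| := by
  rw [dotProduct, Finset.sum_mul]
  refine (Finset.abs_sum_le_sum_abs _ _).trans (Finset.sum_le_sum fun j _ => ?_)
  rw [abs_mul]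
  exact mul_le_mul_of_nonneg_left
    (Finset.single_le_sum (f := fun j => |ξ j|) (fun i _ => abs_nonneg _) (Finset.mem_univ j))
    (abs_nonneg _)

theorem exists_dotProduct_pow_mul_le {d : ℕ} {ν : ℝ} (hν : 0 < ν) (α : Fin d → ℕ) (ζ : Fin d → ℝ)
    (m : ℕ) : ∃ C, 0 ≤ C ∧ ∀ ξ : Fin d → ℝ,
      |(ζ ⬝ᵥ ξ) ^ m * ∏ j, hermiteFun (α j) (ν * ξ j)| ≤ C * Real.exp (-∑ j, |ξ j|) := by
  obtain ⟨C, hC, h⟩ := exists_abs_prod_hermiteFun_le hν α (∑ j, |ζ j| + 1)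
  refine ⟨m.factorial * C, by positivity, fun ξ => ?_⟩
  have h1 : |ζ ⬝ᵥ ξ| ^ m ≤ m.factorial * Real.exp ((∑ j, |ζ j|) * ∑ j, |ξ j|) := by
    have h2 := Real.pow_div_factorial_le_exp _ (abs_nonneg (ζ ⬝ᵥ ξ)) m
    rw [div_le_iff₀' (by positivity)] at h2
    exact h2.trans (mul_le_mul_of_nonneg_left (Real.exp_le_exp.2 (abs_dotProduct_le ζ ξ))
      (by positivity))
  rw [abs_mul, abs_pow]
  refine (mul_le_mul h1 (h ξ) (abs_nonneg _) (by positivity)).trans_eq ?_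
  rw [mul_mul_mul_comm, mul_assoc, ← Real.exp_add, mul_assoc]
  congr 3
  ring

/-- Multiplication by a linear form maps the span of the Hermite functions to itself. -/
theorem dotProduct_mul_prod_hermiteFun {d : ℕ} {ν : ℝ} (hν : 0 < ν) (α : Fin d → ℕ)
    (ζ ξ : Fin d → ℝ) : (ζ ⬝ᵥ ξ) * ∏ j, hermiteFun (α j) (ν * ξ j) =
      ∑ j, (ζ j / ν * α j * ∏ i, hermiteFun (Function.update α j (α j - 1) i) (ν * ξ i)
        + ζ j / ν / 2 * ∏ i, hermiteFun (Function.update α j (α j + 1) i) (ν * ξ i)) := by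
  rw [dotProduct, Finset.sum_mul]
  refine Finset.sum_congr rfl fun j _ => ?_
  have e : ∀ k, ∏ i, hermiteFun (Function.update α j k i) (ν * ξ i)
      = hermiteFun k (ν * ξ j) * ∏ i ∈ Finset.univ.erase j, hermiteFun (α i) (ν * ξ i) := by
    intro k
    rw [← Finset.mul_prod_erase _ _ (Finset.mem_univ j), Function.update_self]
    congr 1
    exact Finset.prod_congr rfl fun i hi => by
      rw [Function.update_of_ne (Finset.ne_of_mem_erase hi)]
  have e0 := e (α j)
  rw [Function.update_eq_self] at e0
  rw [e0, e, e]
  have h := mul_hermiteFun (α j) (ν * ξ j)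
  have hζ : ζ j = ζ j / ν * ν := (div_mul_cancel₀ _ hν.ne').symm
  linear_combination (ξ j * (hermiteFun (α j) (ν * ξ j) *
    ∏ i ∈ Finset.univ.erase j, hermiteFun (α i) (ν * ξ i))) * hζ +
    ζ j / ν * (∏ i ∈ Finset.univ.erase j, hermiteFun (α i) (ν * ξ i)) * h

section

variable {Ω : Type*} [MeasurableSpace Ω] {μ : Measure Ω} {d : ℕ} {Ξ : Ω → Fin d → ℝ} {H : Ω → ℂ}

theorem integrable_comp_mul_of_le (hΞ : Measurable Ξ)
    (hH : Integrable (fun q => (Real.exp (-∑ j, |Ξ q j|) : ℂ) * H q) μ) {w : (Fin d → ℝ) → ℝ}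
    (hw : Continuous w) {C : ℝ} (h : ∀ ξ, |w ξ| ≤ C * Real.exp (-∑ j, |ξ j|)) :
    Integrable (fun q => (w (Ξ q) : ℂ) * H q) μ := by
  have hc : Continuous fun ξ : Fin d → ℝ => w ξ * Real.exp (∑ j, |ξ j|) := by fun_prop
  have e : ∀ q, (w (Ξ q) : ℂ) * H q = ((w (Ξ q) * Real.exp (∑ j, |Ξ q j|) : ℝ) : ℂ)
      * ((Real.exp (-∑ j, |Ξ q j|) : ℂ) * H q) := fun q => by
    rw [← mul_assoc, ← Complex.ofReal_mul, mul_assoc, ← Real.exp_add, add_neg_cancel,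
      Real.exp_zero, mul_one]
  simp only [e]
  refine hH.bdd_mul (c := C)
    (Complex.measurable_ofReal.comp (hc.measurable.comp hΞ)).aestronglyMeasurable
    (Filter.Eventually.of_forall fun q => ?_)
  rw [Complex.norm_real, Real.norm_eq_abs, abs_mul, abs_of_pos (Real.exp_pos _)]
  refine (mul_le_mul_of_nonneg_right (h _) (Real.exp_pos _).le).trans_eq ?_
  rw [mul_assoc, ← Real.exp_add, neg_add_cancel, Real.exp_zero, mul_one]

theorem continuous_prod_hermiteFun (ν : ℝ) (α : Fin d → ℕ) :
    Continuous fun ξ : Fin d → ℝ => ∏ j, hermiteFun (α j) (ν * ξ j) :=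
  continuous_finsetProd _ fun j _ => (continuous_hermiteFun _).comp (by fun_prop)

/-- Orthogonality to all products of Hermite functions passes to their products with powers of a
linear form, by induction on the power. -/
theorem integral_dotProduct_pow_mul_eq_zero {ν : ℝ} (hν : 0 < ν) (hΞ : Measurable Ξ)
    (hH : Integrable (fun q => (Real.exp (-∑ j, |Ξ q j|) : ℂ) * H q) μ)
    (h : ∀ α : Fin d → ℕ,
      ∫ q, ((∏ j, hermiteFun (α j) (ν * Ξ q j) : ℝ) : ℂ) * H q ∂μ = 0)
    (ζ : Fin d → ℝ) (m : ℕ) (α : Fin d → ℕ) :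
    ∫ q, (((ζ ⬝ᵥ Ξ q) ^ m * ∏ j, hermiteFun (α j) (ν * Ξ q j) : ℝ) : ℂ) * H q ∂μ = 0 := by
  have hi : ∀ m (α : Fin d → ℕ), Integrable (fun q =>
      (((ζ ⬝ᵥ Ξ q) ^ m * ∏ j, hermiteFun (α j) (ν * Ξ q j) : ℝ) : ℂ) * H q) μ := by
    intro m α
    obtain ⟨C, -, hC⟩ := exists_dotProduct_pow_mul_le hν α ζ m
    refine integrable_comp_mul_of_le
      (w := fun ξ => (ζ ⬝ᵥ ξ) ^ m * ∏ j, hermiteFun (α j) (ν * ξ j)) hΞ hH ?_ hC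
    exact ((by simp only [dotProduct]; fun_prop : Continuous fun ξ => ζ ⬝ᵥ ξ).pow m).mul
      (continuous_prod_hermiteFun ν α)
  induction m generalizing α with
  | zero => simpa using h α
  | succ m ih =>
    have e : ∀ q, (((ζ ⬝ᵥ Ξ q) ^ (m + 1) * ∏ j, hermiteFun (α j) (ν * Ξ q j) : ℝ) : ℂ) * H q
        = ∑ j, (((ζ j / ν * α j : ℝ) : ℂ) * ((((ζ ⬝ᵥ Ξ q) ^ m *
            ∏ i, hermiteFun (Function.update α j (α j - 1) i) (ν * Ξ q i) : ℝ) : ℂ) * H q)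
          + ((ζ j / ν / 2 : ℝ) : ℂ) * ((((ζ ⬝ᵥ Ξ q) ^ m *
            ∏ i, hermiteFun (Function.update α j (α j + 1) i) (ν * Ξ q i) : ℝ) : ℂ) * H q)) := by
      intro q
      rw [pow_succ, mul_assoc, dotProduct_mul_prod_hermiteFun hν, Finset.mul_sum,
        Complex.ofReal_sum, Finset.sum_mul]
      refine Finset.sum_congr rfl fun j _ => ?_
      push_cast
      ring
    simp only [e]
    rw [integral_finsetSum _ fun j _ => Integrable.fun_add ((hi _ _).const_mul _)
      ((hi _ _).const_mul _)]
    refine Finset.sum_eq_zero fun j _ => ?_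
    rw [integral_add ((hi _ _).const_mul _) ((hi _ _).const_mul _), integral_const_mul,
      integral_const_mul, ih, ih]
    simp

/-- A complex density that is orthogonal to all products of Hermite functions is zero. The
exponential series converges in the mean against the Gaussian, so orthogonality to polynomials
times the Gaussian gives orthogonality to all characters times the Gaussian. -/
theorem integral_comp_mul_gaussian_eq_zero {ν : ℝ} (hν : 0 < ν) (hΞ : Measurable Ξ)
    (hH : Integrable (fun q => (Real.exp (-∑ j, |Ξ q j|) : ℂ) * H q) μ)
    (h : ∀ α : Fin d → ℕ,
      ∫ q, ((∏ j, hermiteFun (α j) (ν * Ξ q j) : ℝ) : ℂ) * H q ∂μ = 0)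
    {g : (Fin d → ℝ) → ℂ} (hg : Measurable g)
    (hgH : Integrable (fun q =>
      g (Ξ q) * (((∏ j, hermiteFun 0 (ν * Ξ q j) : ℝ) : ℂ) * H q)) μ) :
    ∫ q, g (Ξ q) * (((∏ j, hermiteFun 0 (ν * Ξ q j) : ℝ) : ℂ) * H q) ∂μ = 0 := by
  have hG : Integrable (fun q => ((∏ j, hermiteFun 0 (ν * Ξ q j) : ℝ) : ℂ) * H q) μ := by
    obtain ⟨C, -, hC⟩ := exists_abs_prod_hermiteFun_le hν (0 : Fin d → ℕ) 1
    exact integrable_comp_mul_of_le hΞ hH (continuous_prod_hermiteFun ν 0)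
      (fun ξ => by simpa using hC ξ)
  refine integral_comp_mul_eq_zero hΞ hG
    (χ := fun (ζ : Fin d → ℝ) ξ => Complex.exp ((ζ ⬝ᵥ ξ : ℝ) * Complex.I))
    (fun ζ => Continuous.measurable (by simp only [dotProduct]; fun_prop))
    (fun ζ ξ => (Complex.norm_exp_ofReal_mul_I _).le)
    (fun ζ => ⟨-ζ, fun ξ => by rw [← Complex.exp_conj]; simp⟩)
    (fun P P' _ _ hP => ext_of_integral_exp_dotProduct P P' hP) (fun ζ => ?_) hg hgH
  -- decay at rate `∑ |ζ_j| + 1` absorbs the dominating function `e^{|ζ·ξ|}`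
  obtain ⟨C, hC0, hC⟩ := exists_abs_prod_hermiteFun_le hν (0 : Fin d → ℕ) (∑ j, |ζ j| + 1)
  have hsum := hasSum_integral_of_dominated_convergence (μ := μ)
    (F := fun (m : ℕ) q => (Complex.I ^ m / m.factorial : ℂ) *
      ((((ζ ⬝ᵥ Ξ q) ^ m * ∏ j, hermiteFun 0 (ν * Ξ q j) : ℝ) : ℂ) * H q))
    (f := fun q => Complex.exp ((ζ ⬝ᵥ Ξ q : ℝ) * Complex.I) *
      (((∏ j, hermiteFun 0 (ν * Ξ q j) : ℝ) : ℂ) * H q))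
    (fun m q => |ζ ⬝ᵥ Ξ q| ^ m / m.factorial *
      ‖((∏ j, hermiteFun 0 (ν * Ξ q j) : ℝ) : ℂ) * H q‖)
    ?_ ?_ ?_ ?_ ?_
  · refine hsum.unique ?_
    have hz := integral_dotProduct_pow_mul_eq_zero hν hΞ hH h ζ
    simp only [integral_const_mul]
    have hz' : ∀ m,
        ∫ q, (((ζ ⬝ᵥ Ξ q) ^ m * ∏ j, hermiteFun 0 (ν * Ξ q j) : ℝ) : ℂ) * H q ∂μ = 0 :=
      fun m => hz m 0
    simp only [hz', mul_zero]
    exact hasSum_zero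
  · intro m
    have hm : Measurable fun q => (ζ ⬝ᵥ Ξ q) ^ m :=
      (Continuous.measurable (by simp only [dotProduct]; fun_prop :
        Continuous fun ξ => (ζ ⬝ᵥ ξ) ^ m)).comp hΞ
    refine AEStronglyMeasurable.const_mul (((Complex.measurable_ofReal.comp
      hm).aestronglyMeasurable.mul hG.1).congr
      (Filter.Eventually.of_forall fun q => ?_)) _
    simp only [Pi.mul_apply, Function.comp]
    rw [Complex.ofReal_mul, mul_assoc]
  · refine fun m => Filter.Eventually.of_forall fun q => le_of_eq ?_
    rw [Complex.ofReal_mul, mul_assoc, norm_mul, norm_mul, norm_div, norm_pow, Complex.norm_I,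
      Complex.norm_real, Real.norm_eq_abs, abs_pow, Complex.norm_natCast]
    ring
  · exact Filter.Eventually.of_forall fun q =>
      (Real.summable_pow_div_factorial _).mul_right _
  · have e : ∀ q, ∑' m : ℕ, |ζ ⬝ᵥ Ξ q| ^ m / m.factorial *
        ‖((∏ j, hermiteFun 0 (ν * Ξ q j) : ℝ) : ℂ) * H q‖
        = ‖((Real.exp |ζ ⬝ᵥ Ξ q| * ∏ j, hermiteFun 0 (ν * Ξ q j) : ℝ) : ℂ) * H q‖ := by
      intro q
      rw [tsum_mul_right, Complex.ofReal_mul, mul_assoc, norm_mul (Real.exp _ : ℂ),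
        Complex.norm_real (Real.exp _), Real.norm_eq_abs, abs_of_pos (Real.exp_pos _),
        Real.exp_eq_exp_ℝ, NormedSpace.exp_eq_tsum_div]
    simp only [e]
    refine (integrable_comp_mul_of_le
      (w := fun ξ => Real.exp |ζ ⬝ᵥ ξ| * ∏ j, hermiteFun 0 (ν * ξ j)) (C := C) hΞ hH ?_
      fun ξ => ?_).norm
    · exact (by simp only [dotProduct]; fun_prop : Continuous fun ξ => Real.exp |ζ ⬝ᵥ ξ|).mul
        (continuous_prod_hermiteFun ν 0)
    · rw [abs_mul, abs_of_pos (Real.exp_pos _)]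
      refine (mul_le_mul (Real.exp_le_exp.2 (abs_dotProduct_le ζ ξ)) (hC ξ) (abs_nonneg _)
        (Real.exp_pos _).le).trans_eq ?_
      rw [mul_left_comm, ← Real.exp_add]
      congr 2
      ring
  · refine Filter.Eventually.of_forall fun q => ?_
    have e := NormedSpace.expSeries_div_hasSum_exp (((ζ ⬝ᵥ Ξ q : ℝ) : ℂ) * Complex.I)
    rw [← Complex.exp_eq_exp_ℂ] at e
    refine (e.mul_right (((∏ j, hermiteFun 0 (ν * Ξ q j) : ℝ) : ℂ) * H q)).congr_fun ?_
    intro m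
    push_cast
    ring

end

/-! ### Completeness of the eigenfunctions -/

/-- The measure space `ℤ^d × D` on which the integrals of `F` against the `W_n^{a,b} f_α` unfold. -/
def unfoldMeasure (d : ℕ) (r : Fin d → ℕ) : Measure ((Fin d → ℤ) × (CoordIndex d → ℝ)) :=
  Measure.count.prod (volume.restrict (fundamentalDomain d r))

/-- The point `x + k + c` of `ℝ^d`. -/
def unfoldPoint {d : ℕ} (c : Fin d → ℝ) (z : (Fin d → ℤ) × (CoordIndex d → ℝ)) : Fin d → ℝ :=
  fun j => z.2 (.inl j) + z.1 j + c j

/-- The phase `n t + n (k + c) · y`. -/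
def unfoldPhase {d : ℕ} (n : ℤ) (c : Fin d → ℝ) (z : (Fin d → ℤ) × (CoordIndex d → ℝ)) : ℝ :=
  n * z.2 (.inr (.inr ())) + ∑ j, n * (z.1 j + c j) * z.2 (.inr (.inl j))

/-- The density `e^{-2iπ(n t + n (k + c) · y)} F`. -/
def unfoldDensity {d : ℕ} (n : ℤ) (c : Fin d → ℝ) (F : (CoordIndex d → ℝ) → ℂ)
    (z : (Fin d → ℤ) × (CoordIndex d → ℝ)) : ℂ :=
  starRingEnd ℂ (Complex.exp (2 * Real.pi * Complex.I * (unfoldPhase n c z : ℝ))) * F z.2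

theorem measurable_unfoldPoint {d : ℕ} (c : Fin d → ℝ) : Measurable (unfoldPoint c) := by
  refine measurable_pi_lambda _ fun j => (Measurable.add ?_ ?_).add_const _
  · exact (measurable_pi_apply _).comp measurable_snd
  · exact (Measurable.of_discrete (f := fun m : ℤ => (m : ℝ))).comp
      ((measurable_pi_apply j).comp measurable_fst)

theorem measurable_unfoldPhase {d : ℕ} (n : ℤ) (c : Fin d → ℝ) : Measurable (unfoldPhase n c) := by
  refine Measurable.add ?_ (Finset.measurable_fun_sum _ fun j _ => Measurable.mul
    (Measurable.const_mul (Measurable.add_const ?_ _) _) ?_)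
  · exact ((measurable_pi_apply _).comp measurable_snd).const_mul _
  · exact (Measurable.of_discrete (f := fun m : ℤ => (m : ℝ))).comp
      ((measurable_pi_apply j).comp measurable_fst)
  · exact (measurable_pi_apply _).comp measurable_snd

theorem ae_unfoldMeasure (d : ℕ) (r : Fin d → ℕ) :
    ∀ᵐ z ∂unfoldMeasure d r, z.2 ∈ fundamentalDomain d r :=
  Measure.quasiMeasurePreserving_snd.ae (ae_restrict_mem (measurableSet_fundamentalDomain d r))

/-- On `ℤ^d × D` the coordinates `x_j` are bounded, so `e^{-∑|x_j + k_j + c_j|}` is dominated by a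
multiple of the summable `e^{-∑|k_j|}`. -/
theorem integrable_exp_mul_unfoldDensity {d : ℕ} {r : Fin d → ℕ} (n : ℤ) (c : Fin d → ℝ)
    {F : (CoordIndex d → ℝ) → ℂ} (hF : IntegrableOn F (fundamentalDomain d r)) :
    Integrable (fun z => (Real.exp (-∑ j, |unfoldPoint c z j|) : ℂ) * unfoldDensity n c F z)
      (unfoldMeasure d r) := by
  have h1 : Integrable (fun k : Fin d → ℤ => ∏ j, (Real.exp (-1 * |(k j : ℝ)|) : ℂ))
      Measure.count := by
    rw [integrable_count_iff]
    refine (hasSum_prod_of_summable_norm d (fun _ m => (Real.exp (-1 * |(m : ℝ)|) : ℂ))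
      fun j => ?_).2
    simpa [-neg_mul, Complex.norm_exp] using summable_exp_neg_mul_abs one_pos
  have h2 := (h1.mul_prod hF).const_mul ((Real.exp (∑ j, (1 + |c j|)) : ℝ) : ℂ)
  refine h2.mono ?_ ?_
  · refine AEStronglyMeasurable.mul (Measurable.aestronglyMeasurable ?_)
      (AEStronglyMeasurable.mul (Measurable.aestronglyMeasurable ?_) hF.1.comp_snd)
    · refine Complex.measurable_ofReal.comp (Real.measurable_exp.comp (Measurable.neg
        (Finset.measurable_fun_sum _ fun j _ => ?_)))
      exact continuous_abs.measurable.comp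
        ((measurable_pi_apply j).comp (measurable_unfoldPoint c))
    · exact Complex.continuous_conj.measurable.comp (Complex.measurable_exp.comp
        ((Complex.measurable_ofReal.comp (measurable_unfoldPhase n c)).const_mul _))
  · filter_upwards [ae_unfoldMeasure d r] with z hz
    rw [unfoldDensity, norm_mul, norm_mul, RCLike.norm_conj, norm_exp_two_pi, one_mul, norm_mul,
      norm_mul, ← mul_assoc, ← Complex.ofReal_prod, Complex.norm_real, Complex.norm_real,
      Complex.norm_real, ← Real.exp_sum, Real.norm_eq_abs, Real.norm_eq_abs, Real.norm_eq_abs,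
      Real.abs_exp, Real.abs_exp, Real.abs_exp, ← Real.exp_add, ← Finset.sum_neg_distrib,
      ← Finset.sum_add_distrib]
    refine mul_le_mul_of_nonneg_right (Real.exp_le_exp.2 (Finset.sum_le_sum fun j _ => ?_))
      (norm_nonneg _)
    have hx := hz.1 j
    have h3 : |(z.1 j : ℝ)| ≤ |unfoldPoint c z j| + |z.2 (.inl j) + c j| := by
      rw [show (z.1 j : ℝ) = unfoldPoint c z j - (z.2 (.inl j) + c j) by
        rw [unfoldPoint]; ring]
      exact abs_sub _ _
    have h4 : |z.2 (.inl j) + c j| ≤ 1 + |c j| := by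
      refine (abs_add_le _ _).trans (add_le_add_left ?_ _)
      rw [abs_of_nonneg hx.1]
      exact hx.2.le
    linarith

/-- Unfolding: the pairing of `F` with `W_n^{a,b} f_α` is an integral over `ℤ^d × D`. -/
theorem integral_unfoldDensity {d : ℕ} {r : Fin d → ℕ} (n : ℤ) {ν : ℝ} (hν : 0 < ν)
    (c : Fin d → ℝ) (α : Fin d → ℕ) {F : (CoordIndex d → ℝ) → ℂ}
    (hF : IntegrableOn F (fundamentalDomain d r)) :
    ∫ z, ((∏ j, hermiteFun (α j) (ν * unfoldPoint c z j) : ℝ) : ℂ) * unfoldDensity n c F z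
      ∂unfoldMeasure d r = pairing r (hermiteThetaProd n ν c α) F := by
  obtain ⟨C, -, hC⟩ := exists_abs_prod_hermiteFun_le hν α 1
  have hi := integrable_comp_mul_of_le (measurable_unfoldPoint c)
    (integrable_exp_mul_unfoldDensity n c hF) (continuous_prod_hermiteFun ν α)
    (fun ξ => by simpa using hC ξ)
  rw [unfoldMeasure] at hi ⊢
  rw [integral_prod_symm _ hi, pairing]
  refine integral_congr_ae ?_
  filter_upwards [hi.prod_left_ae] with p hp
  rw [integral_countable hp]
  have hterm : ∀ k : Fin d → ℤ,
      ((∏ j, hermiteFun (α j) (ν * unfoldPoint c (k, p) j) : ℝ) : ℂ) * unfoldDensity n c F (k, p)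
        = starRingEnd ℂ (Complex.exp (2 * Real.pi * Complex.I * n * p (.inr (.inr ()))) *
          ∏ j, hermiteThetaTerm n ν (c j) (α j) (k j) (p (.inl j), p (.inr (.inl j)))) * F p := by
    intro k
    rw [unfoldDensity, ← mul_assoc]
    congr 1
    simp only [hermiteThetaTerm, Finset.prod_mul_distrib]
    rw [map_mul, map_mul, ← Complex.exp_sum, mul_left_comm, ← map_mul, ← Complex.exp_add,
      ← Complex.ofReal_prod, Complex.conj_ofReal]
    congr 3
    rw [unfoldPhase]
    push_cast
    rw [mul_add, Finset.mul_sum]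
    congr 1
    · ring
    · exact Finset.sum_congr rfl fun j _ => by ring
  have hprod := (hasSum_prod_of_summable_norm d
    (fun j m => hermiteThetaTerm n ν (c j) (α j) m (p (.inl j), p (.inr (.inl j))))
    fun j => summable_norm_hermiteThetaTerm n hν _ _ _).1
  rw [hermiteThetaProd]
  simp only [hermiteTheta]
  rw [← hprod.tsum_eq, ← tsum_mul_left, Complex.conj_tsum, ← tsum_mul_right]
  refine tsum_congr fun k => ?_
  rw [← hterm]
  simp [Measure.real]

/-- If `F` is orthogonal to the `W_n^{a,b} f_α` for all `α`, with `c = a + b`, then its Fourier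
coefficients with frequencies `-n` in `t`, `-n (k + c)` in `y` and `l` in `x` vanish. -/
theorem integral_exp_mul_eq_zero_of_pairing {d : ℕ} {r : Fin d → ℕ} {n : ℤ} {ν : ℝ} (hν : 0 < ν)
    (c : Fin d → ℝ) {F : (CoordIndex d → ℝ) → ℂ} (hF : IntegrableOn F (fundamentalDomain d r))
    (h : ∀ α, pairing r (hermiteThetaProd n ν c α) F = 0) (l k : Fin d → ℤ) :
    ∫ p in fundamentalDomain d r, Complex.exp (2 * Real.pi * Complex.I *
      (∑ j, (l j : ℝ) * p (.inl j) - unfoldPhase n c (k, p) : ℝ)) * F p = 0 := by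
  obtain ⟨E, hE⟩ : ∃ E : (CoordIndex d → ℝ) → ℂ, E = fun p : CoordIndex d → ℝ =>
      Complex.exp (2 * Real.pi * Complex.I *
        (∑ j, (l j : ℝ) * p (.inl j) - unfoldPhase n c (k, p) : ℝ)) := ⟨_, rfl⟩
  have hEF : ∀ p, Complex.exp (2 * Real.pi * Complex.I *
      (∑ j, (l j : ℝ) * p (.inl j) - unfoldPhase n c (k, p) : ℝ)) * F p = E p * F p := fun p => by
    rw [hE]
  simp only [hEF]
  -- the function `e^{2iπ l·(ξ - c)} / f_0(ξ)` on the cell of `k`, which undoes the unfolding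
  let Q : Set (Fin d → ℝ) := Set.univ.pi fun j => Set.Ico (k j + c j) (k j + c j + 1)
  have hQ : MeasurableSet Q := MeasurableSet.univ_pi fun j => measurableSet_Ico
  let g : (Fin d → ℝ) → ℂ := Q.indicator fun ξ =>
    Complex.exp (2 * Real.pi * Complex.I * (∑ j, l j * (ξ j - c j) : ℝ)) *
      ((∏ j, hermiteFun 0 (ν * ξ j) : ℝ) : ℂ)⁻¹
  have hne : ∀ ξ : Fin d → ℝ, ((∏ j, hermiteFun 0 (ν * ξ j) : ℝ) : ℂ) ≠ 0 := by
    intro ξ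
    rw [Complex.ofReal_ne_zero, Finset.prod_ne_zero_iff]
    intro j _
    rw [hermiteFun_zero]
    exact (Real.exp_pos _).ne'
  have hg : Measurable g := by
    refine Measurable.indicator (Continuous.measurable ?_) hQ
    exact Continuous.mul (by fun_prop) ((Complex.continuous_ofReal.comp
      (continuous_prod_hermiteFun ν 0)).inv₀ hne)
  have hval : ∀ᵐ z ∂unfoldMeasure d r, g (unfoldPoint c z) *
      (((∏ j, hermiteFun 0 (ν * unfoldPoint c z j) : ℝ) : ℂ) * unfoldDensity n c F z)
      = Set.indicator {k} (1 : (Fin d → ℤ) → ℂ) z.1 * (E z.2 * F z.2) := by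
    filter_upwards [ae_unfoldMeasure d r] with z hz
    obtain ⟨k', p⟩ := z
    have hmem : unfoldPoint c (k', p) ∈ Q ↔ k' = k := by
      have hj : ∀ j, unfoldPoint c (k', p) j ∈ Set.Ico (k j + c j) (k j + c j + 1) ↔
          k' j = k j := by
        intro j
        obtain ⟨h0, h1⟩ := hz.1 j
        simp only at h0 h1
        rw [unfoldPoint, Set.mem_Ico]
        simp only
        constructor
        · rintro ⟨h2, h3⟩
          have h4 : (k j : ℝ) < k' j + 1 := by linarith
          have h5 : (k' j : ℝ) < k j + 1 := by linarith
          have h6 : k j < k' j + 1 := by exact_mod_cast h4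
          have h7 : k' j < k j + 1 := by exact_mod_cast h5
          omega
        · intro e
          rw [e]
          constructor <;> linarith
      rw [Set.mem_univ_pi, funext_iff]
      exact forall_congr' hj
    by_cases hk : k' = k
    · subst hk
      simp only [g, Set.indicator_of_mem (hmem.2 rfl), Set.indicator_of_mem (Set.mem_singleton _),
        Pi.one_apply, one_mul]
      rw [mul_assoc, inv_mul_cancel_left₀ (hne _), unfoldDensity, ← mul_assoc,
        conj_exp_two_pi_mul, ← Complex.exp_add, hE]
      congr 1
      have e : (∑ j, l j * (unfoldPoint c (k', p) j - c j) : ℝ)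
          = ∑ j, (l j : ℝ) * p (.inl j) + (∑ j, l j * k' j : ℤ) := by
        push_cast
        rw [← Finset.sum_add_distrib]
        refine Finset.sum_congr rfl fun j _ => ?_
        rw [unfoldPoint]
        ring
      rw [e]
      simp only
      conv_rhs => rw [← one_mul (Complex.exp _), ← exp_two_pi_int (∑ j, l j * k' j),
        ← Complex.exp_add]
      congr 1
      push_cast
      ring
    · simp [g, hk, hmem]
  have hi : Integrable (fun z => g (unfoldPoint c z) *
      (((∏ j, hermiteFun 0 (ν * unfoldPoint c z j) : ℝ) : ℂ) * unfoldDensity n c F z))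
      (unfoldMeasure d r) := by
    refine Integrable.congr ?_ (hval.mono fun z hz => hz.symm)
    refine Integrable.mul_prod (f := Set.indicator {k} (1 : (Fin d → ℤ) → ℂ))
      (g := fun p => E p * F p) ?_ ?_
    · rw [integrable_count_iff]
      refine summable_of_ne_finset_zero (s := {k}) fun k' hk' => ?_
      simp at hk'
      simp [hk']
    · refine hF.bdd_mul (c := 1) (Measurable.aestronglyMeasurable ?_)
        (Filter.Eventually.of_forall fun p => by rw [hE]; exact (norm_exp_two_pi _).le)
      rw [hE]
      refine Continuous.measurable ?_
      simp only [unfoldPhase]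
      fun_prop
  have key := integral_comp_mul_gaussian_eq_zero hν (measurable_unfoldPoint c)
    (integrable_exp_mul_unfoldDensity n c hF)
    (fun α => (integral_unfoldDensity n hν c α hF).trans (h α)) hg hi
  rw [integral_congr_ae hval, unfoldMeasure, integral_prod_mul
    (Set.indicator {k} (1 : (Fin d → ℤ) → ℂ)) fun p => E p * F p,
    integral_indicator (measurableSet_singleton k)] at key
  simpa [Measure.real] using key

/-- Completeness of the eigenfunctions: `F` vanishes since all its Fourier coefficients on the
fundamental domain do. -/
theorem ae_eq_zero_of_pairing_eigenFamily_eq_zero {d : ℕ} {r : Fin d → ℕ} (hr : ∀ j, 0 < r j)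
    {s : ℝ} (hs : 0 < s) {F : (CoordIndex d → ℝ) → ℂ} (hF : IntegrableOn F (fundamentalDomain d r))
    (h : ∀ i : EigenIndex d r, pairing r (pullback (eigenFamily s i)) F = 0) :
    ∀ᵐ p ∂volume.restrict (fundamentalDomain d r), F p = 0 := by
  have hL : ∀ i, 0 < sideLength r i := by
    rintro (j | j | j)
    · exact one_pos
    · exact Nat.cast_pos.2 (hr j)
    · exact one_pos
  rw [fundamentalDomain_eq_pi] at hF ⊢
  refine ae_eq_zero_of_fourier_coeff_eq_zero hL hF fun m => ?_
  rw [← fundamentalDomain_eq_pi] at hF ⊢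
  have hexp : ∀ p : CoordIndex d → ℝ, ∑ i, m i * (p i / sideLength r i)
      = ∑ j, m (.inl j) * p (.inl j) + ∑ j, m (.inr (.inl j)) / r j * p (.inr (.inl j))
        + m (.inr (.inr ())) * p (.inr (.inr ())) := by
    intro p
    simp only [Fintype.sum_sum_type, sideLength, Sum.elim_inl, Sum.elim_inr, div_one,
      Finset.univ_unique, Finset.sum_singleton, PUnit.default_eq_unit, ← add_assoc]
    congr 2
    exact Finset.sum_congr rfl fun j _ => by ring
  -- the pairing is conjugate-linear in its first argument, so the eigenfunctions of the opposite
  -- frequency give the coefficient of frequency `m`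
  rcases eq_or_ne (m (.inr (.inr ()))) 0 with hm | hm
  · have hq : ((fun j => (-m (.inl j) : ℝ), fun j => (-m (.inr (.inl j)) / r j : ℝ)) :
        (Fin d → ℝ) × (Fin d → ℝ)) ∈ dualLattice d r := by
      intro x y hx hy
      choose x' hx' using hx
      choose y' hy' using hy
      refine ⟨∑ j, -m (.inl j) * x' j + ∑ j, -m (.inr (.inl j)) * y' j, ?_⟩
      simp only [dotProduct, hx', hy']
      push_cast
      congr 1
      refine Finset.sum_congr rfl fun j _ => ?_
      have : (r j : ℝ) ≠ 0 := (Nat.cast_pos.2 (hr j)).ne'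
      field_simp
    rw [← h (.inl ⟨_, hq⟩), pairing]
    congr 1
    funext p
    congr 1
    rw [eigenFamily, pullback_chiM, conj_exp_two_pi_mul, hexp, hm]
    congr 1
    simp only [dotProduct, Finset.sum_neg_distrib, neg_mul, neg_div]
    push_cast
    ring
  · obtain ⟨a, b, k, hk⟩ := exists_offset hr (neg_ne_zero.2 hm) fun j => -m (.inr (.inl j))
    have key := integral_exp_mul_eq_zero_of_pairing (frequencyScale_pos hs (neg_ne_zero.2 hm))
      (a.1 + b.1) hF (fun α => by
        rw [← pullback_wM hs (neg_ne_zero.2 hm)]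
        exact h (.inr ⟨⟨_, neg_ne_zero.2 hm⟩, a, b, α⟩)) (fun j => m (.inl j)) k
    rw [← key]
    congr 1
    funext p
    congr 4
    rw [hexp, unfoldPhase]
    simp only [Pi.add_apply, hk]
    push_cast
    simp only [neg_div, neg_mul, Finset.sum_neg_distrib]
    ring

/-! ### The orthogonal basis of `L²(M)` -/

theorem isFiniteMeasure_restrict_fundamentalDomain (d : ℕ) (r : Fin d → ℕ) :
    IsFiniteMeasure (volume.restrict (fundamentalDomain d r)) := by
  have h := integrableOn_fundamentalDomain r (w := fun _ => 1) continuous_const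
  exact (integrable_const_iff_isFiniteMeasure one_ne_zero).1 h

theorem inner_toLp_eq_pairing {d : ℕ} {r : Fin d → ℕ} {s : ℝ} (hs : s ≠ 0)
    {u v : Nilmanifold d r → ℂ} (hu : MemLp u 2 (volumeM d r s)) (hv : MemLp v 2 (volumeM d r s)) :
    inner ℂ (hu.toLp u) (hv.toLp v) = pairing r (pullback u) (pullback v) := by
  rw [L2.inner_def, pairing]
  have hc : AEStronglyMeasurable (fun m => starRingEnd ℂ (u m) * v m) (volumeM d r s) :=
    (Complex.continuous_conj.comp_aestronglyMeasurable hu.1).mul hv.1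
  refine Eq.trans (integral_congr_ae ?_) (integral_volumeM hs hc)
  filter_upwards [hu.coeFn_toLp, hv.coeFn_toLp] with m h1 h2
  rw [h1, h2, RCLike.inner_apply, mul_comm]

theorem ae_eq_zero_of_pairing_eigenFamily {d : ℕ} {r : Fin d → ℕ} (hr : ∀ j, 0 < r j) {s : ℝ}
    (hs : 0 < s) {f : Nilmanifold d r → ℂ} (hfm : StronglyMeasurable f)
    (hfL : MemLp f 2 (volumeM d r s))
    (h : ∀ i : EigenIndex d r, pairing r (pullback (eigenFamily s i)) (pullback f) = 0) :
    f =ᵐ[volumeM d r s] 0 := by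
  have hπ := measurable_proj_coord_symm r
  have hvol : volumeM d r s = (volume.restrict (fundamentalDomain d r)).map
      (fun v => proj r ((coord d).symm v)) := by
    rw [volumeM, riemannianVolume_metric hs.ne']
  have := isFiniteMeasure_restrict_fundamentalDomain d r
  rw [hvol] at hfL ⊢
  have h1 := hfL.integrable one_le_two
  rw [integrable_map_measure hfm.aestronglyMeasurable hπ.aemeasurable] at h1
  exact (ae_map_iff hπ.aemeasurable (measurableSet_eq_fun hfm.measurable measurable_const)).2
    (ae_eq_zero_of_pairing_eigenFamily_eq_zero hr hs h1 h)

theorem exists_orthogonal_basis {d : ℕ} {r : Fin d → ℕ} (hr : ∀ j, 0 < r j) {s : ℝ} (hs : 0 < s) :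
    ∃ e : EigenIndex d r → Lp ℂ 2 (volumeM d r s),
      (∀ i, (e i : Nilmanifold d r → ℂ) =ᵐ[volumeM d r s] eigenFamily s i) ∧
      (∀ i, e i ≠ 0) ∧ (∀ i j, i ≠ j → inner ℂ (e i) (e j) = 0) ∧
      (Submodule.span ℂ (Set.range e)).topologicalClosure = ⊤ := by
  have hc : ∀ i : EigenIndex d r, Continuous (pullback (eigenFamily s i)) :=
    fun i => (smoothM_eigenFamily hs i).continuous
  have hL := fun i => memLp_of_continuous_pullback hs.ne' (hc i)
  refine ⟨fun i => (hL i).toLp _, fun i => (hL i).coeFn_toLp, fun i h0 => ?_, fun i j hij => ?_, ?_⟩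
  · refine pairing_self_ne_zero hr (hc i) (eigenFamily_ne_zero hs i) ?_
    have h1 : (hL i).toLp _ = 0 := h0
    rw [← inner_toLp_eq_pairing hs.ne' (hL i) (hL i), h1, inner_zero_left]
  · rw [inner_toLp_eq_pairing hs.ne']
    exact pairing_eigenFamily_of_ne hs hij
  · rw [Submodule.topologicalClosure_eq_top_iff, Submodule.eq_bot_iff]
    intro f hf
    have hfL := Lp.memLp f
    rw [Lp.eq_zero_iff_ae_eq_zero]
    refine ae_eq_zero_of_pairing_eigenFamily hr hs (Lp.stronglyMeasurable f) hfL fun i => ?_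
    rw [← inner_toLp_eq_pairing hs.ne' (hL i) hfL, Lp.toLp_coeFn]
    exact (Submodule.mem_orthogonal _ _).1 hf _ (Submodule.subset_span ⟨i, rfl⟩)

/-! ### The eigenspaces -/

theorem oscillator_add {d : ℕ} (s κ : ℝ) (j : Fin d) {u v : (CoordIndex d → ℝ) → ℂ}
    (hu : ContDiff ℝ ∞ u) (hv : ContDiff ℝ ∞ v) (p : CoordIndex d → ℝ) :
    oscillator s κ j (u + v) p = oscillator s κ j u p + oscillator s κ j v p := by
  have h1 : ∀ i, partialDeriv i (u + v) = fun q => partialDeriv i u q + partialDeriv i v q :=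
    fun i => funext fun q => partialDeriv_add i (hu.differentiable (by simp) q)
      (hv.differentiable (by simp) q)
  have hd : ∀ {w : (CoordIndex d → ℝ) → ℂ}, ContDiff ℝ ∞ w → ∀ i,
      Differentiable ℝ (partialDeriv i w) := fun hw i =>
    (contDiff_partialDeriv hw (by simp) i : ContDiff ℝ ∞ _).differentiable (by simp)
  simp only [oscillator, h1, partialDeriv_add _ (hd hu _ p) (hd hv _ p), Pi.add_apply]
  ring

theorem oscillator_const_smul {d : ℕ} (s κ : ℝ) (j : Fin d) (c : ℂ) {u : (CoordIndex d → ℝ) → ℂ}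
    (hu : ContDiff ℝ ∞ u) (p : CoordIndex d → ℝ) :
    oscillator s κ j (c • u) p = c * oscillator s κ j u p := by
  have h1 : ∀ i, partialDeriv i (c • u) = fun q => c * partialDeriv i u q :=
    fun i => funext fun q => partialDeriv_const_mul i c (hu.differentiable (by simp) q)
  have hd : ∀ i, Differentiable ℝ (partialDeriv i u) := fun i =>
    (contDiff_partialDeriv hu (by simp) i : ContDiff ℝ ∞ _).differentiable (by simp)
  simp only [oscillator, h1, partialDeriv_const_mul _ _ (hd _ p), Pi.smul_apply, smul_eq_mul]
  ring

theorem continuous_oscillator {d : ℕ} (s κ : ℝ) (j : Fin d) {u : (CoordIndex d → ℝ) → ℂ}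
    (hu : ContDiff ℝ ∞ u) : Continuous (oscillator s κ j u) := by
  have h1 : ∀ i, ContDiff ℝ ∞ (partialDeriv i u) := fun i => contDiff_partialDeriv hu (by simp) i
  have h2 : ∀ i, Continuous (partialDeriv i (partialDeriv i u)) := fun i =>
    (contDiff_partialDeriv (h1 i) (by simp) i : ContDiff ℝ ∞ _).continuous
  have h3 := fun i => (h1 i).continuous
  have h4 := h2 (.inl j)
  have h5 := h2 (.inr (.inl j))
  have h6 := h3 (.inr (.inl j))
  have h7 := hu.continuous
  unfold oscillator
  fun_prop

/-- The space of smooth `u ∈ ℋ_n` with `P u = lam u`, for `P` the Yamabe operator. The hypotheses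
`1 ≤ d` and `0 < s` enter through `HasFrequency.yamabe`, which makes `P` linear on `ℋ_n`. -/
def eigenspace {d : ℕ} (hd : 1 ≤ d) (r : Fin d → ℕ) {s : ℝ} (hs : 0 < s) (n : ℤ) (lam : ℝ) :
    Submodule ℂ (Nilmanifold d r → ℂ) where
  carrier := {u | SmoothM u ∧ InHn n u ∧ YamabeEq s lam u}
  zero_mem' := by
    have hu : SmoothM (0 : Nilmanifold d r → ℂ) := contDiff_const
    have hn : InHn n (0 : Nilmanifold d r → ℂ) := ⟨0, by simp⟩
    refine ⟨hu, hn, fun v => ?_⟩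
    have h := hasFrequency_pullback hu hn
    have h0 : ∀ j, oscillator s (2 * Real.pi * n) j (pullback (0 : Nilmanifold d r → ℂ)) v = 0 :=
      fun j => by
        have e := oscillator_const_smul s (2 * Real.pi * n) j 0 h.contDiff v
        rw [zero_mul, zero_smul] at e
        exact e
    rw [h.yamabe hd hs]
    simp only [h0]
    simp [pullback]
  add_mem' := by
    rintro u v ⟨hu, ⟨g, hg⟩, hue⟩ ⟨hv, ⟨g', hg'⟩, hve⟩
    have hun := hasFrequency_pullback hu ⟨g, hg⟩
    have hvn := hasFrequency_pullback hv ⟨g', hg'⟩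
    refine ⟨hu.add hv, ⟨g + g', fun x y t => by simp [hg, hg', mul_add]⟩, fun p => ?_⟩
    have e1 := hue p
    have e2 := hve p
    rw [hun.yamabe hd hs] at e1
    rw [hvn.yamabe hd hs] at e2
    change CoordGeom.yamabe _ (pullback u + pullback v) p = lam * (pullback u p + pullback v p)
    rw [(hun.add hvn).yamabe hd hs]
    simp only [oscillator_add _ _ _ hun.contDiff hvn.contDiff, Finset.sum_add_distrib,
      Pi.add_apply]
    linear_combination e1 + e2
  smul_mem' := by
    rintro c u ⟨hu, ⟨g, hg⟩, hue⟩
    have hun := hasFrequency_pullback hu ⟨g, hg⟩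
    refine ⟨contDiff_const.smul hu, ⟨c • g, fun x y t => ?_⟩, fun p => ?_⟩
    · simp only [Pi.smul_apply, hg, smul_eq_mul]
      ring
    · have e1 := hue p
      rw [hun.yamabe hd hs] at e1
      change CoordGeom.yamabe _ (c • pullback u) p = lam * (c • pullback u p)
      rw [(hun.const_smul c).yamabe hd hs]
      simp only [oscillator_const_smul _ _ _ _ hun.contDiff, ← Finset.mul_sum, Pi.smul_apply,
        smul_eq_mul]
      linear_combination c * e1

/-- The index set of the functions `W_n^{a,b} f_α` with `|α| = m`. -/
abbrev LevelIndex (d : ℕ) (r : Fin d → ℕ) (n : ℤ) (m : ℕ) : Type :=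
  setA d n × setB d r n × {β : Fin d → ℕ // ∑ j, β j = m}

/-- The functions `W_n^{a,b} f_α` with `|α| = m`. -/
def levelFamily {d : ℕ} {r : Fin d → ℕ} (s : ℝ) (n : ℤ) (m : ℕ) (i : LevelIndex d r n m) :
    Nilmanifold d r → ℂ :=
  wM s n i.1 i.2.1 i.2.2.1

theorem card_setA (d : ℕ) (n : ℤ) : Finite (setA d n) ∧ Nat.card (setA d n) = n.natAbs ^ d := by
  let f : (Fin d → Fin n.natAbs) → setA d n := fun i =>
    ⟨fun j => (i j : ℕ) / n.natAbs, fun j => ⟨i j, (i j).2, rfl⟩⟩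
  have hf : Function.Bijective f := by
    refine ⟨fun i i' h => funext fun j => Fin.ext ?_, fun a => ?_⟩
    · have h1 := congrFun (congrArg Subtype.val h) j
      have h2 : (n.natAbs : ℝ) ≠ 0 := by
        have h3 : 0 < n.natAbs := (Nat.zero_le _).trans_lt (i j).2
        exact_mod_cast h3.ne'
      simpa only [f, div_left_inj' h2, Nat.cast_inj] using h1
    · choose i hi ha using a.2
      exact ⟨fun j => ⟨i j, hi j⟩, Subtype.ext (funext fun j => (ha j).symm)⟩
  refine ⟨Finite.of_surjective f hf.2, ?_⟩
  rw [← Nat.card_eq_of_bijective f hf]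
  simp

theorem card_setB {d : ℕ} (r : Fin d → ℕ) {n : ℤ} (hn : n ≠ 0) :
    Finite (setB d r n) ∧ Nat.card (setB d r n) = ∏ j, r j := by
  let f : (∀ j, Fin (r j)) → setB d r n := fun i =>
    ⟨fun j => (i j : ℕ) / (n.natAbs * r j), fun j => ⟨i j, (i j).2, rfl⟩⟩
  have hf : Function.Bijective f := by
    refine ⟨fun i i' h => funext fun j => Fin.ext ?_, fun a => ?_⟩
    · have h1 := congrFun (congrArg Subtype.val h) j
      have h2 : (n.natAbs : ℝ) * r j ≠ 0 := by
        have h3 : 0 < n.natAbs * r j :=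
          Nat.mul_pos (Int.natAbs_pos.2 hn) ((Nat.zero_le _).trans_lt (i j).2)
        exact_mod_cast h3.ne'
      simpa only [f, div_left_inj' h2, Nat.cast_inj] using h1
    · choose i hi ha using a.2
      exact ⟨fun j => ⟨i j, hi j⟩, Subtype.ext (funext fun j => (ha j).symm)⟩
  refine ⟨Finite.of_surjective f hf.2, ?_⟩
  rw [← Nat.card_eq_of_bijective f hf]
  simp

/-- Stars and bars, through multisets of size `m` in `Fin d`. -/
theorem card_sum_eq {d : ℕ} (hd : 1 ≤ d) (m : ℕ) : Finite {β : Fin d → ℕ // ∑ j, β j = m} ∧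
    Nat.card {β : Fin d → ℕ // ∑ j, β j = m} = (m + d - 1).choose (d - 1) := by
  have e := Sym.equivNatSumOfFintype (Fin d) m
  refine ⟨Finite.of_equiv _ e, ?_⟩
  rw [← Nat.card_congr e, Nat.card_eq_fintype_card, Sym.card_sym_eq_choose, Fintype.card_fin,
    add_comm]
  exact Nat.choose_symm_of_eq_add (by omega)

theorem card_levelIndex {d : ℕ} (hd : 1 ≤ d) (r : Fin d → ℕ) {n : ℤ} (hn : n ≠ 0) (m : ℕ) :
    Finite (LevelIndex d r n m) ∧ Nat.card (LevelIndex d r n m)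
      = n.natAbs ^ d * (∏ j, r j) * (m + d - 1).choose (d - 1) := by
  obtain ⟨h1, c1⟩ := card_setA d n
  obtain ⟨h2, c2⟩ := card_setB r hn
  obtain ⟨h3, c3⟩ := card_sum_eq hd m
  refine ⟨inferInstance, ?_⟩
  rw [Nat.card_prod, Nat.card_prod, c1, c2, c3, mul_assoc]

theorem pairing_levelFamily_of_ne {d : ℕ} {r : Fin d → ℕ} {s : ℝ} (hs : 0 < s) {n : ℤ}
    (hn : n ≠ 0) {m : ℕ} {i j : LevelIndex d r n m} (h : i ≠ j) :
    pairing r (pullback (levelFamily s n m i)) (pullback (levelFamily s n m j)) = 0 := by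
  obtain ⟨a, b, β, hβ⟩ := i
  obtain ⟨a', b', β', hβ'⟩ := j
  refine pairing_eigenFamily_of_ne hs (i := .inr ⟨⟨n, hn⟩, a, b, β⟩)
    (j := .inr ⟨⟨n, hn⟩, a', b', β'⟩) fun e => h ?_
  simp only [Sum.inr.injEq, Sigma.mk.injEq, heq_eq_eq, true_and, Prod.mk.injEq] at e
  obtain ⟨rfl, rfl, rfl⟩ := e
  rfl

/-- The pairing against a finite linear combination. -/
theorem pairing_sub_sum {d : ℕ} {r : Fin d → ℕ} {κ : Type*} [Fintype κ]
    {v u : (CoordIndex d → ℝ) → ℂ} {w : κ → (CoordIndex d → ℝ) → ℂ} (hv : Continuous v)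
    (hu : Continuous u) (hw : ∀ i, Continuous (w i)) (c : κ → ℂ) :
    pairing r v (fun p => u p - ∑ i, c i * w i p)
      = pairing r v u - ∑ i, c i * pairing r v (w i) := by
  have hi : ∀ {f : (CoordIndex d → ℝ) → ℂ}, Continuous f → Integrable
      (fun p => starRingEnd ℂ (v p) * f p) (volume.restrict (fundamentalDomain d r)) :=
    fun hf => integrableOn_fundamentalDomain r (continuous_conj_mul hv hf)
  simp only [pairing, mul_sub, Finset.mul_sum, mul_left_comm _ (c _)]
  rw [integral_sub (hi hu) (integrable_finsetSum _ fun i _ => (hi (hw i)).const_mul _),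
    integral_finsetSum _ fun i _ => (hi (hw i)).const_mul _]
  simp only [integral_const_mul]

/-- The Yamabe operator is symmetric, so an eigenfunction in `ℋ_n` is orthogonal to all
`W_n^{a,b} f_β` with a different eigenvalue. -/
theorem pairing_wM_of_mem_eigenspace {d : ℕ} (hd : 1 ≤ d) {r : Fin d → ℕ} {s : ℝ} (hs : 0 < s)
    {n : ℤ} (hn : n ≠ 0) {m : ℕ} {u : Nilmanifold d r → ℂ}
    (hu : u ∈ eigenspace hd r hs n (muW d s n m)) (a : setA d n) (b : setB d r n) {β : Fin d → ℕ}
    (hβ : ∑ j, β j ≠ m) : pairing r (pullback (wM s n a b β)) (pullback u) = 0 := by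
  obtain ⟨hus, hun, hue⟩ := hu
  have hf := hasFrequency_pullback hus hun
  have hw := hasFrequency_wM hs hn a b β
  set v := pullback (wM s n a b β) with hv
  have h1 : ∀ j, pairing r v (oscillator s (2 * Real.pi * n) j (pullback u))
      = (-(2 * Real.pi * |(n : ℝ)| * s * (2 * β j + 1)) : ℝ) * pairing r v (pullback u) := by
    intro j
    rw [pairing_oscillator s j hf hw, hv, pullback_wM hs hn,
      funext (oscillator_hermiteThetaProd (frequencyScale_pos hs hn) (frequencyScale_sq hs n)
        _ β j),
      pairing, pairing, ← integral_const_mul]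
    congr 1
    funext p
    rw [map_mul, ← Complex.ofReal_neg, Complex.conj_ofReal, frequencyScale_sq hs, mul_assoc]
  have h2 : ∑ j, pairing r v (oscillator s (2 * Real.pi * n) j (pullback u))
      = (-(2 * Real.pi * |(n : ℝ)| * s * (d + 2 * m)) : ℝ) * pairing r v (pullback u) := by
    have e : ∀ p, ∑ j, oscillator s (2 * Real.pi * n) j (pullback u) p
        = (-(2 * Real.pi * |(n : ℝ)| * s * (d + 2 * m)) : ℝ) * pullback u p := by
      intro p
      have e1 := hue p
      rw [hf.yamabe hd hs, muW] at e1
      push_cast at e1 ⊢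
      linear_combination -e1
    simp only [pairing]
    rw [← integral_const_mul, ← integral_finsetSum _ fun j _ =>
      integrableOn_fundamentalDomain r (continuous_conj_mul hw.contDiff.continuous
        (continuous_oscillator _ _ j hf.contDiff))]
    congr 1
    funext p
    rw [← Finset.mul_sum, e, mul_left_comm]
  simp only [h1] at h2
  rw [← Finset.sum_mul, ← sub_eq_zero, ← sub_mul, ← Complex.ofReal_sum, ← Complex.ofReal_sub] at h2
  refine (mul_eq_zero.1 h2).resolve_left ?_
  rw [Complex.ofReal_eq_zero, Finset.sum_neg_distrib, ← Finset.mul_sum, Finset.sum_add_distrib,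
    ← Finset.mul_sum, ← Nat.cast_sum]
  have h3 : ((∑ j, β j : ℕ) : ℝ) - m ≠ 0 := sub_ne_zero.2 (by exact_mod_cast hβ)
  have h4 : |(n : ℝ)| ≠ 0 := abs_ne_zero.2 (by exact_mod_cast hn)
  have h5 : (-(2 * Real.pi * |(n : ℝ)| * s * (2 * ((∑ j, β j : ℕ) : ℝ) + ∑ _j : Fin d, 1))
      - -(2 * Real.pi * |(n : ℝ)| * s * (d + 2 * m)))
      = -(4 * Real.pi * |(n : ℝ)| * s * (((∑ j, β j : ℕ) : ℝ) - m)) := by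
    simp
    ring
  rw [h5]
  exact neg_ne_zero.2 (mul_ne_zero (mul_ne_zero (mul_ne_zero (by positivity) h4) hs.ne') h3)

/-- An eigenfunction minus its orthogonal projection to the span is orthogonal to the whole family
of eigenfunctions, so it vanishes by completeness. -/
theorem span_levelFamily {d : ℕ} (hd : 1 ≤ d) {r : Fin d → ℕ} (hr : ∀ j, 0 < r j) {s : ℝ}
    (hs : 0 < s) {n : ℤ} (hn : n ≠ 0) (m : ℕ) :
    Submodule.span ℂ (Set.range (levelFamily (r := r) s n m))
      = eigenspace hd r hs n (muW d s n m) := by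
  have := (card_levelIndex hd r hn m).1
  have := Fintype.ofFinite (LevelIndex d r n m)
  have hmem : ∀ i, levelFamily (r := r) s n m i ∈ eigenspace hd r hs n (muW d s n m) := by
    rintro ⟨a, b, β, rfl⟩
    exact ⟨smoothM_wM hs hn a b β, inHn_wM hs hn a b β, yamabeEq_wM hd hs hn a b β⟩
  refine le_antisymm (Submodule.span_le.2 ?_) fun u hu => ?_
  · rintro _ ⟨i, rfl⟩
    exact hmem i
  set w := levelFamily (r := r) s n m with hw
  have hcw : ∀ i, Continuous (pullback (w i)) := fun i => (hmem i).1.continuous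
  have hne : ∀ i, pairing r (pullback (w i)) (pullback (w i)) ≠ 0 := fun i =>
    pairing_self_ne_zero hr (hcw i) (wM_ne_zero hs hn _ _ _)
  -- the orthogonal projection of `u` to the span of the family
  let c : LevelIndex d r n m → ℂ := fun i =>
    pairing r (pullback (w i)) (pullback u) / pairing r (pullback (w i)) (pullback (w i))
  have hS : ∑ i, c i • w i ∈ Submodule.span ℂ (Set.range w) :=
    Submodule.sum_mem _ fun i _ => Submodule.smul_mem _ _ (Submodule.subset_span ⟨i, rfl⟩)
  have hSE : ∑ i, c i • w i ∈ eigenspace hd r hs n (muW d s n m) :=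
    Submodule.sum_mem _ fun i _ => Submodule.smul_mem _ _ (hmem i)
  have hv := Submodule.sub_mem _ hu hSE
  have hvf := hasFrequency_pullback hv.1 hv.2.1
  have hpb : pullback (u - ∑ i, c i • w i)
      = fun p => pullback u p - ∑ i, c i * pullback (w i) p := by
    funext p
    simp [pullback, Finset.sum_apply]
  have hzero : u - ∑ i, c i • w i = 0 := by
    refine eq_zero_of_pullback_ae_eq_zero hr hv.1.continuous
      (ae_eq_zero_of_pairing_eigenFamily_eq_zero hr hs
        (integrableOn_fundamentalDomain r hv.1.continuous) ?_)
    rintro (q | ⟨⟨n', hn'⟩, a, b, β⟩)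
    · exact pairing_eq_zero_of_frequency_ne hn hvf (hasFrequency_chiM q)
    · by_cases hnn : n' = n
      · subst hnn
        by_cases hβ : ∑ j, β j = m
        · change pairing r (pullback (w (a, b, ⟨β, hβ⟩))) _ = 0
          generalize (a, b, (⟨β, hβ⟩ : {β : Fin d → ℕ // ∑ j, β j = m})) = i
          rw [hpb, pairing_sub_sum (hcw i) hu.1.continuous hcw, Finset.sum_eq_single i
            (fun j _ hj => by rw [pairing_levelFamily_of_ne hs hn hj.symm, mul_zero]) (by simp),
            div_mul_cancel₀ _ (hne i), sub_self]
        · exact pairing_wM_of_mem_eigenspace hd hs hn' hv a b hβ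
      · exact pairing_eq_zero_of_frequency_ne (Ne.symm hnn) hvf (hasFrequency_wM hs hn' a b β)
  rw [sub_eq_zero.1 hzero]
  exact hS

theorem linearIndependent_levelFamily {d : ℕ} {r : Fin d → ℕ} (hr : ∀ j, 0 < r j)
    {s : ℝ} (hs : 0 < s) {n : ℤ} (hn : n ≠ 0) (m : ℕ) :
    LinearIndependent ℂ (levelFamily (r := r) s n m) := by
  classical
  have hc : ∀ i, Continuous (pullback (levelFamily (r := r) s n m i)) := fun i =>
    (smoothM_wM hs hn _ _ _).continuous
  rw [linearIndependent_iff']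
  intro t g hg i hi
  have hpb : (fun p => pullback (0 : Nilmanifold d r → ℂ) p
      - ∑ j : t, g j * pullback (levelFamily (r := r) s n m j) p) = 0 := by
    funext p
    have e := congrFun hg (proj r ((coord d).symm p))
    rw [← Finset.sum_coe_sort, Finset.sum_apply] at e
    simp only [Pi.smul_apply, smul_eq_mul, Pi.zero_apply] at e
    simp only [pullback, Pi.zero_apply, e, sub_zero]
  have h := pairing_sub_sum (r := r) (hc i) (u := pullback (0 : Nilmanifold d r → ℂ))
    continuous_const (w := fun j : t => pullback (levelFamily (r := r) s n m j))
    (fun j => hc j) fun j => g j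
  rw [hpb, Finset.sum_eq_single (⟨i, hi⟩ : t) (fun j _ hj => by
    rw [pairing_levelFamily_of_ne hs hn (fun e => hj (Subtype.ext e.symm)), mul_zero])
    (by simp)] at h
  have h0 : ∀ v : (CoordIndex d → ℝ) → ℂ, pairing r v 0 = 0 := fun v => by simp [pairing]
  rw [h0, show pullback (0 : Nilmanifold d r → ℂ) = 0 from rfl, h0, zero_sub, zero_eq_neg] at h
  exact (mul_eq_zero.1 h).resolve_right
    (pairing_self_ne_zero hr (hc i) (wM_ne_zero hs hn _ _ _))

theorem finrank_eigenspace {d : ℕ} (hd : 1 ≤ d) {r : Fin d → ℕ} (hr : ∀ j, 0 < r j) {s : ℝ}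
    (hs : 0 < s) {n : ℤ} (hn : n ≠ 0) (m : ℕ) :
    Module.finrank ℂ (eigenspace hd r hs n (muW d s n m))
      = n.natAbs ^ d * (∏ j, r j) * (m + d - 1).choose (d - 1) := by
  obtain ⟨hfin, hcard⟩ := card_levelIndex hd r hn m
  have := Fintype.ofFinite (LevelIndex d r n m)
  rw [← span_levelFamily hd hr hs hn,
    finrank_span_eq_card (linearIndependent_levelFamily hr hs hn m),
    ← Nat.card_eq_fintype_card, hcard]

/-! ### Theta functions -/

theorem hermiteThetaTerm_frequencyScale {n : ℤ} (s a b : ℝ) (k : ℕ) (m : ℤ) (x y : ℝ) :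
    hermiteThetaTerm n (frequencyScale s n) (a + b) k m (x, y) =
      (hermiteFun k (√(2 * Real.pi * |(n : ℝ)| * s) * (x + m + a + b)) : ℂ) *
        Complex.exp (2 * Real.pi * Complex.I * n * (m + a + b) * y) := by
  simp only [hermiteThetaTerm, frequencyScale, Complex.ofReal_add, add_assoc]

theorem wM_zero_eq_jacobiTheta₂ {d : ℕ} {r : Fin d → ℕ} {s : ℝ} (hs : 0 < s) {n : ℤ} (hn : n ≠ 0)
    (a : setA d n) (b : setB d r n) (x y : Fin d → ℝ) (t : ℝ) :
    wM s n a b 0 (proj r ⟨x, y, t⟩) =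
      Complex.exp (2 * Real.pi * Complex.I * n * t) *
        (Real.exp (-Real.pi * |(n : ℝ)| * s * ((x + a.1 + b.1) ⬝ᵥ (x + a.1 + b.1))) : ℂ) *
        Complex.exp (2 * Real.pi * Complex.I * n * (((a.1 + b.1) ⬝ᵥ y : ℝ) : ℂ)) *
        ∏ j, jacobiTheta₂ (n * (y j + (n.sign : ℂ) * Complex.I * s * (x j + a.1 j + b.1 j)))
          (Complex.I * |(n : ℝ)| * s) := by
  rw [wM_proj hs hn]
  simp only [Pi.zero_apply, hermiteTheta_zero_eq_jacobiTheta₂ n (frequencyScale_sq hs n),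
    Finset.prod_mul_distrib]
  rw [← Complex.exp_sum, ← Complex.ofReal_prod, ← Real.exp_sum, ← mul_assoc, ← mul_assoc]
  congr 1
  · congr 3
    · congr 1
      rw [← Finset.mul_sum]
      congr 1
      exact Finset.sum_congr rfl fun j _ => by simp only [Pi.add_apply]; ring
    · rw [← Finset.mul_sum]
      simp [dotProduct]
  · refine Finset.prod_congr rfl fun j _ => ?_
    push_cast
    simp only [add_assoc]

end Heisenberg

end

theorem mainTheorem10 (d : ℕ) (hd : 1 ≤ d) (r : Fin d → ℕ) (hr : ∀ j, 0 < r j)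
    (hdvd : ∀ i j : Fin d, (i : ℕ) + 1 = j → r i ∣ r j) (s : ℝ) (hs : 0 < s) :
    -- the family is an orthogonal basis of `L²(M)`
    (∃ e : Heisenberg.EigenIndex d r → Lp ℂ 2 (Heisenberg.volumeM d r s),
      (∀ i, (e i : Heisenberg.Nilmanifold d r → ℂ)
        =ᵐ[Heisenberg.volumeM d r s] Heisenberg.eigenFamily s i) ∧
      (∀ i, e i ≠ 0) ∧
      (∀ i j, i ≠ j → inner ℂ (e i) (e j) = 0) ∧
      (Submodule.span ℂ (Set.range e)).topologicalClosure = ⊤) ∧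
    -- each `χ_{(ξ,η)}` is an eigenfunction
    (∀ p : Heisenberg.dualLattice d r,
      Heisenberg.IsYamabeEigenfunction s (Heisenberg.lambdaChar s p.1.1 p.1.2)
        (Heisenberg.chiM p)) ∧
    (∀ n : ℤ, n ≠ 0 → ∀ α : Fin d → ℕ,
      (∀ (a : Heisenberg.setA d n) (b : Heisenberg.setB d r n),
        -- each `W_n^{a,b} f_α` is an eigenfunction in `ℋ_n`
        (Heisenberg.InHn n (Heisenberg.wM s n a b α) ∧
          Heisenberg.IsYamabeEigenfunction s (Heisenberg.muW d s n (∑ j, α j))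
            (Heisenberg.wM s n a b α)) ∧
        -- the defining series converges, and factorizes
        (∀ x y : Fin d → ℝ, Summable fun k : Fin d → ℤ =>
          Heisenberg.fAlpha s n α (x + (fun j => (k j : ℝ)) + a + b) *
            Complex.exp (2 * Real.pi * Complex.I * n *
              ((((fun j => (k j : ℝ)) + a.1 + b.1) ⬝ᵥ y : ℝ) : ℂ))) ∧
        (∀ (x y : Fin d → ℝ) (t : ℝ),
          Heisenberg.wM s n a b α (Heisenberg.proj r ⟨x, y, t⟩) =
            Complex.exp (2 * Real.pi * Complex.I * n * t) *
              ∏ j, ∑' k : ℤ,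
                (Heisenberg.hermiteFun (α j)
                  (√(2 * Real.pi * |(n : ℝ)| * s) * (x j + k + a.1 j + b.1 j)) : ℂ) *
                Complex.exp (2 * Real.pi * Complex.I * n * (k + a.1 j + b.1 j) * y j)) ∧
        (∀ (j : Fin d) (x y : ℝ), Summable fun k : ℤ =>
          (Heisenberg.hermiteFun (α j)
            (√(2 * Real.pi * |(n : ℝ)| * s) * (x + k + a.1 j + b.1 j)) : ℂ) *
          Complex.exp (2 * Real.pi * Complex.I * n * (k + a.1 j + b.1 j) * y)) ∧
        -- for `α = 0` it is given by Jacobi's theta function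
        (α = 0 → ∀ (x y : Fin d → ℝ) (t : ℝ),
          Heisenberg.wM s n a b α (Heisenberg.proj r ⟨x, y, t⟩) =
            Complex.exp (2 * Real.pi * Complex.I * n * t) *
              (Real.exp (-Real.pi * |(n : ℝ)| * s * ((x + a.1 + b.1) ⬝ᵥ (x + a.1 + b.1))) : ℂ) *
              Complex.exp (2 * Real.pi * Complex.I * n * (((a.1 + b.1) ⬝ᵥ y : ℝ) : ℂ)) *
              ∏ j, jacobiTheta₂
                (n * (y j + (n.sign : ℂ) * Complex.I * s * (x j + a.1 j + b.1 j)))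
                (Complex.I * |(n : ℝ)| * s))) ∧
      -- the multiplicity of `μ(n,|α|)` in `ℋ_n`
      (∃ E : Submodule ℂ (Heisenberg.Nilmanifold d r → ℂ),
        (∀ u, u ∈ E ↔ Heisenberg.SmoothM u ∧ Heisenberg.InHn n u ∧
          Heisenberg.YamabeEq s (Heisenberg.muW d s n (∑ j, α j)) u) ∧
        Module.finrank ℂ E =
          n.natAbs ^ d * (∏ j, r j) * (∑ j, α j + d - 1).choose (d - 1))) := by
  refine ⟨Heisenberg.exists_orthogonal_basis hr hs, fun p => ⟨Heisenberg.smoothM_chiM p,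
    Heisenberg.chiM_ne_zero p, Heisenberg.yamabeEq_chiM hd hs p⟩, fun n hn α => ⟨fun a b =>
    ⟨⟨Heisenberg.inHn_wM hs hn a b α, Heisenberg.smoothM_wM hs hn a b α,
      Heisenberg.wM_ne_zero hs hn a b α, Heisenberg.yamabeEq_wM hd hs hn a b α⟩,
      fun x y => (Heisenberg.summable_norm_fAlpha_mul_exp hs hn α a.1 b.1 x y).of_norm,
      fun x y t => ?_, fun j x y => ?_, ?_⟩,
    Heisenberg.eigenspace hd r hs n _, fun u => Iff.rfl,
    Heisenberg.finrank_eigenspace hd hr hs hn _⟩⟩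
  · rw [Heisenberg.wM_proj hs hn]
    simp only [Heisenberg.hermiteTheta, Heisenberg.hermiteThetaTerm_frequencyScale]
  · simp only [← Heisenberg.hermiteThetaTerm_frequencyScale]
    exact (Heisenberg.summable_norm_hermiteThetaTerm n (Heisenberg.frequencyScale_pos hs hn)
      _ _ _).of_norm
  · rintro rfl x y t
    exact Heisenberg.wM_zero_eq_jacobiTheta₂ hs hn a b x y t
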